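/- For a separable metrizable space whose topology is completely metrizable (Polish space) $X$, let $\mathcal P(X)$ be the set of Borel probability measures on $X$ with the topology of weak convergence, and for a metric space $(X,d)$ whose topology is Polish, let $\mathcal P_2(X)$ be the set of Borel probability measures $\mu$ on $X$ with $\int d^2(x_0,x)\,d\mu(x)<\infty$ for some $x_0\in X$, with the Wasserstein distance $W_2$. For a map $f$ put $[f](\mu)=f_\#\mu$; $\mathcal P^{(n)}$, $\mathcal P_2^{(n)}$ and $[f]^{(n)}$ denote $n$-fold iterates ($n\ge 0$, the $0$-th iterate being the identity). A map $f:X\to Y$ of metric spaces has linear growth if there are $x_0\in X$, $y_0\in Y$, $C>0$ with $d_Y(y_0,f(x))\le C(1+d_X(x_0,x))$ for all $x$; it has linearly growing antecedents if it is surjective and there are $x_0\in X$, $C>0$ such that every $y\in Y$ has some $x\in f^{-1}(y)$ with $d_X(x_0,x)\le C(1+d_Y(f(x_0),y))$. For $f_1:X\to Z$, $f_2:Y\to Z$ let $X\times_Z Y=\{(x,y): f_1(x)=f_2(y)\}$, with the distance $\sqrt{d_X^2+d_Y^2}$ if $X,Y$ are metric spaces. (1) Let $\mathcal M$ be a complete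 connected Riemannian manifold without boundary, $T\mathcal M$ its tangent bundle with the geodesic distance of the Sasaki metric and projection $\pi:T\mathcal M\to\mathcal M$, and $T^2\mathcal M=\{(x,v_1,v_2): x\in\mathcal M,\ v_1,v_2\in T_x\mathcal M\}$ with $d^2((x,v_1,v_2),(x',v_1',v_2'))=d^2((x,v_1),(x',v_1'))+d^2((x,v_2),(x',v_2'))$ and projections $\pi_i(x,v_1,v_2)=(x,v_i)$, $i=1,2$. Then for every $n\ge0$ the maps $[\pi]^{(n)}$, $[\pi_1]^{(n)}$, $[\pi_2]^{(n)}$ between the spaces $\mathcal P_2^{(n)}(T^2\mathcal M)$, $\mathcal P_2^{(n)}(T\mathcal M)$, $\mathcal P_2^{(n)}(\mathcal M)$ are continuous with linear growth, $[\pi]^{(n)}\circ[\pi_1]^{(n)}=[\pi]^{(n)}\circ[\pi_2]^{(n)}$, and $$([\pi_1]^{(n)},[\pi_2]^{(n)}):\mathcal P_2^{(n)}(T^2\mathcal M)\to\mathcal P_2^{(n)}(T\mathcal M)\times_{\mathcal P_2^{(n)}(\mathcal M)}\mathcal P_2^{(n)}(T\mathcal M)$$ is surjective. In particular, for all $\mu\in\mathcal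 P_2^{(n)}(\mathcal M)$ and all $\gamma_1,\gamma_2\in\mathcal P_2^{(n)}(T\mathcal M)$ with $[\pi]^{(n)}(\gamma_1)=[\pi]^{(n)}(\gamma_2)=\mu$ there is a coupling, i.e. an $\alpha\in\mathcal P_2^{(n)}(T^2\mathcal M)$ with $[\pi_1]^{(n)}(\alpha)=\gamma_1$ and $[\pi_2]^{(n)}(\alpha)=\gamma_2$. (2) Let $W,X,Y,Z$ be Polish spaces and $f_1:X\to Z$, $f_2:Y\to Z$, $g_1:W\to X$, $g_2:W\to Y$ continuous with $f_1\circ g_1=f_2\circ g_2$. If $(g_1,g_2):W\to X\times_Z Y$ is surjective, then for every $n\ge0$ one has $[f_1]^{(n)}\circ[g_1]^{(n)}=[f_2]^{(n)}\circ[g_2]^{(n)}$ on $\mathcal P^{(n)}(W)$, and $([g_1]^{(n)},[g_2]^{(n)}):\mathcal P^{(n)}(W)\to\mathcal P^{(n)}(X)\times_{\mathcal P^{(n)}(Z)}\mathcal P^{(n)}(Y)$ is surjective. (3) Let $W,X,Y,Z$ be metric spaces whose topologies are Polish, and $f_1,f_2,g_1,g_2$ as in (2) continuous with linear growth and with $f_1\circ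 g_1=f_2\circ g_2$. If $(g_1,g_2):W\to X\times_Z Y$ has linearly growing antecedents, then for every $n\ge0$ the maps $[f_i]^{(n)}$, $[g_i]^{(n)}$ between the $\mathcal P_2^{(n)}$ spaces are continuous with linear growth, $[f_1]^{(n)}\circ[g_1]^{(n)}=[f_2]^{(n)}\circ[g_2]^{(n)}$, and $([g_1]^{(n)},[g_2]^{(n)}):\mathcal P_2^{(n)}(W)\to\mathcal P_2^{(n)}(X)\times_{\mathcal P_2^{(n)}(Z)}\mathcal P_2^{(n)}(Y)$ is surjective, with linearly growing antecedents. -/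

import Mathlib

open MeasureTheory Bundle Manifold
open scoped ENNReal NNReal ContDiff Topology

universe u v w z

noncomputable section

/-! ### The functor `P` on topological spaces and its iterates -/

namespace WeakHierarchy

/-- `P(X)`: the Borel probability measures on `X`, with the topology of weak convergence. -/
def P (X : TopCat.{u}) : TopCat.{u} :=
  letI : MeasurableSpace X := borel X
  haveI : BorelSpace X := ⟨rfl⟩
  TopCat.of (ProbabilityMeasure X)

/-- `P(f) = [f]`: the pushforward map `μ ↦ f_# μ`, as a continuous map `P(X) → P(Y)`. -/
def P.map {X : TopCat.{u}} {Y : TopCat.{v}} (f : C(X, Y)) : C(P X, P Y) :=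
  letI : MeasurableSpace X := borel X
  haveI : BorelSpace X := ⟨rfl⟩
  letI : MeasurableSpace Y := borel Y
  haveI : BorelSpace Y := ⟨rfl⟩
  { toFun := fun μ : ProbabilityMeasure X =>
      (μ.map f.continuous.measurable.aemeasurable : ProbabilityMeasure Y)
    continuous_toFun := ProbabilityMeasure.continuous_map f.continuous }

/-- `P⁽ⁿ⁾(X)`. -/
def iter (X : TopCat.{u}) : ℕ → TopCat.{u}
  | 0 => X
  | n + 1 => P (iter X n)

/-- `P⁽ⁿ⁾(f) = [f]⁽ⁿ⁾`. -/
def iterMap {X : TopCat.{u}} {Y : TopCat.{v}} (f : C(X, Y)) :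
    (n : ℕ) → C(iter X n, iter Y n)
  | 0 => f
  | n + 1 => P.map (iterMap f n)

end WeakHierarchy

/-! ### Maps into set-theoretic fiber products -/

/-- The map `w ↦ (g₁ w, g₂ w)` into the fiber product `{(x, y) | f₁ x = f₂ y}`, induced by
`g₁, g₂` with `f₁ ∘ g₁ = f₂ ∘ g₂`. -/
def fiberLift {W X Y Z : Type*} {g₁ : W → X} {g₂ : W → Y} {f₁ : X → Z} {f₂ : Y → Z}
    (h : ∀ w, f₁ (g₁ w) = f₂ (g₂ w)) (w : W) : Function.Pullback f₁ f₂ :=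
  ⟨(g₁ w, g₂ w), h w⟩

/-! ### Spaces with a distance, the functor `P₂` and its iterates -/

/-- A type together with a `[0, ∞]`-valued distance function. The axioms of a metric are not
bundled: the base spaces below are metric spaces. The topology and the Borel `σ`-algebra are
those of the distance. -/
structure DistSpace where
  carrier : Type u
  d : carrier → carrier → ℝ≥0∞
  d_self : ∀ x, d x x = 0

namespace DistSpace

instance : CoeSort DistSpace.{u} (Type u) := ⟨DistSpace.carrier⟩

/-- A metric space, seen as a `DistSpace`. -/
def of (X : Type u) [MetricSpace X] : DistSpace.{u} := ⟨X, edist, edist_self⟩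

/-- The topology of the distance. -/
instance (X : DistSpace.{u}) : TopologicalSpace X.carrier where
  IsOpen s := ∀ x ∈ s, ∃ ε > 0, ∀ y, X.d y x < ε → y ∈ s
  isOpen_univ := fun _ _ => ⟨1, one_pos, fun _ _ => Set.mem_univ _⟩
  isOpen_inter := by
    rintro s t hs ht x ⟨hxs, hxt⟩
    obtain ⟨ε, hε, h⟩ := hs x hxs
    obtain ⟨δ, hδ, h'⟩ := ht x hxt
    exact ⟨min ε δ, lt_min hε hδ, fun y hy =>
      ⟨h y (hy.trans_le (min_le_left _ _)), h' y (hy.trans_le (min_le_right _ _))⟩⟩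
  isOpen_sUnion := by
    rintro S hS x ⟨s, hs, hx⟩
    obtain ⟨ε, hε, h⟩ := hS s hs x hx
    exact ⟨ε, hε, fun y hy => ⟨s, hs, h y hy⟩⟩

instance (X : DistSpace.{u}) : MeasurableSpace X.carrier := borel X.carrier

instance (X : DistSpace.{u}) : BorelSpace X.carrier := ⟨rfl⟩

/-- Linear growth: `d(y₀, f x) ≤ C (1 + d(x₀, x))` for some `x₀`, `y₀`, `C` and all `x`. -/
def LinearGrowth {X : DistSpace.{u}} {Y : DistSpace.{v}} (f : X → Y) : Prop :=
  ∃ (x₀ : X) (y₀ : Y) (C : ℝ≥0), ∀ x, Y.d y₀ (f x) ≤ C * (1 + X.d x₀ x)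

/-- Continuous maps with linear growth. -/
structure IsMorphism {X : DistSpace.{u}} {Y : DistSpace.{v}} (f : X → Y) : Prop where
  continuous : Continuous f
  linearGrowth : LinearGrowth f

/-- `f` is surjective with linearly growing antecedents. -/
def LinearlyGrowingAntecedents {X : DistSpace.{u}} {Y : DistSpace.{v}} (f : X → Y) : Prop :=
  Function.Surjective f ∧
    ∃ (x₀ : X) (C : ℝ≥0), ∀ y, ∃ x, f x = y ∧ X.d x₀ x ≤ C * (1 + Y.d (f x₀) y)

/-- The distance `√(a² + b²)` built from two distances `a` and `b`. -/
def hypot (a b : ℝ≥0∞) : ℝ≥0∞ := (a ^ 2 + b ^ 2) ^ (1 / 2 : ℝ)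

lemma hypot_zero : hypot 0 0 = 0 := by simp [hypot]

/-- The fiber product `X ×_Z Y = {(x, y) | f₁ x = f₂ y}` with the distance
`√(d_X² + d_Y²)`. -/
def fiberProd {X : DistSpace.{u}} {Y : DistSpace.{v}} {Z : DistSpace.{w}}
    (f₁ : X → Z) (f₂ : Y → Z) : DistSpace.{max u v} where
  carrier := Function.Pullback f₁ f₂
  d p q := hypot (X.d p.1.1 q.1.1) (Y.d p.1.2 q.1.2)
  d_self p := by simp only [d_self, hypot_zero]

/-- Borel probability measures with finite second moment. -/
structure IsP2 {X : DistSpace.{u}} (μ : Measure X) : Prop where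
  prob : IsProbabilityMeasure μ
  moment : ∃ x₀, ∫⁻ x, X.d x₀ x ^ 2 ∂μ < ⊤

/-- The Wasserstein distance of order `2`: the square root of the infimum of
`∫ d(x, y)² dγ(x, y)` over the transport plans `γ` between `μ` and `ν`. -/
def W2 {X : DistSpace.{u}} (μ ν : Measure X) : ℝ≥0∞ :=
  (⨅ (γ : Measure (X × X)) (_ : γ.map Prod.fst = μ ∧ γ.map Prod.snd = ν),
    ∫⁻ p, X.d p.1 p.2 ^ 2 ∂γ) ^ (1 / 2 : ℝ)

lemma W2_self {X : DistSpace.{u}} (μ : Measure X) : W2 μ μ = 0 := by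
  have hdiag : Measurable (fun x : X => (x, x)) := measurable_id.prodMk measurable_id
  have h0 : (⨅ (γ : Measure (X × X)) (_ : γ.map Prod.fst = μ ∧ γ.map Prod.snd = μ),
      ∫⁻ p, X.d p.1 p.2 ^ 2 ∂γ) = 0 := by
    refine le_antisymm (iInf₂_le_of_le (μ.map fun x => (x, x)) ⟨?_, ?_⟩ ?_) (zero_le)
    · rw [Measure.map_map measurable_fst hdiag]; exact Measure.map_id
    · rw [Measure.map_map measurable_snd hdiag]; exact Measure.map_id
    · refine (lintegral_map_le _ _).trans ?_
      simp [X.d_self]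
  rw [W2, h0]; simp

/-- `P₂(X)`: the Borel probability measures on `X` with finite second moment, with the distance
`W₂`. -/
def P2 (X : DistSpace.{u}) : DistSpace.{u} where
  carrier := {μ : Measure X // IsP2 μ}
  d μ ν := W2 μ.1 ν.1
  d_self μ := W2_self μ.1

lemma P2.nonempty {Y : DistSpace.{u}} (y : Y) : Nonempty (P2 Y) := by
  refine ⟨⟨Measure.dirac y, ⟨inferInstance, y, ?_⟩⟩⟩
  have : Measure.dirac y = (Measure.dirac ()).map (fun _ : Unit => y) := by
    rw [Measure.map_dirac' measurable_const]
  rw [this]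
  refine (lintegral_map_le _ _).trans_lt ?_
  simp [Y.d_self]

open Classical in
/-- `P₂(f) = [f]`: the pushforward map `μ ↦ f_# μ`. If `f` is continuous with linear growth,
then `f_# μ` belongs to `P₂(Y)` for all `μ` in `P₂(X)`; the `else` branch only makes the map
total for all other `f`. -/
def P2.map {X : DistSpace.{u}} {Y : DistSpace.{v}} (f : X → Y) (μ : P2 X) : P2 Y :=
  if h : IsP2 (μ.1.map f) then ⟨μ.1.map f, h⟩
  else Classical.choice <| by
    have := μ.2.prob
    obtain ⟨x⟩ := nonempty_of_isProbabilityMeasure μ.1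
    exact P2.nonempty (f x)

/-- `P₂⁽ⁿ⁾(X)`. -/
def iter (X : DistSpace.{u}) : ℕ → DistSpace.{u}
  | 0 => X
  | n + 1 => P2 (iter X n)

/-- `P₂⁽ⁿ⁾(f) = [f]⁽ⁿ⁾`. -/
def iterMap {X : DistSpace.{u}} {Y : DistSpace.{v}} (f : X → Y) :
    (n : ℕ) → iter X n → iter Y n
  | 0 => f
  | n + 1 => P2.map (iterMap f n)

end DistSpace

/-! ### The Sasaki distance on the tangent bundle and the space `T²M` -/

namespace Sasaki

variable {E : Type u} [NormedAddCommGroup E] [NormedSpace ℝ E]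
  {M : Type v} [TopologicalSpace M] [ChartedSpace E M] [IsManifold 𝓘(ℝ, E) ∞ M]
  [RiemannianBundle (fun x : M => TangentSpace 𝓘(ℝ, E) x)]

/-- The Riemannian metric read in the preferred chart at `x`: for `y` in the model space, close
to the image of `x`, this is the bilinear form `g_{ij}(y)` in the coordinates of the chart. -/
def chartMetric (x : M) (y : E) : E →L[ℝ] E →L[ℝ] ℝ :=
  let z : M := (extChartAt 𝓘(ℝ, E) x).symm y
  let A : E →L[ℝ] TangentSpace 𝓘(ℝ, E) z :=
    (trivializationAt E (TangentSpace 𝓘(ℝ, E) : M → Type u) x).symmL ℝ z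
  (innerSL ℝ (E := TangentSpace 𝓘(ℝ, E) z)).bilinearComp A A

set_option synthInstance.maxHeartbeats 200000 in
/-- The linear form `w ↦ ½ (∂_v g(u, w) + ∂_u g(v, w) - ∂_w g(v, u))` at `x`, in the preferred
chart at `x`. -/
def koszulForm (x : M) (v u : E) : E →L[ℝ] ℝ :=
  let D : E →L[ℝ] E →L[ℝ] E →L[ℝ] ℝ := fderiv ℝ (chartMetric x) (extChartAt 𝓘(ℝ, E) x x)
  (1 / 2 : ℝ) • (D v u + D u v - (D.flip v).flip u)

set_option synthInstance.maxHeartbeats 200000 in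
lemma koszulForm_zero (x : M) (u : E) : koszulForm x 0 u = 0 := by
  simp [koszulForm]

variable [FiniteDimensional ℝ E]

instance (x : M) : FiniteDimensional ℝ (TangentSpace 𝓘(ℝ, E) x) :=
  inferInstanceAs (FiniteDimensional ℝ E)

/-- The vector `Γ(v, u) = ∑ Γ^i_{jk}(x) v^j u^k ∂_i` given by the Christoffel symbols of the
Levi-Civita connection at `x`, in the preferred chart at `x`. -/
def christoffel (x : M) (v u : TangentSpace 𝓘(ℝ, E) x) : TangentSpace 𝓘(ℝ, E) x :=
  haveI : CompleteSpace (TangentSpace 𝓘(ℝ, E) x) := FiniteDimensional.complete ℝ _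
  (InnerProductSpace.toDual ℝ (TangentSpace 𝓘(ℝ, E) x)).symm
    (koszulForm (E := E) x v u)

/-- The norm on `T_{(x,u)} TM` of the Sasaki metric. A tangent vector of `TM` at `p = (x, u)` has,
in the chart of `TM` given by the preferred chart of `M` at `x`, coordinates `(v, Ξ)`. Its
horizontal part projects to `v`, and its vertical part is `Ξ + Γ(v, u)`. -/
def sasakiNorm (p : TangentBundle 𝓘(ℝ, E) M)
    (ξ : TangentSpace 𝓘(ℝ, E).tangent p) : ℝ :=
  let v : TangentSpace 𝓘(ℝ, E) p.1 := (show E × E from ξ).1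
  let Ξ : TangentSpace 𝓘(ℝ, E) p.1 := (show E × E from ξ).2
  √(‖v‖ ^ 2 + ‖Ξ + christoffel p.1 v p.2‖ ^ 2)

/-- The geodesic distance of the Sasaki metric on `TM`: the infimum of the Sasaki lengths of the
`C¹` paths in `TM`. -/
def sasakiEDist (p q : TangentBundle 𝓘(ℝ, E) M) : ℝ≥0∞ :=
  letI : ∀ p : TangentBundle 𝓘(ℝ, E) M, ENorm (TangentSpace 𝓘(ℝ, E).tangent p) :=
    fun p => ⟨fun ξ => ENNReal.ofReal (sasakiNorm p ξ)⟩
  riemannianEDist 𝓘(ℝ, E).tangent p q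

lemma sasakiNorm_zero (p : TangentBundle 𝓘(ℝ, E) M) : sasakiNorm p 0 = 0 := by
  have hc : christoffel p.1 0 p.2 = 0 := by
    unfold christoffel
    exact (congrArg _ (koszulForm_zero p.1 _)).trans (map_zero _)
  have hv : ‖(0 : TangentSpace 𝓘(ℝ, E) p.1)‖ ^ 2 +
      ‖(0 : TangentSpace 𝓘(ℝ, E) p.1) + christoffel p.1 0 p.2‖ ^ 2 = 0 := by
    rw [hc]; simp
  unfold sasakiNorm
  exact (congrArg Real.sqrt hv).trans Real.sqrt_zero

lemma sasakiEDist_self (p : TangentBundle 𝓘(ℝ, E) M) : sasakiEDist p p = 0 := by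
  unfold sasakiEDist
  rw [riemannianEDist]
  refine le_antisymm (iInf₂_le_of_le (Path.refl p) contMDiff_const ?_) zero_le
  refine (lintegral_congr fun t => ?_).trans_le (lintegral_zero).le
  have hm : mfderiv (𝓡∂ 1) 𝓘(ℝ, E).tangent (Path.refl p) t = 0 := mfderiv_const
  change ENNReal.ofReal (sasakiNorm p (mfderiv (𝓡∂ 1) 𝓘(ℝ, E).tangent (Path.refl p) t 1)) = 0
  rw [hm]
  exact (congrArg ENNReal.ofReal (sasakiNorm_zero p)).trans ENNReal.ofReal_zero

/-- `TM`, with the Sasaki distance. -/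
def TM (E : Type u) [NormedAddCommGroup E] [NormedSpace ℝ E] [FiniteDimensional ℝ E]
    (M : Type v) [TopologicalSpace M] [ChartedSpace E M] [IsManifold 𝓘(ℝ, E) ∞ M]
    [RiemannianBundle (fun x : M => TangentSpace 𝓘(ℝ, E) x)] : DistSpace.{max u v} where
  carrier := TangentBundle 𝓘(ℝ, E) M
  d := sasakiEDist
  d_self := sasakiEDist_self

/-- `T²M = {(x, v₁, v₂) | x ∈ M, v₁, v₂ ∈ T_x M}`, with the distance given by
`d²((x, v₁, v₂), (x', v₁', v₂')) = d²((x, v₁), (x', v₁')) + d²((x, v₂), (x', v₂'))`. -/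
def T2M (E : Type u) [NormedAddCommGroup E] [NormedSpace ℝ E] [FiniteDimensional ℝ E]
    (M : Type v) [TopologicalSpace M] [ChartedSpace E M] [IsManifold 𝓘(ℝ, E) ∞ M]
    [RiemannianBundle (fun x : M => TangentSpace 𝓘(ℝ, E) x)] : DistSpace.{max u v} where
  carrier := Σ x : M, TangentSpace 𝓘(ℝ, E) x × TangentSpace 𝓘(ℝ, E) x
  d p q := DistSpace.hypot
    (sasakiEDist (E := E) (M := M) ⟨p.1, p.2.1⟩ ⟨q.1, q.2.1⟩)
    (sasakiEDist (E := E) (M := M) ⟨p.1, p.2.2⟩ ⟨q.1, q.2.2⟩)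
  d_self p := by simp only [sasakiEDist_self, DistSpace.hypot_zero]

end Sasaki

/-! ### Velocity plans and couplings -/

section Plans

variable (E : Type u) [NormedAddCommGroup E] [NormedSpace ℝ E] [FiniteDimensional ℝ E]
  (M : Type v) [MetricSpace M] [ChartedSpace E M] [IsManifold 𝓘(ℝ, E) ∞ M]
  [RiemannianBundle (fun x : M => TangentSpace 𝓘(ℝ, E) x)]

open Sasaki DistSpace

/-- The projection `π : TM → M`. -/
def baseProj : TM E M → DistSpace.of M := fun p : TangentBundle 𝓘(ℝ, E) M => p.1

/-- The projection `π₁ : T²M → TM`, `(x, v₁, v₂) ↦ (x, v₁)`. -/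
def proj₁ : T2M E M → TM E M :=
  fun p : (Σ x : M, TangentSpace 𝓘(ℝ, E) x × TangentSpace 𝓘(ℝ, E) x) =>
    (⟨p.1, p.2.1⟩ : TangentBundle 𝓘(ℝ, E) M)

/-- The projection `π₂ : T²M → TM`, `(x, v₁, v₂) ↦ (x, v₂)`. -/
def proj₂ : T2M E M → TM E M :=
  fun p : (Σ x : M, TangentSpace 𝓘(ℝ, E) x × TangentSpace 𝓘(ℝ, E) x) =>
    (⟨p.1, p.2.2⟩ : TangentBundle 𝓘(ℝ, E) M)

/-- The set `P₂⁽ⁿ⁾(TM)_μ` of velocity plans with base `μ`. -/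
def velocityPlans (n : ℕ) (μ : iter (DistSpace.of M) n) : Set (iter (TM E M) n) :=
  {γ | iterMap (baseProj E M) n γ = μ}

/-- The set of couplings between the velocity plans `γ₁` and `γ₂`. -/
def couplings (n : ℕ) (γ₁ γ₂ : iter (TM E M) n) : Set (iter (T2M E M) n) :=
  {α | iterMap (proj₁ E M) n α = γ₁ ∧ iterMap (proj₂ E M) n α = γ₂}

end Plans

end

/-!
The maps `[f]⁽ⁿ⁾` are iterated push-forwards, so all three parts follow by induction on `n`, once one
application of `P` or `P₂` is understood. The induction is run in a class of spaces which is larger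
than that of Polish spaces: the separable metrizable spaces which are Borel images of the real line
(`IsAnalyticSpace`, `DistSpace.IsSuslin`, `WeakHierarchy.IsSuslin`). This avoids all completeness
questions for spaces of measures, and it makes the tangent bundle with the Sasaki distance, whose
completeness plays no role, an admissible base space.

*One step of the induction.* Let `μ` and `ν` be measures on `X` and `Y` with the same image on `Z`.
Disintegration over `Z` glues them to a measure `γ` on `X × Y` which is concentrated on the fiber
product (`exists_glue`). If every point of the fiber product has an antecedent in a measurable set
`Q ⊆ W`, then `γ` lifts to a measure on `W` which is concentrated on `Q` (`exists_lift`). Both facts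
rest on `exists_measurable_ae_section`: a measurable map from a standard Borel space has a measurable
section up to a null set. This is proved by filling up the range, up to small measure, by images of
compact subsets of the Baire space. For `P₂`, the set `Q` consists of the antecedents of linear
growth. Then the lift has a finite second moment, and comparing it with a Dirac mass shows that the
linear growth of antecedents is inherited (`DistSpace.LinearlyGrowingAntecedents.map`).

*The class is stable.* Probability measures on `ℝ` are parametrized by their distribution functions,
so they form an analytic space for the evaluation `σ`-algebra, and hence so do the probability
measures on any space of the class. Every measure is the limit of its images under nearest point maps
with finite range, and these depend continuously on finitely many weights. Hence the identity from
the evaluation `σ`-algebra to the weak topology or to the topology of `W₂` is strongly measurable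
(`stronglyMeasurable_of_tendsto_weights`), so these topologies are separable and their Borel
structures are analytic. The triangle inequality for `W₂` is again gluing.

*Morphisms.* If `f` is continuous with linear growth then so is `[f]` (`DistSpace.IsMorphism.map`).
For continuity, `d(f x, f y)` is bounded by a modulus of continuity at `y`, whose `L²` norm is small
by dominated convergence, when `x` is close to `y` on the scale `1 + d(x₀, y)`, and by a multiple of
`d(x, y)` otherwise.

*The tangent bundle.* The Christoffel symbols transform under a change of coordinates `τ` with a
defect given by the second derivative of `τ` (`christoffelVec_pullback`). Therefore the Sasaki norm
is the norm of a continuous Riemannian metric on the vector bundle `T(TM)` (`Sasaki.sasakiMetric`),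
and its geodesic distance induces the topology of `TM`, which is locally compact, second countable
and connected. Projecting paths shows that `π` is `1`-Lipschitz. Finally `(π₁, π₂)` is an isometric
bijection from `T²M` to the fiber product of `TM` with itself, so that the first part is an instance
of the induction.
-/

noncomputable section

/-! ### Measurable sections up to null sets -/

/-- A continuous injective function from the Baire space to the real line. -/
def baireToReal (x : ℕ → ℕ) : ℝ :=
  Cardinal.cantorFunction (1 / 3) fun n => decide (x n.unpair.1 = n.unpair.2)

lemma baireToReal_injective : Function.Injective baireToReal := by
  intro x y h
  have h1 := Cardinal.cantorFunction_injective (c := 1 / 3) (by norm_num) (by norm_num) h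
  funext n
  have h2 := congrFun h1 (Nat.pair n (x n))
  simpa [eq_comm] using h2

lemma continuous_baireToReal : Continuous baireToReal := by
  unfold baireToReal Cardinal.cantorFunction
  refine continuous_tsum (u := fun n => (1 / 3 : ℝ) ^ n) (fun n => ?_)
    (summable_geometric_of_lt_one (by norm_num) (by norm_num)) fun n x => ?_
  · have : Continuous fun x : ℕ → ℕ => x n.unpair.1 := continuous_apply _
    exact (continuous_of_discreteTopology (f := fun k : ℕ =>
      Cardinal.cantorFunctionAux (1 / 3)
        (fun m => decide ((fun _ => k : ℕ → ℕ) m = n.unpair.2)) n)).comp this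
  · rw [Real.norm_eq_abs, abs_of_nonneg (Cardinal.cantorFunctionAux_nonneg (by norm_num))]
    unfold Cardinal.cantorFunctionAux
    by_cases hx : x n.unpair.1 = n.unpair.2 <;> simp [hx]

/-- A continuous map on a compact subset of the Baire space has a measurable section: among the
preimages of a point, take the one with the smallest real code. -/
lemma exists_measurable_section_of_isCompact {V : Type*} [TopologicalSpace V] [T2Space V]
    [MeasurableSpace V] [BorelSpace V] {H : (ℕ → ℕ) → V} (hH : Continuous H)
    {K : Set (ℕ → ℕ)} (hK : IsCompact K) :
    ∃ s : V → ℕ → ℕ, Measurable s ∧ ∀ v ∈ H '' K, H (s v) = v := by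
  have hι : MeasurableEmbedding baireToReal :=
    continuous_baireToReal.measurableEmbedding baireToReal_injective
  have hfib : ∀ v, IsCompact (baireToReal '' (K ∩ H ⁻¹' {v})) := fun v =>
    (hK.inter_right (isClosed_singleton.preimage hH)).image continuous_baireToReal
  let t : V → ℝ := fun v => sInf (baireToReal '' (K ∩ H ⁻¹' {v}))
  have hmem : ∀ v ∈ H '' K, t v ∈ baireToReal '' (K ∩ H ⁻¹' {v}) := by
    rintro _ ⟨x, hx, rfl⟩
    exact (hfib _).sInf_mem ⟨_, x, ⟨hx, rfl⟩, rfl⟩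
  have hHK : MeasurableSet (H '' K) := (hK.image hH).measurableSet
  -- A sublevel set of `t` is the image of a compact set; outside of `H '' K` the infimum over the
  -- empty set is `0`.
  have ht : Measurable t := by
    refine measurable_of_Iic fun c => ?_
    have hset : t ⁻¹' Set.Iic c = H '' (K ∩ baireToReal ⁻¹' Set.Iic c) ∪
        ((H '' K)ᶜ ∩ {_v | (0 : ℝ) ≤ c}) := by
      ext v
      by_cases hv : v ∈ H '' K
      · constructor
        · intro h
          obtain ⟨x, ⟨hxK, hxv⟩, hx⟩ := hmem v hv
          exact Or.inl ⟨x, ⟨hxK, by simpa [hx] using h⟩, hxv⟩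
        · rintro (⟨x, ⟨hxK, hxc⟩, rfl⟩ | h)
          · exact (csInf_le (hfib _).bddBelow ⟨x, ⟨hxK, rfl⟩, rfl⟩).trans hxc
          · exact absurd hv h.1
      · have hempty : K ∩ H ⁻¹' {v} = ∅ := by
          ext x
          simp only [Set.mem_inter_iff, Set.mem_preimage, Set.mem_singleton_iff,
            Set.mem_empty_iff_false, iff_false, not_and]
          exact fun hx hxv => hv ⟨x, hx, hxv⟩
        have ht0 : t v = 0 := by simp [t, hempty]
        constructor
        · intro h
          exact Or.inr ⟨hv, by simpa [ht0] using h⟩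
        · rintro (⟨x, ⟨hxK, hxc⟩, rfl⟩ | h)
          · exact absurd ⟨x, hxK, rfl⟩ hv
          · simpa [ht0] using h.2
    rw [hset]
    refine MeasurableSet.union ?_ (hHK.compl.inter (MeasurableSet.const _))
    exact ((hK.inter_right (isClosed_Iic.preimage continuous_baireToReal)).image hH).measurableSet
  obtain ⟨g, hg, hgι⟩ := hι.exists_measurable_extend (g := (id : (ℕ → ℕ) → ℕ → ℕ)) measurable_id
    fun _ => inferInstance
  refine ⟨g ∘ t, hg.comp ht, fun v hv => ?_⟩
  obtain ⟨x, ⟨-, hxv⟩, hx⟩ := hmem v hv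
  rw [Function.comp_apply, ← hx]
  have : g (baireToReal x) = x := congrFun hgι x
  rw [this]
  exact hxv

/-- Inner approximation of the range of a continuous map on the Baire space by images of compact
sets (capacitability of analytic sets). -/
lemma exists_isCompact_lt_measure_image {V : Type*} [TopologicalSpace V] [T2Space V]
    [MeasurableSpace V] [BorelSpace V] {H : (ℕ → ℕ) → V} (hH : Continuous H)
    (γ : Measure V) [IsFiniteMeasure γ] {a : ℝ≥0∞} (ha : a < γ (Set.range H)) :
    ∃ K : Set (ℕ → ℕ), IsCompact K ∧ a ≤ γ (H '' K) := by
  -- `C b k` bounds the first `k` coordinates by those of `b`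
  let C : (ℕ → ℕ) → ℕ → Set (ℕ → ℕ) := fun b k => {x | ∀ i < k, x i ≤ b i}
  have hstep : ∀ (b : ℕ → ℕ) (k : ℕ), a < γ (H '' C b k) →
      ∃ m, a < γ (H '' C (Function.update b k m) (k + 1)) := by
    intro b k h
    have hU : H '' C b k = ⋃ m, H '' C (Function.update b k m) (k + 1) := by
      rw [← Set.image_iUnion]
      congr 1
      ext x
      simp only [C, Set.mem_ofPred_eq, Set.mem_iUnion]
      constructor
      · intro hx
        refine ⟨x k, fun i hi => ?_⟩
        rcases Nat.lt_succ_iff_lt_or_eq.1 hi with h | rfl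
        · simpa [Function.update_of_ne h.ne] using hx i h
        · simp
      · rintro ⟨m, hm⟩ i hi
        simpa [Function.update_of_ne hi.ne] using hm i (hi.trans k.lt_succ_self)
    have hmono : Monotone fun m => H '' C (Function.update b k m) (k + 1) := by
      intro m m' hmm
      refine Set.image_mono fun x hx i hi => (hx i hi).trans ?_
      by_cases hik : i = k
      · subst hik; simpa using hmm
      · simp [Function.update_of_ne hik]
    rw [hU, hmono.measure_iUnion] at h
    exact lt_iSup_iff.1 h
  choose! m hm using hstep
  let B : ℕ → ℕ → ℕ := fun k => Nat.rec (fun _ => 0) (fun k b => Function.update b k (m b k)) k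
  have hBsucc : ∀ k, B (k + 1) = Function.update (B k) k (m (B k) k) := fun k => rfl
  have hB : ∀ k, a < γ (H '' C (B k) k) := by
    intro k
    induction k with
    | zero => simpa [C] using ha
    | succ k ih => rw [hBsucc]; exact hm _ _ ih
  let b : ℕ → ℕ := fun i => B (i + 1) i
  have hBb : ∀ k, ∀ i < k, B k i = b i := by
    intro k
    induction k with
    | zero => intro i hi; omega
    | succ k ih =>
      intro i hi
      rcases Nat.lt_succ_iff_lt_or_eq.1 hi with h | rfl
      · rw [hBsucc, Function.update_of_ne h.ne, ih i h]
      · rfl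
  have hCb : ∀ k, C (B k) k = C b k := by
    intro k
    ext x
    exact forall₂_congr fun i hi => by rw [hBb k i hi]
  let K : Set (ℕ → ℕ) := Set.pi Set.univ fun i => Set.Iic (b i)
  have hK : IsCompact K := isCompact_univ_pi fun i => (Set.finite_Iic _).isCompact
  refine ⟨K, hK, ?_⟩
  -- A neighborhood of the compact set `H '' K` contains `H '' C b k` for all large `k`, because
  -- truncating the coordinates of a point of `C b k` by `b` gives a nearby point of `K`.
  have hsub : ⋂ k, closure (H '' C b k) ⊆ H '' K := by
    intro v hv
    by_contra hvK
    obtain ⟨U, U', hU, hU', hKU, hvU', hdisj⟩ :=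
      SeparatedNhds.of_isCompact_isCompact (hK.image hH) isCompact_singleton
        (Set.disjoint_singleton_right.2 hvK)
    let : MetricSpace (ℕ → ℕ) := PiNat.metricSpaceNatNat
    obtain ⟨δ, hδ, hδU⟩ := hK.exists_thickening_subset_open (hU.preimage hH)
      (Set.image_subset_iff.1 hKU)
    obtain ⟨k, hk⟩ := exists_pow_lt_of_lt_one hδ (by norm_num : (1 / 2 : ℝ) < 1)
    have hCU : H '' C b k ⊆ U := by
      rintro _ ⟨x, hx, rfl⟩
      refine hδU (Metric.mem_thickening_iff.2 ⟨fun i => min (x i) (b i), ?_, lt_of_le_of_lt ?_ hk⟩)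
      · exact fun i _ => min_le_right (x i) (b i)
      · refine PiNat.mem_cylinder_iff_dist_le.1 fun i hi => ?_
        exact (min_eq_left (hx i hi)).symm
    have : v ∈ closure U := closure_mono hCU (Set.mem_iInter.1 hv k)
    obtain ⟨y, hyU', hyU⟩ := mem_closure_iff.1 this U' hU' (hvU' rfl)
    exact Set.disjoint_left.1 hdisj hyU hyU'
  refine le_trans ?_ (measure_mono hsub)
  have hanti : Antitone fun k => closure (H '' C b k) := fun k k' hkk =>
    closure_mono (Set.image_mono fun x hx i hi => hx i (hi.trans_le hkk))
  rw [hanti.measure_iInter (fun k => isClosed_closure.measurableSet.nullMeasurableSet)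
    ⟨0, measure_ne_top _ _⟩]
  exact le_iInf fun k => ((hCb k ▸ hB k).le).trans (measure_mono subset_closure)

/-- A measurable map `φ` from a standard Borel space whose range has full measure has a measurable
section, up to a null set. -/
lemma exists_measurable_ae_section {S : Type*} [MeasurableSpace S] [StandardBorelSpace S]
    {V : Type*} [TopologicalSpace V] [T2Space V] [SecondCountableTopology V]
    [MeasurableSpace V] [BorelSpace V] {φ : S → V} (hφ : Measurable φ)
    (γ : Measure V) [IsFiniteMeasure γ] [NeZero γ] (hγ : ∀ᵐ v ∂γ, v ∈ Set.range φ) :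
    ∃ s : V → S, Measurable s ∧ ∀ᵐ v ∂γ, φ (s v) = v := by
  have hS : Nonempty S := by
    obtain ⟨v, s, hs⟩ := hγ.exists
    exact ⟨s⟩
  -- Refine the topology of `S` to make `φ` continuous, and code `S` by the Baire space.
  obtain ⟨p, hp, hp', hH⟩ : ∃ p : (ℕ → ℕ) → S, Measurable p ∧ Function.Surjective p ∧
      Continuous (φ ∘ p) := by
    let := upgradeStandardBorel S
    have hmeas : ∀ f : (ℕ → ℕ) → S, Continuous f → Measurable f := fun f hf => hf.measurable
    obtain ⟨t', ht', hcont, hpol⟩ := hφ.exists_continuous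
    obtain ⟨f, hf, hfs⟩ := @PolishSpace.exists_nat_nat_continuous_surjective S t' hpol hS
    exact ⟨f, hmeas f (continuous_le_rng ht' hf), hfs, @Continuous.comp _ _ _ _ t' _ _ _ hcont hf⟩
  have hrange : Set.range (φ ∘ p) = Set.range φ := by
    rw [Set.range_comp, hp'.range_eq, Set.image_univ]
  have hfull : γ (Set.range (φ ∘ p)) = γ Set.univ := by
    rw [hrange]; exact measure_congr (Filter.eventuallyEq_univ.2 hγ)
  have hK : ∀ n : ℕ, ∃ K : Set (ℕ → ℕ), IsCompact K ∧
      γ Set.univ - (n + 1 : ℝ≥0∞)⁻¹ ≤ γ ((φ ∘ p) '' K) := fun n => by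
    refine exists_isCompact_lt_measure_image hH γ ?_
    rw [hfull]
    exact ENNReal.sub_lt_self (measure_ne_top _ _) (NeZero.ne _) (by simp)
  choose K hKc hKγ using hK
  choose s hs hsK using fun n => exists_measurable_section_of_isCompact hH (hKc n)
  -- Patch the sections over the sets `T n`, which together have full measure.
  let T : ℕ → Set V := fun n => (φ ∘ p) '' K n
  have hT : ∀ n, MeasurableSet (T n) := fun n => ((hKc n).image hH).measurableSet
  obtain ⟨r, hr, hrs⟩ := exists_measurable_piecewise (disjointed T)
    (fun n => MeasurableSet.disjointed hT n) s hs fun i j hij v hv =>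
      absurd (disjoint_disjointed T hij) (Set.not_disjoint_iff.2 ⟨v, hv⟩)
  refine ⟨p ∘ r, hp.comp hr, ?_⟩
  have hnull : γ (⋃ n, T n)ᶜ = 0 := by
    refine le_antisymm (ENNReal.le_of_forall_pos_le_add fun ε hε _ => ?_) zero_le
    obtain ⟨n, hn⟩ := ENNReal.exists_inv_nat_lt (a := (ε : ℝ≥0∞)) (by simpa using hε.ne')
    have h1 : γ (⋃ n, T n)ᶜ ≤ γ (T n)ᶜ :=
      measure_mono (Set.compl_subset_compl.2 (Set.subset_iUnion T n))
    have h2 : γ (T n)ᶜ ≤ (n + 1 : ℝ≥0∞)⁻¹ := by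
      rw [measure_compl (hT n) (measure_ne_top _ _)]
      exact tsub_le_iff_tsub_le.1 (hKγ n)
    have h3 : (n + 1 : ℝ≥0∞)⁻¹ ≤ (n : ℝ≥0∞)⁻¹ := ENNReal.inv_le_inv.2 le_self_add
    rw [zero_add]
    exact h1.trans (h2.trans (h3.trans hn.le))
  filter_upwards [compl_mem_ae_iff.2 hnull] with v hv
  rw [← iUnion_disjointed, compl_compl, Set.mem_iUnion] at hv
  obtain ⟨n, hn⟩ := hv
  rw [Function.comp_apply, hrs n hn]
  exact hsK n v (disjointed_subset T n hn)

/-! ### Measurable images of the real line, gluing and lifting of measures -/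

/-- A measurable space is *analytic* if it is empty or a measurable image of the real line. -/
def IsAnalyticSpace (X : Type*) [MeasurableSpace X] : Prop :=
  Nonempty X → ∃ φ : ℝ → X, Measurable φ ∧ Function.Surjective φ

lemma IsAnalyticSpace.of_surjective {X Y : Type*} [MeasurableSpace X] [MeasurableSpace Y]
    (hX : IsAnalyticSpace X) {f : X → Y} (hf : Measurable f) (hs : Function.Surjective f) :
    IsAnalyticSpace Y := by
  rintro ⟨y⟩
  obtain ⟨x, -⟩ := hs y
  obtain ⟨φ, hφ, hφs⟩ := hX ⟨x⟩
  exact ⟨f ∘ φ, hf.comp hφ, hs.comp hφs⟩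

lemma isAnalyticSpace_of_standardBorel (X : Type*) [MeasurableSpace X] [StandardBorelSpace X] :
    IsAnalyticSpace X := by
  intro h
  obtain ⟨f, hf⟩ := exists_measurableEmbedding_real X
  obtain ⟨g, hg, hgf⟩ := hf.exists_measurable_extend (g := (id : X → X)) measurable_id fun _ => h
  exact ⟨g, hg, fun x => ⟨f x, congrFun hgf x⟩⟩

lemma IsAnalyticSpace.prod {X Y : Type*} [MeasurableSpace X] [MeasurableSpace Y]
    (hX : IsAnalyticSpace X) (hY : IsAnalyticSpace Y) : IsAnalyticSpace (X × Y) := by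
  rintro ⟨x, y⟩
  obtain ⟨φ, hφ, hφs⟩ := hX ⟨x⟩
  obtain ⟨ψ, hψ, hψs⟩ := hY ⟨y⟩
  exact (isAnalyticSpace_of_standardBorel (ℝ × ℝ)).of_surjective (hφ.prodMap hψ)
    (hφs.prodMap hψs) ⟨(x, y)⟩

/-- A probability measure is an image of a probability measure under any measurable surjection
from a standard Borel space. -/
lemma exists_measure_map_eq {S : Type*} [MeasurableSpace S] [StandardBorelSpace S]
    {V : Type*} [TopologicalSpace V] [T2Space V] [SecondCountableTopology V]
    [MeasurableSpace V] [BorelSpace V] {φ : S → V} (hφ : Measurable φ)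
    (γ : Measure V) [IsProbabilityMeasure γ] (hγ : ∀ᵐ v ∂γ, v ∈ Set.range φ) :
    ∃ α : Measure S, IsProbabilityMeasure α ∧ α.map φ = γ := by
  obtain ⟨s, hs, hφs⟩ := exists_measurable_ae_section hφ γ hγ
  refine ⟨γ.map s, Measure.isProbabilityMeasure_map hs.aemeasurable, ?_⟩
  rw [Measure.map_map hφ hs]
  exact (Measure.map_congr hφs).trans Measure.map_id

/-- Probability measures on the real line whose images under two measurable maps agree can be
glued along these maps, by disintegration. -/
lemma exists_glue_real {Z : Type*} [TopologicalSpace Z] [T2Space Z] [SecondCountableTopology Z]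
    [MeasurableSpace Z] [BorelSpace Z] {f₁ f₂ : ℝ → Z} (hf₁ : Measurable f₁) (hf₂ : Measurable f₂)
    (μ ν : Measure ℝ) [IsProbabilityMeasure μ] [IsProbabilityMeasure ν]
    (h : μ.map f₁ = ν.map f₂) :
    ∃ γ : Measure (ℝ × ℝ), γ.map Prod.fst = μ ∧ γ.map Prod.snd = ν ∧
      ∀ᵐ p ∂γ, f₁ p.1 = f₂ p.2 := by
  let ρ₁ : Measure (Z × ℝ) := μ.map fun t => (f₁ t, t)
  let ρ₂ : Measure (Z × ℝ) := ν.map fun t => (f₂ t, t)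
  have hm₁ : Measurable fun t => (f₁ t, t) := hf₁.prodMk measurable_id
  have hm₂ : Measurable fun t => (f₂ t, t) := hf₂.prodMk measurable_id
  have : IsProbabilityMeasure ρ₁ := Measure.isProbabilityMeasure_map hm₁.aemeasurable
  have : IsProbabilityMeasure ρ₂ := Measure.isProbabilityMeasure_map hm₂.aemeasurable
  let ζ : Measure Z := μ.map f₁
  have hζ₁ : ρ₁.fst = ζ := by
    change (μ.map _).map _ = _
    rw [Measure.map_map measurable_fst hm₁]; rfl
  have hζ₂ : ρ₂.fst = ζ := by
    change (ν.map _).map _ = _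
    rw [Measure.map_map measurable_fst hm₂]; exact h.symm
  -- Over `Z`, take the product of the two conditional laws.
  let Γ : Measure (Z × ℝ × ℝ) := ζ.compProd
    (ProbabilityTheory.Kernel.prod ρ₁.condKernel ρ₂.condKernel)
  have : IsProbabilityMeasure ζ := Measure.isProbabilityMeasure_map hf₁.aemeasurable
  have h₁ : Γ.map (Prod.map id Prod.fst) = ρ₁ := by
    rw [← Measure.compProd_map measurable_fst, ← ProbabilityTheory.Kernel.fst_eq,
      ProbabilityTheory.Kernel.fst_prod, ← hζ₁, ρ₁.disintegrate]
  have h₂ : Γ.map (Prod.map id Prod.snd) = ρ₂ := by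
    rw [← Measure.compProd_map measurable_snd, ← ProbabilityTheory.Kernel.snd_eq,
      ProbabilityTheory.Kernel.snd_prod, ← hζ₂, ρ₂.disintegrate]
  have hp₁ : Measurable (Prod.map id Prod.fst : Z × ℝ × ℝ → Z × ℝ) :=
    measurable_id.prodMap measurable_fst
  have hp₂ : Measurable (Prod.map id Prod.snd : Z × ℝ × ℝ → Z × ℝ) :=
    measurable_id.prodMap measurable_snd
  have ha₁ : ∀ᵐ p ∂Γ, f₁ p.2.1 = p.1 := by
    have hs : MeasurableSet {q : Z × ℝ | f₁ q.2 = q.1} :=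
      measurableSet_eq_fun (hf₁.comp measurable_snd) measurable_fst
    have : ∀ᵐ q ∂ρ₁, f₁ q.2 = q.1 := (ae_map_iff hm₁.aemeasurable hs).2 (by simp)
    rw [← h₁] at this
    exact (ae_map_iff hp₁.aemeasurable hs).1 this
  have ha₂ : ∀ᵐ p ∂Γ, f₂ p.2.2 = p.1 := by
    have hs : MeasurableSet {q : Z × ℝ | f₂ q.2 = q.1} :=
      measurableSet_eq_fun (hf₂.comp measurable_snd) measurable_fst
    have : ∀ᵐ q ∂ρ₂, f₂ q.2 = q.1 := (ae_map_iff hm₂.aemeasurable hs).2 (by simp)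
    rw [← h₂] at this
    exact (ae_map_iff hp₂.aemeasurable hs).1 this
  refine ⟨Γ.map Prod.snd, ?_, ?_, ?_⟩
  · have : (Γ.map (Prod.map id Prod.fst)).map Prod.snd = μ := by
      rw [h₁, Measure.map_map measurable_snd hm₁]; exact Measure.map_id
    rw [Measure.map_map measurable_snd hp₁] at this
    rw [Measure.map_map measurable_fst measurable_snd]
    exact this
  · have : (Γ.map (Prod.map id Prod.snd)).map Prod.snd = ν := by
      rw [h₂, Measure.map_map measurable_snd hm₂]; exact Measure.map_id
    rw [Measure.map_map measurable_snd hp₂] at this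
    rw [Measure.map_map measurable_snd measurable_snd]
    exact this
  · have hs : MeasurableSet {q : ℝ × ℝ | f₁ q.1 = f₂ q.2} :=
      measurableSet_eq_fun (hf₁.comp measurable_fst) (hf₂.comp measurable_snd)
    refine (ae_map_iff measurable_snd.aemeasurable hs).2 ?_
    filter_upwards [ha₁, ha₂] with p h1 h2
    exact h1.trans h2.symm

section

variable {X Y Z : Type*}
  [TopologicalSpace X] [T2Space X] [SecondCountableTopology X] [MeasurableSpace X] [BorelSpace X]
  [TopologicalSpace Y] [T2Space Y] [SecondCountableTopology Y] [MeasurableSpace Y] [BorelSpace Y]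
  [TopologicalSpace Z] [T2Space Z] [SecondCountableTopology Z] [MeasurableSpace Z] [BorelSpace Z]

/-- Two probability measures on analytic spaces with the same image can be glued. -/
lemma exists_glue (hX : IsAnalyticSpace X) (hY : IsAnalyticSpace Y)
    {f₁ : X → Z} {f₂ : Y → Z} (hf₁ : Measurable f₁) (hf₂ : Measurable f₂)
    (μ : Measure X) (ν : Measure Y) [IsProbabilityMeasure μ] [IsProbabilityMeasure ν]
    (h : μ.map f₁ = ν.map f₂) :
    ∃ γ : Measure (X × Y), IsProbabilityMeasure γ ∧ γ.map Prod.fst = μ ∧ γ.map Prod.snd = ν ∧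
      ∀ᵐ p ∂γ, f₁ p.1 = f₂ p.2 := by
  obtain ⟨φ, hφ, hφs⟩ := hX (nonempty_of_isProbabilityMeasure μ)
  obtain ⟨ψ, hψ, hψs⟩ := hY (nonempty_of_isProbabilityMeasure ν)
  obtain ⟨μ', _, rfl⟩ := exists_measure_map_eq hφ μ (.of_forall hφs)
  obtain ⟨ν', _, rfl⟩ := exists_measure_map_eq hψ ν (.of_forall hψs)
  rw [Measure.map_map hf₁ hφ, Measure.map_map hf₂ hψ] at h
  obtain ⟨γ, h₁, h₂, hγ⟩ := exists_glue_real (hf₁.comp hφ) (hf₂.comp hψ) μ' ν' h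
  have hm : Measurable (Prod.map φ ψ) := hφ.prodMap hψ
  have h₁' : (γ.map (Prod.map φ ψ)).map Prod.fst = μ'.map φ := by
    rw [Measure.map_map measurable_fst hm, ← h₁, Measure.map_map hφ measurable_fst]; rfl
  refine ⟨γ.map (Prod.map φ ψ), ⟨?_⟩, h₁', ?_, ?_⟩
  · have : ((γ.map (Prod.map φ ψ)).map Prod.fst) Set.univ = 1 := by rw [h₁']; exact measure_univ
    rwa [Measure.map_apply measurable_fst .univ] at this
  · rw [Measure.map_map measurable_snd hm, ← h₂, Measure.map_map hψ measurable_snd]; rfl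
  · exact (ae_map_iff hm.aemeasurable (measurableSet_eq_fun (hf₁.comp measurable_fst)
      (hf₂.comp measurable_snd))).2 hγ

/-- A pair of probability measures with the same image in `Z` lifts to `W`, if the points of the
fiber product lift to `W`. The lift can be chosen to be concentrated on a measurable set which
contains a lift of every point of the fiber product. -/
lemma exists_lift {W : Type*} [MeasurableSpace W] (hW : IsAnalyticSpace W)
    (hX : IsAnalyticSpace X) (hY : IsAnalyticSpace Y)
    {f₁ : X → Z} {f₂ : Y → Z} (hf₁ : Measurable f₁) (hf₂ : Measurable f₂)
    {g₁ : W → X} {g₂ : W → Y} (hg₁ : Measurable g₁) (hg₂ : Measurable g₂)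
    {Q : Set W} (hQ : MeasurableSet Q)
    (hlift : ∀ x y, f₁ x = f₂ y → ∃ w ∈ Q, g₁ w = x ∧ g₂ w = y)
    (μ : Measure X) (ν : Measure Y) [IsProbabilityMeasure μ] [IsProbabilityMeasure ν]
    (h : μ.map f₁ = ν.map f₂) :
    ∃ α : Measure W, IsProbabilityMeasure α ∧ α.map g₁ = μ ∧ α.map g₂ = ν ∧
      ∀ᵐ w ∂α, w ∈ Q := by
  obtain ⟨γ, hγ, rfl, rfl, hγf⟩ := exists_glue hX hY hf₁ hf₂ μ ν h
  obtain ⟨p, hp⟩ := hγf.exists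
  obtain ⟨w, -⟩ := hlift p.1 p.2 hp
  obtain ⟨φ, hφ, hφs⟩ := hW ⟨w⟩
  have hS : MeasurableSet (φ ⁻¹' Q) := hφ hQ
  have : StandardBorelSpace (φ ⁻¹' Q) := hS.standardBorel
  -- `ψ` maps the parameters of points of `Q` onto the fiber product.
  let ψ : φ ⁻¹' Q → X × Y := fun s => (g₁ (φ s), g₂ (φ s))
  have hφ' : Measurable fun s : φ ⁻¹' Q => φ s := hφ.comp measurable_subtype_coe
  have hψ : Measurable ψ := (hg₁.comp hφ').prodMk (hg₂.comp hφ')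
  obtain ⟨α, _, hα⟩ := exists_measure_map_eq hψ γ (by
    filter_upwards [hγf] with p hp
    obtain ⟨w, hw, h1, h2⟩ := hlift p.1 p.2 hp
    obtain ⟨t, rfl⟩ := hφs w
    exact ⟨⟨t, hw⟩, Prod.ext h1 h2⟩)
  refine ⟨α.map fun s : φ ⁻¹' Q => φ s, Measure.isProbabilityMeasure_map hφ'.aemeasurable,
    ?_, ?_, ?_⟩
  · rw [← hα, Measure.map_map hg₁ hφ', Measure.map_map measurable_fst hψ]; rfl
  · rw [← hα, Measure.map_map hg₂ hφ', Measure.map_map measurable_snd hψ]; rfl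
  · exact (ae_map_iff hφ'.aemeasurable hQ).2 (.of_forall fun s => s.2)

end

/-! ### Spaces of probability measures are analytic -/

/-- Probability measures on the line are parametrized by the restrictions of their distribution
functions to the rationals. -/
lemma isAnalyticSpace_probabilityMeasure_real :
    IsAnalyticSpace {μ : Measure ℝ // IsProbabilityMeasure μ} := by
  let S : (ℚ → ℝ) → StieltjesFunction ℝ :=
    ProbabilityTheory.stieltjesOfMeasurableRat id measurable_id
  have hS : Measurable fun c => (S c).measure :=
    ProbabilityTheory.measurable_measure_stieltjesOfMeasurableRat measurable_id
  refine (isAnalyticSpace_of_standardBorel (ℚ → ℝ)).of_surjective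
    (f := fun c => ⟨(S c).measure,
      ProbabilityTheory.instIsProbabilityMeasure_stieltjesOfMeasurableRat measurable_id c⟩)
    hS.subtype_mk ?_
  rintro ⟨μ, hμ⟩
  let F := ProbabilityTheory.cdf μ
  let c : ℚ → ℝ := fun q => F q
  have hc : ProbabilityTheory.IsRatStieltjesPoint id c :=
    { mono := fun q r h => F.mono (by exact_mod_cast h)
      tendsto_atTop_one := (ProbabilityTheory.tendsto_cdf_atTop μ).comp
        (tendsto_ratCast_atTop_iff.2 Filter.tendsto_id)
      tendsto_atBot_zero := (ProbabilityTheory.tendsto_cdf_atBot μ).comp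
        (tendsto_ratCast_atBot_iff.2 Filter.tendsto_id)
      iInf_rat_gt_eq := fun t => by
        refine Eq.trans ?_ (F.iInf_rat_gt_eq t)
        exact (Equiv.subtypeEquivRight fun r : ℚ =>
          (Rat.cast_lt (K := ℝ) (p := t) (q := r)).symm).iInf_congr fun _ => rfl }
  refine ⟨c, Subtype.ext ?_⟩
  have : IsProbabilityMeasure (S c).measure :=
    ProbabilityTheory.instIsProbabilityMeasure_stieltjesOfMeasurableRat measurable_id c
  refine ext_of_generate_finite _ Real.borel_eq_generateFrom_Iic_rat Real.isPiSystem_Iic_rat ?_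
    (by simp)
  simp only [Set.mem_iUnion, Set.mem_singleton_iff]
  rintro _ ⟨q, rfl⟩
  have h1 : S c q = F q := by
    rw [ProbabilityTheory.stieltjesOfMeasurableRat_eq,
      ProbabilityTheory.toRatCDF_of_isRatStieltjesPoint hc]
    rfl
  change (S c).measure _ = _
  rw [ProbabilityTheory.measure_stieltjesOfMeasurableRat_Iic]
  change ENNReal.ofReal (S c q) = _
  rw [h1, ProbabilityTheory.ofReal_cdf]

/-- The probability measures on an analytic space form an analytic space. -/
lemma IsAnalyticSpace.probabilityMeasure {X : Type*} [TopologicalSpace X] [T2Space X]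
    [SecondCountableTopology X] [MeasurableSpace X] [BorelSpace X] (hX : IsAnalyticSpace X) :
    IsAnalyticSpace {μ : Measure X // IsProbabilityMeasure μ} := by
  rintro ⟨μ, hμ⟩
  obtain ⟨φ, hφ, hφs⟩ := hX (nonempty_of_isProbabilityMeasure μ)
  refine isAnalyticSpace_probabilityMeasure_real.of_surjective
    (f := fun ν => ⟨ν.1.map φ, have := ν.2; Measure.isProbabilityMeasure_map hφ.aemeasurable⟩)
    ((Measure.measurable_map φ hφ).comp measurable_subtype_coe).subtype_mk ?_ ⟨μ, hμ⟩
  rintro ⟨ν, hν⟩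
  obtain ⟨α, hα, rfl⟩ := exists_measure_map_eq hφ ν (.of_forall hφs)
  exact ⟨⟨α, hα⟩, rfl⟩

/-- A measurable subset of an analytic space is an analytic space. -/
lemma IsAnalyticSpace.subtype {X : Type*} [MeasurableSpace X] (hX : IsAnalyticSpace X) {s : Set X}
    (hs : MeasurableSet s) : IsAnalyticSpace s := by
  rintro ⟨x⟩
  obtain ⟨φ, hφ, hφs⟩ := hX ⟨x⟩
  have : StandardBorelSpace (φ ⁻¹' s) := (hφ hs).standardBorel
  refine (isAnalyticSpace_of_standardBorel (φ ⁻¹' s)).of_surjective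
    (f := fun t => (⟨φ t, t.2⟩ : s)) (hφ.comp measurable_subtype_coe).subtype_mk ?_ ⟨x⟩
  rintro ⟨y, hy⟩
  obtain ⟨t, rfl⟩ := hφs y
  exact ⟨⟨t, hy⟩, rfl⟩

/-! ### Measures with finite support -/

/-- The weights of the convex combinations of points indexed by `ι`. -/
abbrev Weights (ι : Type*) [Fintype ι] : Type _ := {p : ι → ℝ≥0 // ∑ i, p i = 1}

/-- The measure `∑ i, p i • δ_{x i}`. -/
def discreteMeasure {X ι : Type*} [MeasurableSpace X] [Fintype ι] (x : ι → X) (p : ι → ℝ≥0) :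
    Measure X := ∑ i, (p i : ℝ≥0∞) • Measure.dirac (x i)

section

variable {X : Type*} [MeasurableSpace X]

lemma discreteMeasure_univ {ι : Type*} [Fintype ι] (x : ι → X) (p : ι → ℝ≥0) :
    discreteMeasure x p Set.univ = ∑ i, (p i : ℝ≥0∞) := by
  simp [discreteMeasure, Measure.finsetSum_apply]

instance isProbabilityMeasure_discreteMeasure {ι : Type*} [Fintype ι] (x : ι → X) (p : Weights ι) :
    IsProbabilityMeasure (discreteMeasure x p.1) :=
  ⟨by rw [discreteMeasure_univ]; exact_mod_cast p.2⟩

lemma lintegral_discreteMeasure {ι : Type*} [Fintype ι] (x : ι → X) (p : ι → ℝ≥0)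
    {f : X → ℝ≥0∞} (hf : Measurable f) :
    ∫⁻ y, f y ∂(discreteMeasure x p) = ∑ i, p i * f (x i) := by
  simp [discreteMeasure, lintegral_finsetSum_measure, lintegral_dirac' _ hf]
  rfl

/-- The law of a simple function, as a point of a simplex. -/
def MeasureTheory.SimpleFunc.weights {Y : Type*} (s : SimpleFunc X Y) (μ : Measure X)
    [IsProbabilityMeasure μ] : Weights s.range :=
  ⟨fun y => (μ (s ⁻¹' {y.1})).toNNReal, by
    rw [Finset.univ_eq_attach, Finset.sum_attach s.range fun y => (μ (s ⁻¹' {y})).toNNReal,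
      ← ENNReal.toNNReal_sum fun y _ => measure_ne_top _ _, s.sum_range_measure_preimage_singleton,
      measure_univ, ENNReal.toNNReal_one]⟩

lemma discreteMeasure_weights {Y : Type*} [MeasurableSpace Y] (s : SimpleFunc X Y)
    (hs : Measurable s) (μ : Measure X) [IsProbabilityMeasure μ] :
    discreteMeasure (fun y : s.range => y.1) (s.weights μ).1 = μ.map s := by
  ext A hA
  have h1 : ∀ y : s.range, ((s.weights μ).1 y : ℝ≥0∞) = μ (s ⁻¹' {y.1}) := fun y =>
    ENNReal.coe_toNNReal (measure_ne_top _ _)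
  rw [← lintegral_indicator_one hA, lintegral_discreteMeasure _ _ (measurable_one.indicator hA),
    ← lintegral_indicator_one hA, lintegral_map (measurable_one.indicator hA) hs]
  simp only [h1]
  rw [Finset.univ_eq_attach, Finset.sum_attach s.range
    fun y => μ (s ⁻¹' {y}) * A.indicator 1 y]
  have h2 := (s.map (A.indicator (1 : Y → ℝ≥0∞))).lintegral_eq_lintegral μ
  rw [SimpleFunc.map_lintegral] at h2
  rw [show (∫⁻ a, A.indicator 1 (s a) ∂μ) =
    ∫⁻ a, (s.map (A.indicator (1 : Y → ℝ≥0∞))) a ∂μ from rfl, h2]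
  exact Finset.sum_congr rfl fun y _ => mul_comm _ _

/-- A limit of functions of the laws of simple functions is strongly measurable, for the evaluation
`σ`-algebra on measures. -/
lemma stronglyMeasurable_of_tendsto_weights {Ω T Y : Type*} [MeasurableSpace Ω] {m : Ω → Measure X}
    [∀ o, IsProbabilityMeasure (m o)] (hm : Measurable m) [TopologicalSpace T]
    [TopologicalSpace.PseudoMetrizableSpace T] (s : ℕ → SimpleFunc X Y)
    (F : ∀ k, Weights (s k).range → T) (hF : ∀ k, Continuous (F k)) {G : Ω → T}
    (hG : ∀ o, Filter.Tendsto (fun k => F k ((s k).weights (m o))) Filter.atTop (𝓝 (G o))) :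
    StronglyMeasurable G := by
  refine stronglyMeasurable_of_tendsto (u := Filter.atTop)
    (f := fun k o => F k ((s k).weights (m o))) (fun k => (hF k).comp_stronglyMeasurable ?_)
    (tendsto_pi_nhds.2 hG)
  have : Measurable fun o => (s k).weights (m o) := by
    refine Measurable.subtype_mk (measurable_pi_lambda _ fun y => ?_)
    exact ((Measure.measurable_coe ((s k).measurableSet_preimage _)).comp hm).ennreal_toNNReal
  exact this.stronglyMeasurable

end

/-! ### Gluing in the hierarchy of spaces of probability measures -/

/-- A measure of total mass one, as a point of the space of probability measures. -/
def MeasureTheory.ProbabilityMeasure.ofMeasure {X : Type*} [MeasurableSpace X] (μ : Measure X)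
    (hμ : IsProbabilityMeasure μ) : ProbabilityMeasure X := ⟨μ, hμ⟩

namespace WeakHierarchy

lemma continuous_probabilityMeasure_discreteMeasure {X ι : Type*} [TopologicalSpace X]
    [MeasurableSpace X] [BorelSpace X] [Fintype ι] (x : ι → X) :
    Continuous fun p : Weights ι =>
      ProbabilityMeasure.ofMeasure (discreteMeasure x p.1) inferInstance := by
  rw [continuous_iff_continuousAt]
  intro p
  refine ProbabilityMeasure.tendsto_iff_forall_lintegral_tendsto.2 fun f => ?_
  have hf : Measurable fun y => (f y : ℝ≥0∞) := f.continuous.measurable.coe_nnreal_ennreal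
  simp only [ProbabilityMeasure.coe_mk, ProbabilityMeasure.ofMeasure,
    lintegral_discreteMeasure _ _ hf]
  refine tendsto_finsetSum _ fun i _ => ENNReal.Tendsto.mul_const ?_ (Or.inr ENNReal.coe_ne_top)
  exact ENNReal.tendsto_coe.2 (((continuous_apply i).comp continuous_subtype_val).tendsto p)

section

variable {X : Type*} [TopologicalSpace X] [TopologicalSpace.MetrizableSpace X]
  [SecondCountableTopology X] [MeasurableSpace X] [BorelSpace X]

/-- The identity is strongly measurable from the evaluation `σ`-algebra to the weak topology. -/
lemma stronglyMeasurable_probabilityMeasure :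
    StronglyMeasurable fun μ : {μ : Measure X // IsProbabilityMeasure μ} =>
      ProbabilityMeasure.ofMeasure μ.1 μ.2 := by
  let := TopologicalSpace.metrizableSpaceMetric X
  rcases isEmpty_or_nonempty X with hE | hE
  · have : IsEmpty {μ : Measure X // IsProbabilityMeasure μ} := ⟨fun μ =>
      have := μ.2
      (nonempty_of_isProbabilityMeasure μ.1).elim hE.elim⟩
    exact .of_subsingleton_dom
  · have : ∀ μ : {μ : Measure X // IsProbabilityMeasure μ}, IsProbabilityMeasure μ.1 := fun μ => μ.2
    let s : ℕ → SimpleFunc X X := SimpleFunc.nearestPt (TopologicalSpace.denseSeq X)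
    let F : ∀ k, Weights (s k).range → ProbabilityMeasure X := fun k p =>
      .ofMeasure (discreteMeasure (fun y => y.1) p.1) inferInstance
    refine stronglyMeasurable_of_tendsto_weights (Ω := {μ : Measure X // IsProbabilityMeasure μ})
      (m := fun μ => μ.1) measurable_subtype_coe s F
      (fun k => continuous_probabilityMeasure_discreteMeasure _) fun μ => ?_
    refine ProbabilityMeasure.tendsto_iff_forall_integral_tendsto.2 fun f => ?_
    have h1 : ∀ k, ∫ y, f y ∂(F k ((s k).weights μ.1) : Measure X) = ∫ x, f (s k x) ∂μ.1 := by
      intro k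
      have h2 : (F k ((s k).weights μ.1) : Measure X) = μ.1.map (s k) :=
        discreteMeasure_weights (s k) (SimpleFunc.measurable _) μ.1
      rw [h2, integral_map (SimpleFunc.measurable _).aemeasurable
        f.continuous.measurable.aestronglyMeasurable]
    simp only [h1]
    refine tendsto_integral_of_dominated_convergence (fun _ => ‖f‖)
      (fun k => (f.continuous.measurable.comp (SimpleFunc.measurable _)).aestronglyMeasurable)
      (integrable_const _) (fun k => .of_forall fun x => f.norm_coe_le_norm _)
      (.of_forall fun x => ?_)
    exact (f.continuous.tendsto x).comp
      (SimpleFunc.tendsto_nearestPt (TopologicalSpace.denseRange_denseSeq X x))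

lemma separableSpace_probabilityMeasure :
    TopologicalSpace.SeparableSpace (ProbabilityMeasure X) := by
  have h := (stronglyMeasurable_probabilityMeasure (X := X)).isSeparable_range
  have : Set.range (fun μ : {μ : Measure X // IsProbabilityMeasure μ} =>
      ProbabilityMeasure.ofMeasure μ.1 μ.2) = Set.univ := Set.eq_univ_of_forall fun μ => ⟨μ, rfl⟩
  rw [this] at h
  exact TopologicalSpace.isSeparable_univ_iff.1 h

lemma isAnalyticSpace_probabilityMeasure (hX : IsAnalyticSpace X) :
    @IsAnalyticSpace (ProbabilityMeasure X) (borel _) :=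
  let _ : MeasurableSpace (ProbabilityMeasure X) := borel _
  have : BorelSpace (ProbabilityMeasure X) := ⟨rfl⟩
  hX.probabilityMeasure.of_surjective stronglyMeasurable_probabilityMeasure.measurable
    fun μ => ⟨⟨μ.1, μ.2⟩, rfl⟩

end

/-- The topological spaces to which the hierarchical gluing argument applies: separable metrizable
spaces which are Borel images of the real line (or empty). -/
class IsSuslin (X : TopCat.{u}) : Prop where
  metrizable : TopologicalSpace.MetrizableSpace X
  secondCountable : SecondCountableTopology X
  analytic : @IsAnalyticSpace X (borel X)

attribute [instance] IsSuslin.metrizable IsSuslin.secondCountable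

instance (X : TopCat.{u}) [hX : IsSuslin X] : IsSuslin (P X) :=
  let _ : MeasurableSpace X := borel X
  have : BorelSpace X := ⟨rfl⟩
  have hm : TopologicalSpace.MetrizableSpace (ProbabilityMeasure X) := inferInstance
  { metrizable := hm
    secondCountable := by
      have : TopologicalSpace.SeparableSpace (ProbabilityMeasure X) :=
        separableSpace_probabilityMeasure
      have : SecondCountableTopology (ProbabilityMeasure X) := by
        let := TopologicalSpace.metrizableSpaceMetric (ProbabilityMeasure X)
        exact UniformSpace.secondCountable_of_separable _
      exact this
    analytic := isAnalyticSpace_probabilityMeasure hX.analytic }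

instance isSuslin_iter (X : TopCat.{u}) [IsSuslin X] : ∀ n, IsSuslin (iter X n)
  | 0 => inferInstanceAs (IsSuslin X)
  | n + 1 => have := isSuslin_iter X n; inferInstanceAs (IsSuslin (P (iter X n)))

instance (X : Type u) [TopologicalSpace X] [PolishSpace X] : IsSuslin (TopCat.of X) where
  metrizable := inferInstanceAs (TopologicalSpace.MetrizableSpace X)
  secondCountable := inferInstanceAs (SecondCountableTopology X)
  analytic :=
    let _ : MeasurableSpace X := borel X
    have : BorelSpace X := ⟨rfl⟩
    isAnalyticSpace_of_standardBorel X

variable {W : TopCat.{u}} {X : TopCat.{v}} {Y : TopCat.{w}} {Z : TopCat.{z}}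
  {f₁ : C(X, Z)} {f₂ : C(Y, Z)} {g₁ : C(W, X)} {g₂ : C(W, Y)}

lemma P.map_map_eq (h : ∀ w, f₁ (g₁ w) = f₂ (g₂ w)) (α : P W) :
    P.map f₁ (P.map g₁ α) = P.map f₂ (P.map g₂ α) := by
  let _ : MeasurableSpace W := borel W
  have : BorelSpace W := ⟨rfl⟩
  let _ : MeasurableSpace X := borel X
  have : BorelSpace X := ⟨rfl⟩
  let _ : MeasurableSpace Y := borel Y
  have : BorelSpace Y := ⟨rfl⟩
  let _ : MeasurableSpace Z := borel Z
  have : BorelSpace Z := ⟨rfl⟩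
  let α' : ProbabilityMeasure W := α
  have key : ((α' : Measure W).map g₁).map f₁ = ((α' : Measure W).map g₂).map f₂ := by
    rw [Measure.map_map f₁.continuous.measurable g₁.continuous.measurable,
      Measure.map_map f₂.continuous.measurable g₂.continuous.measurable]
    exact congrArg (fun k => Measure.map k (α' : Measure W)) (funext h)
  exact Subtype.ext key

lemma surjective_fiberLift_map [hW : IsSuslin W] [hX : IsSuslin X] [hY : IsSuslin Y]
    [hZ : IsSuslin Z] {h : ∀ w, f₁ (g₁ w) = f₂ (g₂ w)} (hs : Function.Surjective (fiberLift h))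
    (h' : ∀ α, P.map f₁ (P.map g₁ α) = P.map f₂ (P.map g₂ α)) :
    Function.Surjective (fiberLift h') := by
  let _ : MeasurableSpace W := borel W
  have : BorelSpace W := ⟨rfl⟩
  let _ : MeasurableSpace X := borel X
  have : BorelSpace X := ⟨rfl⟩
  let _ : MeasurableSpace Y := borel Y
  have : BorelSpace Y := ⟨rfl⟩
  let _ : MeasurableSpace Z := borel Z
  have : BorelSpace Z := ⟨rfl⟩
  rintro ⟨⟨μ, ν⟩, hμν⟩
  let μ' : ProbabilityMeasure X := μ
  let ν' : ProbabilityMeasure Y := ν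
  have hmap : (μ' : Measure X).map f₁ = (ν' : Measure Y).map f₂ :=
    congrArg (fun ρ : ProbabilityMeasure Z => (ρ : Measure Z)) hμν
  obtain ⟨α, hα, hα₁, hα₂, -⟩ := exists_lift hW.analytic hX.analytic hY.analytic
    f₁.continuous.measurable f₂.continuous.measurable g₁.continuous.measurable
    g₂.continuous.measurable .univ (fun x y hxy => by
      obtain ⟨w, hw⟩ := hs ⟨(x, y), hxy⟩
      have h1 : (g₁ w, g₂ w) = (x, y) := congrArg Subtype.val hw
      exact ⟨w, trivial, (Prod.ext_iff.1 h1).1, (Prod.ext_iff.1 h1).2⟩)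
    (μ' : Measure X) (ν' : Measure Y) hmap
  let α' : ProbabilityMeasure W := ⟨α, hα⟩
  exact ⟨α', Subtype.ext (Prod.ext (Subtype.ext hα₁) (Subtype.ext hα₂))⟩

theorem exists_surjective_fiberLift_iterMap [IsSuslin W] [IsSuslin X] [IsSuslin Y] [IsSuslin Z]
    (h : ∀ w, f₁ (g₁ w) = f₂ (g₂ w)) (hs : Function.Surjective (fiberLift h)) (n : ℕ) :
    ∃ comm : ∀ α, iterMap f₁ n (iterMap g₁ n α) = iterMap f₂ n (iterMap g₂ n α),
      Function.Surjective (fiberLift comm) := by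
  induction n with
  | zero => exact ⟨h, hs⟩
  | succ n ih =>
    obtain ⟨comm, hn⟩ := ih
    exact ⟨P.map_map_eq comm, surjective_fiberLift_map hn _⟩

end WeakHierarchy

/-! ### The square mean of a nonnegative function -/

/-- The `L²` norm of a function with values in `[0, ∞]`. -/
def l2Norm {α : Type*} [MeasurableSpace α] (μ : Measure α) (f : α → ℝ≥0∞) : ℝ≥0∞ :=
  (∫⁻ x, f x ^ 2 ∂μ) ^ (1 / 2 : ℝ)

section

variable {α : Type*} [MeasurableSpace α] {μ : Measure α} {f g : α → ℝ≥0∞}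

lemma ENNReal.rpow_half_sq (a : ℝ≥0∞) : (a ^ 2) ^ (1 / 2 : ℝ) = a := by
  rw [← ENNReal.rpow_natCast, ← ENNReal.rpow_mul]; norm_num

lemma ENNReal.sq_rpow_half (a : ℝ≥0∞) : (a ^ (1 / 2 : ℝ)) ^ 2 = a := by
  rw [← ENNReal.rpow_natCast, ← ENNReal.rpow_mul]; norm_num

lemma l2Norm_sq : l2Norm μ f ^ 2 = ∫⁻ x, f x ^ 2 ∂μ := ENNReal.sq_rpow_half _

lemma l2Norm_mono_ae (h : ∀ᵐ x ∂μ, f x ≤ g x) : l2Norm μ f ≤ l2Norm μ g := by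
  refine ENNReal.rpow_le_rpow (lintegral_mono_ae ?_) (by norm_num)
  filter_upwards [h] with x hx
  gcongr

lemma l2Norm_mono (h : ∀ x, f x ≤ g x) : l2Norm μ f ≤ l2Norm μ g := l2Norm_mono_ae (.of_forall h)

lemma l2Norm_add_le (hf : Measurable f) (hg : Measurable g) :
    l2Norm μ (fun x => f x + g x) ≤ l2Norm μ f + l2Norm μ g := by
  have := ENNReal.lintegral_Lp_add_le (μ := μ) (p := 2) hf.aemeasurable hg.aemeasurable
    (by norm_num)
  simp only [ENNReal.rpow_two, Pi.add_apply] at this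
  exact this

lemma l2Norm_const_mul (c : ℝ≥0∞) (hf : Measurable f) :
    l2Norm μ (fun x => c * f x) = c * l2Norm μ f := by
  unfold l2Norm
  simp only [mul_pow]
  rw [lintegral_const_mul _ (hf.pow_const 2), ENNReal.mul_rpow_of_nonneg _ _ (by norm_num),
    ENNReal.rpow_half_sq]

lemma l2Norm_const [IsProbabilityMeasure μ] (c : ℝ≥0∞) : l2Norm μ (fun _ => c) = c := by
  unfold l2Norm
  rw [lintegral_const, measure_univ, mul_one, ENNReal.rpow_half_sq]

lemma l2Norm_one_add_le [IsProbabilityMeasure μ] (hg : Measurable g) (C : ℝ≥0∞) :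
    l2Norm μ (fun x => C * (1 + g x)) ≤ C * (1 + l2Norm μ g) := by
  rw [l2Norm_const_mul (f := fun x => 1 + g x) _ (measurable_const.add hg)]
  gcongr
  exact (l2Norm_add_le measurable_const hg).trans_eq (by rw [l2Norm_const])

lemma l2Norm_map {β : Type*} [MeasurableSpace β] {φ : α → β} (hφ : Measurable φ) {f : β → ℝ≥0∞}
    (hf : Measurable f) : l2Norm (μ.map φ) f = l2Norm μ (fun x => f (φ x)) := by
  unfold l2Norm
  rw [lintegral_map (hf.pow_const 2) hφ]

lemma l2Norm_lt_top : l2Norm μ f < ⊤ ↔ ∫⁻ x, f x ^ 2 ∂μ < ⊤ :=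
  ENNReal.rpow_lt_top_iff_of_pos (by norm_num)

end

namespace DistSpace

lemma hypot_le_add (a b : ℝ≥0∞) : hypot a b ≤ a + b := by
  rw [← ENNReal.rpow_half_sq (a + b)]
  refine ENNReal.rpow_le_rpow ?_ (by norm_num)
  rw [add_sq]
  calc a ^ 2 + b ^ 2 ≤ a ^ 2 + b ^ 2 + 2 * a * b := le_self_add
    _ = _ := by ring

lemma hypot_mono {a b a' b' : ℝ≥0∞} (h : a ≤ a') (h' : b ≤ b') : hypot a b ≤ hypot a' b' := by
  unfold hypot
  gcongr

lemma le_hypot_left (a b : ℝ≥0∞) : a ≤ hypot a b := by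
  conv_lhs => rw [← ENNReal.rpow_half_sq a]
  unfold hypot
  gcongr
  exact le_self_add

lemma le_hypot_right (a b : ℝ≥0∞) : b ≤ hypot a b := by
  conv_lhs => rw [← ENNReal.rpow_half_sq b]
  unfold hypot
  gcongr
  exact le_add_self

/-! ### Suslin metric spaces -/

/-- The axioms of a metric, for a space with a distance. -/
class IsMetric (X : DistSpace.{u}) : Prop where
  d_comm : ∀ x y : X, X.d x y = X.d y x
  d_triangle : ∀ x y z : X, X.d x z ≤ X.d x y + X.d y z
  eq_of_d_eq_zero : ∀ x y : X, X.d x y = 0 → x = y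
  d_ne_top : ∀ x y : X, X.d x y ≠ ⊤

/-- The spaces to which the hierarchical gluing argument applies: separable metric spaces which are
measurable images of the real line (or empty). Unlike completeness, this property is also easily
checked for spaces of measures. -/
class IsSuslin (X : DistSpace.{u}) : Prop extends IsMetric X where
  separable : TopologicalSpace.SeparableSpace X
  analytic : IsAnalyticSpace X

attribute [instance] IsSuslin.separable

lemma isOpen_iff {X : DistSpace.{u}} {s : Set X} :
    IsOpen s ↔ ∀ x ∈ s, ∃ ε > 0, ∀ y, X.d y x < ε → y ∈ s := Iff.rfl

lemma nhds_basis {X : DistSpace.{u}} (h_comm : ∀ x y : X, X.d x y = X.d y x)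
    (h_triangle : ∀ x y z : X, X.d x z ≤ X.d x y + X.d y z) (x : X) :
    (𝓝 x).HasBasis (fun c : ℝ≥0∞ => 0 < c) (fun c => {y | X.d x y < c}) := by
  refine ⟨fun s => ?_⟩
  rw [mem_nhds_iff]
  constructor
  · rintro ⟨t, hts, ht, hx⟩
    obtain ⟨ε, hε, h⟩ := isOpen_iff.1 ht x hx
    exact ⟨ε, hε, fun y hy => hts (h y (by rw [h_comm]; exact hy))⟩
  · rintro ⟨c, hc, hcs⟩
    refine ⟨_, hcs, isOpen_iff.2 fun y hy => ⟨c - X.d x y, tsub_pos_of_lt hy, fun z hz => ?_⟩, ?_⟩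
    · change X.d x z < c
      rw [h_comm] at hz
      calc X.d x z ≤ X.d x y + X.d y z := h_triangle _ _ _
        _ < c := by rw [add_comm]; exact lt_tsub_iff_right.1 hz
    · change X.d x x < c
      rwa [X.d_self]

/-- If the balls of the distance are neighborhood bases of a topology, then this topology is the
topology of the distance. -/
lemma topology_eq {X : DistSpace.{u}} (h_comm : ∀ x y : X, X.d x y = X.d y x)
    (h_triangle : ∀ x y z : X, X.d x z ≤ X.d x y + X.d y z) (t : TopologicalSpace X)
    (h : ∀ x, (@nhds X t x).HasBasis (fun c : ℝ≥0∞ => 0 < c) (fun c => {y | X.d x y < c})) :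
    t = instTopologicalSpaceCarrier X :=
  TopologicalSpace.ext_nhds fun x => (h x).eq_of_same_basis (nhds_basis h_comm h_triangle x)

section

variable {X : DistSpace.{u}} [hX : IsMetric X]

instance : EMetricSpace X.carrier where
  __ := PseudoEMetricSpace.ofEDistOfTopology X.d X.d_self hX.d_comm hX.d_triangle
    (nhds_basis hX.d_comm hX.d_triangle)
  eq_of_edist_eq_zero h := hX.eq_of_d_eq_zero _ _ h

lemma edist_eq (x y : X) : edist x y = X.d x y := rfl

instance : TopologicalSpace.MetrizableSpace X.carrier :=
  letI := EMetricSpace.toMetricSpace (α := X.carrier) hX.d_ne_top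
  inferInstance

end

section

variable {X : DistSpace.{u}} [hX : IsSuslin X]

instance : SecondCountableTopology X.carrier := UniformSpace.secondCountable_of_separable _

lemma continuous_d : Continuous fun p : X × X => X.d p.1 p.2 := continuous_edist

lemma measurable_d : Measurable fun p : X × X => X.d p.1 p.2 := continuous_d.measurable

lemma measurable_d_right (x : X) : Measurable fun y : X => X.d x y :=
  measurable_d.comp (measurable_const.prodMk measurable_id)

end

end DistSpace

/-! ### The Wasserstein distance -/

namespace DistSpace

section Plans

variable {X : DistSpace.{u}}

lemma W2_le {μ ν : Measure X} (γ : Measure (X × X)) (h₁ : γ.map Prod.fst = μ)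
    (h₂ : γ.map Prod.snd = ν) : W2 μ ν ≤ l2Norm γ fun p => X.d p.1 p.2 :=
  ENNReal.rpow_le_rpow (iInf₂_le γ ⟨h₁, h₂⟩) (by norm_num)

lemma le_W2 {μ ν : Measure X} {c : ℝ≥0∞}
    (h : ∀ γ : Measure (X × X), γ.map Prod.fst = μ → γ.map Prod.snd = ν →
      c ≤ l2Norm γ fun p => X.d p.1 p.2) : c ≤ W2 μ ν := by
  rw [← ENNReal.rpow_half_sq c]
  refine ENNReal.rpow_le_rpow (le_iInf₂ fun γ hγ => ?_) (by norm_num)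
  rw [← l2Norm_sq]
  exact pow_le_pow_left' (h γ hγ.1 hγ.2) 2

lemma exists_plan_lt {μ ν : Measure X} {c : ℝ≥0∞} (h : W2 μ ν < c) :
    ∃ γ : Measure (X × X), γ.map Prod.fst = μ ∧ γ.map Prod.snd = ν ∧
      l2Norm γ (fun p => X.d p.1 p.2) < c := by
  by_contra! hc
  exact (le_W2 hc).not_gt h

lemma isProbabilityMeasure_of_map {α β : Type*} [MeasurableSpace α] [MeasurableSpace β]
    {γ : Measure α} {f : α → β} (hf : Measurable f) (h : IsProbabilityMeasure (γ.map f)) :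
    IsProbabilityMeasure γ :=
  ⟨by rw [← Set.preimage_univ (f := f), ← Measure.map_apply hf .univ]; exact measure_univ⟩

variable [hX : IsSuslin X]

lemma W2_comm (μ ν : Measure X) : W2 μ ν = W2 ν μ := by
  have key : ∀ μ ν : Measure X, W2 μ ν ≤ W2 ν μ := by
    intro μ ν
    refine le_W2 fun γ h₁ h₂ => ?_
    refine (W2_le (γ.map Prod.swap) ?_ ?_).trans_eq ?_
    · rw [Measure.map_map measurable_fst measurable_swap, ← h₂]; rfl
    · rw [Measure.map_map measurable_snd measurable_swap, ← h₁]; rfl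
    · rw [l2Norm_map measurable_swap measurable_d]
      exact congrArg (l2Norm γ) (funext fun p => hX.d_comm _ _)
  exact le_antisymm (key _ _) (key _ _)

lemma W2_triangle (μ ν ρ : Measure X) [hν : IsProbabilityMeasure ν] :
    W2 μ ρ ≤ W2 μ ν + W2 ν ρ := by
  -- Plans close to the infimum are used, since optimal plans need not exist here.
  refine ENNReal.le_of_forall_pos_le_add fun ε hε hlt => ?_
  have h1 := ne_top_of_le_ne_top hlt.ne (le_self_add : W2 μ ν ≤ W2 μ ν + W2 ν ρ)
  have h2 := ne_top_of_le_ne_top hlt.ne (le_add_self : W2 ν ρ ≤ W2 μ ν + W2 ν ρ)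
  have hε2 : (0 : ℝ≥0∞) < ε / 2 := ENNReal.half_pos (by exact_mod_cast hε.ne')
  obtain ⟨γ₁, h₁₁, h₁₂, hγ₁⟩ := exists_plan_lt (ENNReal.lt_add_right h1 hε2.ne')
  obtain ⟨γ₂, h₂₁, h₂₂, hγ₂⟩ := exists_plan_lt (ENNReal.lt_add_right h2 hε2.ne')
  have : IsProbabilityMeasure γ₁ := isProbabilityMeasure_of_map measurable_snd (h₁₂ ▸ hν)
  have : IsProbabilityMeasure γ₂ := isProbabilityMeasure_of_map measurable_fst (h₂₁ ▸ hν)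
  obtain ⟨γ, _, rfl, rfl, hγ⟩ := exists_glue (hX.analytic.prod hX.analytic)
    (hX.analytic.prod hX.analytic) (measurable_snd : Measurable (Prod.snd : X × X → X))
    (measurable_fst : Measurable (Prod.fst : X × X → X)) γ₁ γ₂ (h₁₂.trans h₂₁.symm)
  have m₁ : Measurable fun q : (X × X) × X × X => X.d q.1.1 q.1.2 :=
    measurable_d.comp measurable_fst
  have m₂ : Measurable fun q : (X × X) × X × X => X.d q.2.1 q.2.2 :=
    measurable_d.comp measurable_snd
  have hm : Measurable fun q : (X × X) × X × X => (q.1.1, q.2.2) := by fun_prop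
  rw [l2Norm_map measurable_fst measurable_d] at hγ₁
  rw [l2Norm_map measurable_snd measurable_d] at hγ₂
  calc W2 μ ρ ≤ l2Norm (γ.map fun q => (q.1.1, q.2.2)) fun p => X.d p.1 p.2 := by
        refine W2_le _ ?_ ?_
        · rw [Measure.map_map measurable_fst hm, ← h₁₁,
            Measure.map_map measurable_fst measurable_fst]
          rfl
        · rw [Measure.map_map measurable_snd hm, ← h₂₂,
            Measure.map_map measurable_snd measurable_snd]
          rfl
    _ = l2Norm γ fun q => X.d q.1.1 q.2.2 := l2Norm_map hm measurable_d
    _ ≤ l2Norm γ fun q => X.d q.1.1 q.1.2 + X.d q.2.1 q.2.2 := by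
        refine l2Norm_mono_ae ?_
        filter_upwards [hγ] with q hq
        rw [hq]
        exact hX.d_triangle _ _ _
    _ ≤ _ := l2Norm_add_le m₁ m₂
    _ ≤ (W2 μ ν + ε / 2) + (W2 ν ρ + ε / 2) := add_le_add hγ₁.le hγ₂.le
    _ = _ := by rw [add_add_add_comm, ENNReal.add_halves]

/-- A transport plan of small cost moves little mass by more than `δ`, by Chebyshev's inequality. -/
lemma measure_le_measure_thickening_of_W2_eq_zero {μ ν : Measure X} {A : Set X} (hA : IsClosed A)
    {δ : ℝ} (hδ : 0 < δ) (h : W2 μ ν = 0) : μ A ≤ ν (Metric.thickening δ A) := by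
  refine ENNReal.le_of_forall_pos_le_add fun ε hε _ => ?_
  have hδ' : ENNReal.ofReal δ ^ 2 ≠ 0 := pow_ne_zero 2 (by simpa using hδ)
  have hc : 0 < (ε * ENNReal.ofReal δ ^ 2) ^ (1 / 2 : ℝ) :=
    ENNReal.rpow_pos (ENNReal.mul_pos (by exact_mod_cast hε.ne') hδ') (by finiteness)
  obtain ⟨γ, rfl, rfl, hγ⟩ := exists_plan_lt (h.trans_lt hc)
  have hγ2 : ∫⁻ p, X.d p.1 p.2 ^ 2 ∂γ ≤ ε * ENNReal.ofReal δ ^ 2 := by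
    rw [← l2Norm_sq, ← ENNReal.sq_rpow_half (ε * ENNReal.ofReal δ ^ 2)]
    exact pow_le_pow_left' hγ.le 2
  let B : Set (X × X) := {p | ENNReal.ofReal δ ^ 2 ≤ X.d p.1 p.2 ^ 2}
  have hB : γ B ≤ ε := by
    have := mul_meas_ge_le_lintegral (μ := γ) (measurable_d (X := X) |>.pow_const 2)
      (ENNReal.ofReal δ ^ 2)
    refine (ENNReal.mul_le_mul_iff_right hδ' (by finiteness)).1 (this.trans ?_)
    rwa [mul_comm]
  rw [Measure.map_apply measurable_fst hA.measurableSet,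
    Measure.map_apply measurable_snd Metric.isOpen_thickening.measurableSet]
  refine (measure_mono (?_ : _ ⊆ Prod.snd ⁻¹' Metric.thickening δ A ∪ B)).trans
    ((measure_union_le _ _).trans (add_le_add_right hB _))
  rintro ⟨x, y⟩ hx
  by_cases hxy : ENNReal.ofReal δ ^ 2 ≤ X.d x y ^ 2
  · exact Or.inr hxy
  · refine Or.inl ((Metric.mem_thickening_iff_exists_edist_lt _ _).2 ⟨x, hx, ?_⟩)
    rw [edist_comm, edist_eq]
    exact lt_of_pow_lt_pow_left' 2 (not_le.1 hxy)

/-- Measures at distance `0` agree on closed sets, as limits of their thickenings. -/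
lemma eq_of_W2_eq_zero {μ ν : Measure X} [IsProbabilityMeasure μ] [IsProbabilityMeasure ν]
    (h : W2 μ ν = 0) : μ = ν := by
  have key : ∀ μ ν : Measure X, IsProbabilityMeasure ν → W2 μ ν = 0 → ∀ A, IsClosed A →
      μ A ≤ ν A := by
    intro μ ν _ h A hA
    refine ge_of_tendsto (tendsto_measure_thickening_of_isClosed
      ⟨1, one_pos, measure_ne_top _ _⟩ hA) ?_
    filter_upwards [self_mem_nhdsWithin] with δ hδ
    exact measure_le_measure_thickening_of_W2_eq_zero hA hδ h
  refine ext_of_generate_finite _ borel_eq_generateFrom_isClosed isPiSystem_isClosed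
    (fun A hA => le_antisymm (key μ ν ‹_› h A hA) (key ν μ ‹_› ?_ A hA)) (by simp)
  rwa [W2_comm]

/-- The distance of a measure from a Dirac mass. -/
lemma W2_dirac (x : X) (μ : Measure X) [IsProbabilityMeasure μ] :
    W2 (Measure.dirac x) μ = l2Norm μ (X.d x) := by
  have hm : Measurable fun y : X => (x, y) := measurable_const.prodMk measurable_id
  refine le_antisymm ((W2_le (μ.map fun y => (x, y)) ?_ ?_).trans_eq
    (l2Norm_map hm measurable_d)) (le_W2 fun γ h₁ h₂ => ?_)
  · rw [Measure.map_map measurable_fst hm]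
    exact (Measure.map_const μ x).trans (by simp)
  · rw [Measure.map_map measurable_snd hm]
    exact Measure.map_id
  · rw [← h₂, l2Norm_map measurable_snd (measurable_d_right x)]
    refine l2Norm_mono_ae ?_
    have : ∀ᵐ p ∂γ, p.1 = x := by
      have h : ∀ᵐ y ∂(γ.map Prod.fst), y = x := by rw [h₁]; simp
      exact (ae_map_iff measurable_fst.aemeasurable (measurableSet_singleton x)).1 h
    filter_upwards [this] with p hp
    rw [hp]

lemma isP2_dirac (x : X) : IsP2 (Measure.dirac x) :=
  ⟨inferInstance, x, by rw [lintegral_dirac, X.d_self]; simp⟩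

lemma l2Norm_d_lt_top {μ : Measure X} (hμ : IsP2 μ) (x : X) : l2Norm μ (X.d x) < ⊤ := by
  have := hμ.prob
  obtain ⟨y, hy⟩ := hμ.moment
  calc l2Norm μ (X.d x) ≤ l2Norm μ fun z => X.d x y + X.d y z :=
        l2Norm_mono fun z => hX.d_triangle _ _ _
    _ ≤ X.d x y + l2Norm μ (X.d y) :=
        (l2Norm_add_le measurable_const (measurable_d_right y)).trans_eq (by rw [l2Norm_const])
    _ < ⊤ := ENNReal.add_lt_top.2 ⟨(hX.d_ne_top _ _).lt_top, l2Norm_lt_top.2 hy⟩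

lemma isP2_iff (x : X) {μ : Measure X} :
    IsP2 μ ↔ IsProbabilityMeasure μ ∧ l2Norm μ (X.d x) < ⊤ :=
  ⟨fun h => ⟨h.prob, l2Norm_d_lt_top h x⟩, fun h => ⟨h.1, x, l2Norm_lt_top.1 h.2⟩⟩

lemma W2_lt_top {μ ν : Measure X} (hμ : IsP2 μ) (hν : IsP2 ν) : W2 μ ν < ⊤ := by
  have := hμ.prob
  have := hν.prob
  obtain ⟨x, -⟩ := hμ.moment
  refine (W2_triangle μ (Measure.dirac x) ν).trans_lt (ENNReal.add_lt_top.2 ⟨?_, ?_⟩)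
  · rw [W2_comm, W2_dirac]; exact l2Norm_d_lt_top hμ x
  · rw [W2_dirac]; exact l2Norm_d_lt_top hν x

end Plans

end DistSpace

/-! ### The Wasserstein space of a Suslin space is Suslin -/

lemma discreteMeasure_apply {X ι : Type*} [MeasurableSpace X] [Fintype ι] (x : ι → X)
    (p : ι → ℝ≥0) {A : Set X} (hA : MeasurableSet A) :
    discreteMeasure x p A = ∑ i, (p i : ℝ≥0∞) * A.indicator (1 : X → ℝ≥0∞) (x i) := by
  rw [← lintegral_indicator_one hA, lintegral_discreteMeasure _ _ (measurable_one.indicator hA)]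

/-- Two probability vectors have a coupling whose mass off the diagonal is the total variation
of their difference. -/
lemma exists_coupling_weights {ι : Type*} [Fintype ι] [DecidableEq ι] (p q : Weights ι) :
    ∃ r : ι × ι → ℝ≥0, (∀ i, ∑ j, r (i, j) = p.1 i) ∧ (∀ j, ∑ i, r (i, j) = q.1 j) ∧
      ∑ k, (if k.1 = k.2 then 0 else r k) ≤ ∑ i, (p.1 i - min (p.1 i) (q.1 i)) := by
  -- Leave the common part `c` of `p` and `q` on the diagonal, and take the normalized product of the
  -- remainders `a` and `b`; if these vanish, the division by `m = 0` gives `0`, as it should.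
  set c : ι → ℝ≥0 := fun i => min (p.1 i) (q.1 i)
  set a : ι → ℝ≥0 := fun i => p.1 i - c i
  set b : ι → ℝ≥0 := fun i => q.1 i - c i
  have ha : ∀ i, c i + a i = p.1 i := fun i => add_tsub_cancel_of_le (min_le_left _ _)
  have hb : ∀ i, c i + b i = q.1 i := fun i => add_tsub_cancel_of_le (min_le_right _ _)
  have hab : ∑ i, a i = ∑ i, b i := by
    refine add_left_cancel (a := ∑ i, c i) ?_
    rw [← Finset.sum_add_distrib, ← Finset.sum_add_distrib]
    simp only [ha, hb, p.2, q.2]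
  set m : ℝ≥0 := ∑ i, a i
  have hm : ∀ i, a i * m / m = a i := fun i => by
    by_cases h : m = 0
    · rw [h, div_zero]
      exact ((Finset.sum_eq_zero_iff.1 h) i (Finset.mem_univ i)).symm
    · exact mul_div_cancel_right₀ _ h
  have hm' : ∀ i, m * b i / m = b i := fun i => by
    by_cases h : m = 0
    · rw [h, div_zero]
      exact ((Finset.sum_eq_zero_iff.1 (hab.symm.trans h)) i (Finset.mem_univ i)).symm
    · exact mul_div_cancel_left₀ _ h
  refine ⟨fun k => (if k.1 = k.2 then c k.1 else 0) + a k.1 * b k.2 / m, fun i => ?_, fun j => ?_,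
    ?_⟩
  · simp only [Finset.sum_add_distrib, Finset.sum_ite_eq, Finset.mem_univ, if_true]
    rw [← Finset.sum_div, ← Finset.mul_sum, ← hab, hm, ha]
  · simp only [Finset.sum_add_distrib, Finset.sum_ite_eq', Finset.mem_univ, if_true]
    rw [← Finset.sum_div, ← Finset.sum_mul, hm', hb]
  · calc ∑ k : ι × ι, (if k.1 = k.2 then 0 else (if k.1 = k.2 then c k.1 else 0) +
          a k.1 * b k.2 / m) ≤ ∑ k : ι × ι, a k.1 * b k.2 / m := by
          refine Finset.sum_le_sum fun k _ => ?_
          split_ifs <;> simp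
      _ = ∑ i, ∑ j, a i * b j / m := Fintype.sum_prod_type _
      _ = ∑ i, a i := Finset.sum_congr rfl fun i _ => by
          rw [← Finset.sum_div, ← Finset.mul_sum, ← hab, hm]
      _ ≤ _ := le_rfl

namespace DistSpace

/-- A measure with finite second moment, as a point of `P₂(X)`. -/
def P2.mk {X : DistSpace.{u}} (μ : Measure X) (hμ : IsP2 μ) : P2 X := ⟨μ, hμ⟩

variable {X : DistSpace.{u}} [hX : IsSuslin X]

instance : IsMetric (P2 X) where
  d_comm μ ν := W2_comm μ.1 ν.1
  d_triangle μ ν ρ := have := ν.2.prob; W2_triangle μ.1 ν.1 ρ.1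
  eq_of_d_eq_zero μ ν h := have := μ.2.prob; have := ν.2.prob; Subtype.ext (eq_of_W2_eq_zero h)
  d_ne_top μ ν := (W2_lt_top μ.2 ν.2).ne

lemma isP2_discreteMeasure {ι : Type*} [Fintype ι] (x : ι → X) (p : Weights ι) :
    IsP2 (discreteMeasure x p.1) := by
  obtain ⟨y⟩ := nonempty_of_isProbabilityMeasure (discreteMeasure x p.1)
  refine ⟨inferInstance, y, ?_⟩
  rw [lintegral_discreteMeasure _ _ ((measurable_d_right y).pow_const 2)]
  exact ENNReal.sum_lt_top.2 fun i _ => ENNReal.mul_lt_top ENNReal.coe_lt_top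
    (ENNReal.pow_lt_top (hX.d_ne_top _ _).lt_top)

lemma W2_discreteMeasure_sq_le {ι : Type*} [Fintype ι] (x : ι → X) {D : ℝ≥0∞}
    (hD : ∀ i j, X.d (x i) (x j) ^ 2 ≤ D) (p q : Weights ι) :
    W2 (discreteMeasure x p.1) (discreteMeasure x q.1) ^ 2 ≤
      (∑ i, (p.1 i - min (p.1 i) (q.1 i)) : ℝ≥0) * D := by
  classical
  obtain ⟨r, h₁, h₂, hr⟩ := exists_coupling_weights p q
  have hW := W2_le (discreteMeasure (fun k : ι × ι => (x k.1, x k.2)) r)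
    (μ := discreteMeasure x p.1) (ν := discreteMeasure x q.1) (by
      ext A hA
      rw [Measure.map_apply measurable_fst hA, discreteMeasure_apply _ _ (measurable_fst hA),
        discreteMeasure_apply _ _ hA, Fintype.sum_prod_type]
      refine Finset.sum_congr rfl fun i _ => ?_
      rw [← h₁ i, ENNReal.ofNNReal_finsetSum, Finset.sum_mul]
      rfl) (by
      ext A hA
      rw [Measure.map_apply measurable_snd hA, discreteMeasure_apply _ _ (measurable_snd hA),
        discreteMeasure_apply _ _ hA, Fintype.sum_prod_type_right]
      refine Finset.sum_congr rfl fun i _ => ?_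
      rw [← h₂ i, ENNReal.ofNNReal_finsetSum, Finset.sum_mul]
      rfl)
  refine (pow_le_pow_left' hW 2).trans ?_
  rw [l2Norm_sq, lintegral_discreteMeasure _ _ (measurable_d.pow_const 2)]
  calc ∑ k : ι × ι, (r k : ℝ≥0∞) * X.d (x k.1) (x k.2) ^ 2
      ≤ ∑ k : ι × ι, ((if k.1 = k.2 then 0 else r k : ℝ≥0) : ℝ≥0∞) * D := by
        refine Finset.sum_le_sum fun k _ => ?_
        split_ifs with hk
        · rw [hk, X.d_self]; simp
        · gcongr
          exact hD _ _
    _ = ((∑ k, (if k.1 = k.2 then 0 else r k) : ℝ≥0) : ℝ≥0∞) * D := by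
        rw [← Finset.sum_mul, ENNReal.ofNNReal_finsetSum]
    _ ≤ _ := by gcongr

lemma continuous_discreteMeasure {ι : Type*} [Fintype ι] (x : ι → X) :
    Continuous fun p : Weights ι => P2.mk (discreteMeasure x p.1) (isP2_discreteMeasure x p) := by
  let D : ℝ≥0∞ := ∑ i, ∑ j, X.d (x i) (x j) ^ 2
  have hD : ∀ i j, X.d (x i) (x j) ^ 2 ≤ D := fun i j =>
    (Finset.single_le_sum (f := fun j => X.d (x i) (x j) ^ 2) (fun _ _ => zero_le)
      (Finset.mem_univ j)).trans (Finset.single_le_sum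
        (f := fun i => ∑ j, X.d (x i) (x j) ^ 2) (fun _ _ => zero_le) (Finset.mem_univ i))
  have hDtop : D ≠ ⊤ := (ENNReal.sum_lt_top.2 fun i _ => ENNReal.sum_lt_top.2 fun j _ =>
    ENNReal.pow_lt_top (hX.d_ne_top _ _).lt_top).ne
  rw [continuous_iff_continuousAt]
  intro p
  refine tendsto_iff_edist_tendsto_0.2 ?_
  have h1 : Filter.Tendsto (fun q : Weights ι => ((((∑ i, (p.1 i - min (p.1 i) (q.1 i)) : ℝ≥0) :
      ℝ≥0∞) * D) ^ (1 / 2 : ℝ))) (𝓝 p) (𝓝 0) := by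
    have h2 : Continuous fun q : Weights ι => ∑ i, (p.1 i - min (p.1 i) (q.1 i)) :=
      continuous_finsetSum _ fun i _ => continuous_const.sub
        (continuous_const.min ((continuous_apply i).comp continuous_subtype_val))
    have h3 := (ENNReal.tendsto_coe.2 (h2.tendsto p))
    have h4 := ((ENNReal.Tendsto.mul_const h3 (Or.inr hDtop)).ennrpow_const (1 / 2))
    simpa using h4
  refine tendsto_of_tendsto_of_tendsto_of_le_of_le tendsto_const_nhds h1 (fun _ => zero_le)
    fun q => ?_
  rw [edist_comm, edist_eq, ← ENNReal.rpow_half_sq ((P2 X).d _ _)]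
  exact ENNReal.rpow_le_rpow (W2_discreteMeasure_sq_le x hD p q) (by norm_num)

/-- Every measure in `P₂(X)` is the limit of its images under nearest point maps to finite sets. -/
lemma tendsto_W2_map_nearestPt {e : ℕ → X} (he : DenseRange e) {μ : Measure X} (hμ : IsP2 μ) :
    Filter.Tendsto (fun k => W2 (μ.map (SimpleFunc.nearestPt e k)) μ) Filter.atTop (𝓝 0) := by
  have hprob := hμ.prob
  have hk : ∀ k, Measurable (SimpleFunc.nearestPt e k) := fun k => SimpleFunc.measurable _
  have hm : ∀ k, Measurable fun x : X => (SimpleFunc.nearestPt e k x, x) := fun k =>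
    (hk k).prodMk measurable_id
  have h1 : Filter.Tendsto
      (fun k => (∫⁻ x, X.d (SimpleFunc.nearestPt e k x) x ^ 2 ∂μ) ^ (1 / 2 : ℝ))
      Filter.atTop (𝓝 0) := by
    have h2 := tendsto_lintegral_of_dominated_convergence (μ := μ)
      (F := fun k x => X.d (SimpleFunc.nearestPt e k x) x ^ 2) (f := fun _ => 0)
      (fun x => X.d (e 0) x ^ 2) (fun k => (measurable_d.comp (hm k)).pow_const 2)
      (fun k => .of_forall fun x =>
        pow_le_pow_left' (SimpleFunc.edist_nearestPt_le e x (Nat.zero_le k)) 2)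
      (l2Norm_lt_top.1 (l2Norm_d_lt_top hμ (e 0))).ne
      (.of_forall fun x => by
        have h3 := tendsto_iff_edist_tendsto_0.1 (SimpleFunc.tendsto_nearestPt (he x))
        have h4 := ((ENNReal.continuous_pow 2).tendsto 0).comp h3
        rw [zero_pow two_ne_zero] at h4
        exact h4)
    simpa using h2.ennrpow_const (1 / 2)
  refine tendsto_of_tendsto_of_tendsto_of_le_of_le tendsto_const_nhds h1 (fun _ => zero_le)
    fun k => ?_
  refine (W2_le (μ.map fun x => (SimpleFunc.nearestPt e k x, x)) ?_ ?_).trans_eq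
    (l2Norm_map (hm k) measurable_d)
  · rw [Measure.map_map measurable_fst (hm k)]; rfl
  · rw [Measure.map_map measurable_snd (hm k)]; exact Measure.map_id

/-- The identity of `P₂(X)` is strongly measurable from the evaluation `σ`-algebra to the topology
of `W₂`. -/
lemma stronglyMeasurable_P2 :
    StronglyMeasurable fun μ : {μ : Measure X // IsP2 μ} => P2.mk μ.1 μ.2 := by
  rcases isEmpty_or_nonempty X with hE | hE
  · have : IsEmpty {μ : Measure X // IsP2 μ} := ⟨fun μ =>
      have := μ.2.prob
      (nonempty_of_isProbabilityMeasure μ.1).elim hE.elim⟩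
    exact .of_subsingleton_dom
  · have : ∀ μ : {μ : Measure X // IsP2 μ}, IsProbabilityMeasure μ.1 := fun μ => μ.2.prob
    let s : ℕ → SimpleFunc X X := SimpleFunc.nearestPt (TopologicalSpace.denseSeq X)
    let F : ∀ k, Weights (s k).range → P2 X := fun k p =>
      P2.mk (discreteMeasure (fun y => y.1) p.1) (isP2_discreteMeasure _ p)
    have hs : ∀ (μ : {μ : Measure X // IsP2 μ}) k,
        W2 (μ.1.map (s k)) μ.1 = edist (F k ((s k).weights μ.1)) (P2.mk μ.1 μ.2) := fun μ k =>
      congrArg (fun ν => W2 ν μ.1)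
        (discreteMeasure_weights (s k) (SimpleFunc.measurable _) μ.1).symm
    refine stronglyMeasurable_of_tendsto_weights (m := fun μ : {μ : Measure X // IsP2 μ} => μ.1)
      measurable_subtype_coe s F (fun k => continuous_discreteMeasure _) fun μ => ?_
    have h := tendsto_W2_map_nearestPt (TopologicalSpace.denseRange_denseSeq X) μ.2
    rw [show (fun k => W2 (μ.1.map (s k)) μ.1) = _ from funext (hs μ)] at h
    exact tendsto_iff_edist_tendsto_0.2 h

instance : IsSuslin (P2 X) where
  separable := by
    have h := (stronglyMeasurable_P2 (X := X)).isSeparable_range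
    have : Set.range (fun μ : {μ : Measure X // IsP2 μ} => P2.mk μ.1 μ.2) = Set.univ :=
      Set.eq_univ_of_forall fun μ => ⟨μ, rfl⟩
    rw [this] at h
    exact TopologicalSpace.isSeparable_univ_iff.1 h
  analytic := by
    intro h
    have hne : Nonempty X := by
      obtain ⟨μ⟩ := h
      have := μ.2.prob
      exact nonempty_of_isProbabilityMeasure μ.1
    obtain ⟨x⟩ := hne
    have hset : MeasurableSet {μ : {μ : Measure X // IsProbabilityMeasure μ} |
        l2Norm μ.1 (X.d x) < ⊤} := by
      refine measurableSet_lt ?_ measurable_const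
      exact ((Measure.measurable_lintegral ((measurable_d_right x).pow_const 2)).comp
        measurable_subtype_coe).pow_const _
    have h1 := hX.analytic.probabilityMeasure.subtype hset
    have h2 : IsAnalyticSpace {μ : Measure X // IsP2 μ} :=
      h1.of_surjective (f := fun μ => ⟨μ.1.1, (isP2_iff x).2 ⟨μ.1.2, μ.2⟩⟩)
        (measurable_subtype_coe.comp measurable_subtype_coe).subtype_mk
        fun μ => ⟨⟨⟨μ.1, μ.2.prob⟩, l2Norm_d_lt_top μ.2 x⟩, rfl⟩
    exact h2.of_surjective (stronglyMeasurable_P2 (X := X)).measurable (fun μ => ⟨μ, rfl⟩) h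

end DistSpace

/-! ### Push-forward as a morphism of Wasserstein spaces -/

namespace DistSpace

variable {X : DistSpace.{u}} {Y : DistSpace.{v}}

lemma IsMorphism.measurable {f : X → Y} (hf : IsMorphism f) : Measurable f :=
  hf.continuous.measurable

section

variable [hX : IsMetric X] [hY : IsMetric Y]

/-- Linear growth does not depend on the base points. -/
lemma LinearGrowth.exists_forall_le {f : X → Y} (hf : LinearGrowth f) (x₀ : X) (y₀ : Y) :
    ∃ C : ℝ≥0, ∀ x, Y.d y₀ (f x) ≤ C * (1 + X.d x₀ x) := by
  obtain ⟨x₁, y₁, C, hC⟩ := hf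
  have htop : Y.d y₀ y₁ + C * (1 + X.d x₁ x₀) ≠ ⊤ := by
    have := hY.d_ne_top y₀ y₁
    have := hX.d_ne_top x₁ x₀
    finiteness
  refine ⟨(Y.d y₀ y₁ + C * (1 + X.d x₁ x₀)).toNNReal, fun x => ?_⟩
  rw [ENNReal.coe_toNNReal htop]
  calc Y.d y₀ (f x) ≤ Y.d y₀ y₁ + Y.d y₁ (f x) := hY.d_triangle _ _ _
    _ ≤ Y.d y₀ y₁ + C * (1 + (X.d x₁ x₀ + X.d x₀ x)) := by
        gcongr
        exact (hC x).trans (by gcongr; exact hX.d_triangle _ _ _)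
    _ ≤ Y.d y₀ y₁ + C * (1 + (X.d x₁ x₀ + X.d x₀ x)) +
          (Y.d y₀ y₁ * X.d x₀ x + C * X.d x₁ x₀ * X.d x₀ x) := le_self_add
    _ = (Y.d y₀ y₁ + C * (1 + X.d x₁ x₀)) * (1 + X.d x₀ x) := by ring

end

variable [hX : IsSuslin X] [hY : IsSuslin Y]

lemma IsMorphism.isP2_map {f : X → Y} (hf : IsMorphism f) {μ : Measure X} (hμ : IsP2 μ) :
    IsP2 (μ.map f) := by
  have := hμ.prob
  obtain ⟨x₀, y₀, C, hC⟩ := hf.linearGrowth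
  refine (isP2_iff y₀).2 ⟨Measure.isProbabilityMeasure_map hf.measurable.aemeasurable, ?_⟩
  rw [l2Norm_map hf.measurable (measurable_d_right y₀)]
  calc l2Norm μ (fun x => Y.d y₀ (f x)) ≤ l2Norm μ fun x => C * (1 + X.d x₀ x) := l2Norm_mono hC
    _ ≤ C * (1 + l2Norm μ (X.d x₀)) := l2Norm_one_add_le (measurable_d_right x₀) C
    _ < ⊤ := by
        have := (l2Norm_d_lt_top hμ x₀).ne
        finiteness

lemma IsMorphism.coe_map {f : X → Y} (hf : IsMorphism f) (μ : P2 X) :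
    (P2.map f μ).1 = μ.1.map f := by
  exact congrArg Subtype.val (dif_pos (hf.isP2_map μ.2))

lemma IsMorphism.linearGrowth_map {f : X → Y} (hf : IsMorphism f) : LinearGrowth (P2.map f) := by
  obtain ⟨x₀, y₀, C, hC⟩ := hf.linearGrowth
  refine ⟨P2.mk _ (isP2_dirac x₀), P2.mk _ (isP2_dirac y₀), C, fun μ => ?_⟩
  have := μ.2.prob
  have : IsProbabilityMeasure (μ.1.map f) :=
    Measure.isProbabilityMeasure_map hf.measurable.aemeasurable
  change W2 (Measure.dirac y₀) (P2.map f μ).1 ≤ C * (1 + W2 (Measure.dirac x₀) μ.1)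
  rw [hf.coe_map, W2_dirac, W2_dirac, l2Norm_map hf.measurable (measurable_d_right y₀)]
  exact (l2Norm_mono hC).trans (l2Norm_one_add_le (measurable_d_right x₀) C)

/-- The modulus of continuity of `f` at `y`, at a scale proportional to `1 + d(x₀, y)`. -/
def scaledModulus (f : X → Y) (x₀ : X) (δ : ℝ≥0∞) (y : X) : ℝ≥0∞ :=
  ⨆ (x : X) (_ : X.d x y < δ * (1 + X.d x₀ y)), Y.d (f x) (f y)

lemma measurable_scaledModulus {f : X → Y} (hf : Continuous f) (x₀ : X) {δ : ℝ≥0∞} (hδ : δ ≠ ⊤) :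
    Measurable (scaledModulus f x₀ δ) := by
  -- The modulus is a lower semicontinuous function of `y`.
  refine measurable_of_Ioi fun a => IsOpen.measurableSet ?_
  have : scaledModulus f x₀ δ ⁻¹' Set.Ioi a =
      ⋃ x : X, {y | X.d x y < δ * (1 + X.d x₀ y)} ∩ {y | a < Y.d (f x) (f y)} := by
    ext y
    simp [scaledModulus, lt_iSup_iff]
  rw [this]
  have hd : ∀ x : X, Continuous fun y : X => X.d x y := fun x =>
    continuous_d.comp (continuous_const.prodMk continuous_id)
  refine isOpen_iUnion fun x => IsOpen.inter ?_ ?_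
  · exact isOpen_lt (hd x) ((ENNReal.continuous_const_mul hδ).comp
      (continuous_const.add (hd x₀)))
  · exact isOpen_lt continuous_const (continuous_d.comp (continuous_const.prodMk hf))

/-- Away from the diagonal, at scale `δ (1 + d(x₀, y))`, the distance of the images is at most a
multiple of the distance of the points; near the diagonal it is at most the modulus of
continuity. -/
lemma d_le_scaledModulus_add {f : X → Y} {x₀ : X} {y₀ : Y} {C : ℝ≥0}
    (hC : ∀ x, Y.d y₀ (f x) ≤ C * (1 + X.d x₀ x)) {δ : ℝ≥0∞} (hδ : δ ≠ 0) (hδ' : δ ≠ ⊤) (x y : X) :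
    Y.d (f x) (f y) ≤ scaledModulus f x₀ δ y + C * (2 * δ⁻¹ + 1) * X.d x y := by
  rcases lt_or_ge (X.d x y) (δ * (1 + X.d x₀ y)) with h | h
  · exact (le_iSup₂ (f := fun (x : X) (_ : X.d x y < δ * (1 + X.d x₀ y)) => Y.d (f x) (f y))
      x h).trans le_self_add
  · refine le_add_left ?_
    have h1 : 1 + X.d x₀ y ≤ δ⁻¹ * X.d x y := by
      calc 1 + X.d x₀ y = δ⁻¹ * (δ * (1 + X.d x₀ y)) := by
            rw [← mul_assoc, ENNReal.inv_mul_cancel hδ hδ', one_mul]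
        _ ≤ _ := by gcongr
    calc Y.d (f x) (f y) ≤ Y.d y₀ (f x) + Y.d y₀ (f y) := by
          rw [hY.d_comm y₀ (f x)]; exact hY.d_triangle _ _ _
      _ ≤ C * (1 + (X.d x₀ y + X.d x y)) + C * (1 + X.d x₀ y) := by
          refine add_le_add ((hC x).trans ?_) (hC y)
          gcongr
          rw [hX.d_comm x y]
          exact hX.d_triangle _ _ _
      _ = C * (2 * (1 + X.d x₀ y) + X.d x y) := by ring
      _ ≤ C * (2 * (δ⁻¹ * X.d x y) + X.d x y) := by gcongr
      _ = _ := by ring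

lemma tendsto_l2Norm_scaledModulus {f : X → Y} (hf : IsMorphism f) (x₀ : X) {μ : Measure X}
    (hμ : IsP2 μ) :
    Filter.Tendsto (fun n : ℕ => l2Norm μ (scaledModulus f x₀ (n + 1 : ℝ≥0∞)⁻¹)) Filter.atTop
      (𝓝 0) := by
  have := hμ.prob
  obtain ⟨C, hC⟩ := hf.linearGrowth.exists_forall_le x₀ (f x₀)
  have hδ1 : ∀ n : ℕ, (n + 1 : ℝ≥0∞)⁻¹ ≤ 1 := fun n => by simp
  have hδtop : ∀ n : ℕ, (n + 1 : ℝ≥0∞)⁻¹ ≠ ⊤ := fun n => ne_top_of_le_ne_top (by simp) (hδ1 n)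
  have hbound : ∀ (n : ℕ) (y : X),
      scaledModulus f x₀ (n + 1 : ℝ≥0∞)⁻¹ y ≤ 3 * C * (1 + X.d x₀ y) := by
    intro n y
    refine iSup₂_le fun x hx => ?_
    have hx' : X.d x y ≤ 1 + X.d x₀ y := hx.le.trans (by
      calc _ ≤ 1 * (1 + X.d x₀ y) := by gcongr; exact hδ1 n
        _ = _ := one_mul _)
    calc Y.d (f x) (f y) ≤ Y.d (f x₀) (f x) + Y.d (f x₀) (f y) := by
          rw [hY.d_comm (f x₀) (f x)]; exact hY.d_triangle _ _ _
      _ ≤ C * (1 + (X.d x₀ y + X.d x y)) + C * (1 + X.d x₀ y) := by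
          refine add_le_add ((hC x).trans ?_) (hC y)
          gcongr
          rw [hX.d_comm x y]
          exact hX.d_triangle _ _ _
      _ ≤ C * (1 + (X.d x₀ y + (1 + X.d x₀ y))) + C * (1 + X.d x₀ y) := by gcongr
      _ = 3 * C * (1 + X.d x₀ y) := by ring
  have hlim : ∀ y : X, Filter.Tendsto (fun n : ℕ => scaledModulus f x₀ (n + 1 : ℝ≥0∞)⁻¹ y)
      Filter.atTop (𝓝 0) := by
    intro y
    refine ENNReal.tendsto_nhds_zero.2 fun ε hε => ?_
    obtain ⟨η, hη, hfη⟩ := EMetric.tendsto_nhds_nhds.1 (hf.continuous.tendsto y) ε hε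
    have h1 : Filter.Tendsto (fun n : ℕ => (n + 1 : ℝ≥0∞)⁻¹ * (1 + X.d x₀ y)) Filter.atTop
        (𝓝 0) := by
      have h2 : Filter.Tendsto (fun n : ℕ => (n + 1 : ℝ≥0∞)⁻¹) Filter.atTop (𝓝 0) := by
        have := (Filter.tendsto_add_atTop_iff_nat 1).2 ENNReal.tendsto_inv_nat_nhds_zero
        simpa using this
      have h3 := ENNReal.Tendsto.mul_const (b := 1 + X.d x₀ y) h2
        (Or.inr (by have := hX.d_ne_top x₀ y; finiteness))
      simpa using h3
    filter_upwards [h1.eventually_lt_const hη] with n hn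
    exact iSup₂_le fun x hx => (hfη (hx.trans hn)).le
  have h := tendsto_lintegral_of_dominated_convergence (μ := μ)
    (F := fun (n : ℕ) y => scaledModulus f x₀ (n + 1 : ℝ≥0∞)⁻¹ y ^ 2) (f := fun _ => 0)
    (fun y => (3 * C * (1 + X.d x₀ y)) ^ 2)
    (fun n => (measurable_scaledModulus hf.continuous x₀ (hδtop n)).pow_const 2)
    (fun n => .of_forall fun y => pow_le_pow_left' (hbound n y) 2)
    (l2Norm_lt_top.1 ((l2Norm_one_add_le (measurable_d_right x₀) _).trans_lt (by
      have := (l2Norm_d_lt_top hμ x₀).ne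
      finiteness))).ne
    (.of_forall fun y => by
      have h4 := ((ENNReal.continuous_pow 2).tendsto 0).comp (hlim y)
      rw [zero_pow two_ne_zero] at h4
      exact h4)
  have h5 := h.ennrpow_const (1 / 2)
  rw [lintegral_zero, ENNReal.zero_rpow_of_pos (by norm_num)] at h5
  exact h5

lemma IsMorphism.W2_map_le {f : X → Y} (hf : IsMorphism f) {x₀ : X} {y₀ : Y} {C : ℝ≥0}
    (hC : ∀ x, Y.d y₀ (f x) ≤ C * (1 + X.d x₀ x)) {δ : ℝ≥0∞} (hδ : δ ≠ 0) (hδ' : δ ≠ ⊤)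
    {ν μ : Measure X} {c : ℝ≥0∞} (hc : W2 ν μ < c) :
    W2 (ν.map f) (μ.map f) ≤ l2Norm μ (scaledModulus f x₀ δ) + C * (2 * δ⁻¹ + 1) * c := by
  obtain ⟨γ, rfl, rfl, hγ⟩ := exists_plan_lt hc
  have hm := measurable_scaledModulus hf.continuous x₀ hδ'
  have hff : Measurable (Prod.map f f) := hf.measurable.prodMap hf.measurable
  calc W2 ((γ.map Prod.fst).map f) ((γ.map Prod.snd).map f)
      ≤ l2Norm (γ.map (Prod.map f f)) fun p => Y.d p.1 p.2 := by
        refine W2_le _ ?_ ?_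
        · rw [Measure.map_map measurable_fst hff, Measure.map_map hf.measurable measurable_fst]; rfl
        · rw [Measure.map_map measurable_snd hff, Measure.map_map hf.measurable measurable_snd]; rfl
    _ = l2Norm γ fun p => Y.d (f p.1) (f p.2) := l2Norm_map hff measurable_d
    _ ≤ l2Norm γ fun p => scaledModulus f x₀ δ p.2 + C * (2 * δ⁻¹ + 1) * X.d p.1 p.2 :=
        l2Norm_mono fun p => d_le_scaledModulus_add hC hδ hδ' p.1 p.2
    _ ≤ l2Norm γ (fun p => scaledModulus f x₀ δ p.2) +
          l2Norm γ fun p => C * (2 * δ⁻¹ + 1) * X.d p.1 p.2 :=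
        l2Norm_add_le (hm.comp measurable_snd) (measurable_d.const_mul _)
    _ ≤ _ := by
        rw [l2Norm_map measurable_snd hm, l2Norm_const_mul _ measurable_d]
        gcongr

lemma IsMorphism.continuous_map {f : X → Y} (hf : IsMorphism f) : Continuous (P2.map f) := by
  rw [continuous_iff_continuousAt]
  intro μ
  have := μ.2.prob
  obtain ⟨x₀⟩ := nonempty_of_isProbabilityMeasure μ.1
  obtain ⟨C, hC⟩ := hf.linearGrowth.exists_forall_le x₀ (f x₀)
  refine tendsto_iff_edist_tendsto_0.2 (ENNReal.tendsto_nhds_zero.2 fun ε hε => ?_)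
  have hε2 : 0 < ε / 2 := ENNReal.half_pos hε.ne'
  obtain ⟨n, hn⟩ := ((tendsto_l2Norm_scaledModulus hf x₀ μ.2).eventually_le_const hε2).exists
  set δ : ℝ≥0∞ := (n + 1 : ℝ≥0∞)⁻¹
  have hδ : δ ≠ 0 := by simp [δ]
  have hδ' : δ ≠ ⊤ := by simp [δ]
  set K : ℝ≥0∞ := C * (2 * δ⁻¹ + 1)
  have hK : K ≠ ⊤ := by
    have := ENNReal.inv_ne_top.2 hδ
    finiteness
  have hc : 0 < ε / 2 / (K + 1) := ENNReal.div_pos hε2.ne' (by finiteness)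
  have hev := (tendsto_iff_edist_tendsto_0.1 (Filter.tendsto_id (x := 𝓝 μ))).eventually_lt_const hc
  filter_upwards [hev] with ν hν
  change W2 (P2.map f ν).1 (P2.map f μ).1 ≤ ε
  rw [hf.coe_map, hf.coe_map]
  calc W2 (ν.1.map f) (μ.1.map f) ≤ l2Norm μ.1 (scaledModulus f x₀ δ) + K * (ε / 2 / (K + 1)) :=
        hf.W2_map_le hC hδ hδ' hν
    _ ≤ ε / 2 + (K + 1) * (ε / 2 / (K + 1)) := by
        gcongr
        exact le_self_add
    _ ≤ ε / 2 + ε / 2 := by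
        gcongr
        exact ENNReal.mul_div_le
    _ = ε := ENNReal.add_halves ε

lemma IsMorphism.map {f : X → Y} (hf : IsMorphism f) : IsMorphism (P2.map f) :=
  ⟨hf.continuous_map, hf.linearGrowth_map⟩

end DistSpace

/-! ### Gluing in the hierarchy of Wasserstein spaces -/

namespace DistSpace

instance isSuslin_iter (X : DistSpace.{u}) [IsSuslin X] : ∀ n, IsSuslin (iter X n)
  | 0 => inferInstanceAs (IsSuslin X)
  | n + 1 => have := isSuslin_iter X n; inferInstanceAs (IsSuslin (P2 (iter X n)))

lemma IsMorphism.iterMap {X : DistSpace.{u}} {Y : DistSpace.{v}} [IsSuslin X] [IsSuslin Y]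
    {f : X → Y} (hf : IsMorphism f) : ∀ n, IsMorphism (iterMap f n)
  | 0 => hf
  | n + 1 => (hf.iterMap n).map

variable {W : DistSpace.{u}} {X : DistSpace.{v}} {Y : DistSpace.{w}} {Z : DistSpace.{z}}
  [hW : IsSuslin W] [hX : IsSuslin X] [hY : IsSuslin Y] [hZ : IsSuslin Z]
  {f₁ : X → Z} {f₂ : Y → Z} {g₁ : W → X} {g₂ : W → Y}

lemma P2.map_map_eq (hf₁ : IsMorphism f₁) (hf₂ : IsMorphism f₂) (hg₁ : IsMorphism g₁)
    (hg₂ : IsMorphism g₂) (h : ∀ w, f₁ (g₁ w) = f₂ (g₂ w)) (α : P2 W) :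
    P2.map f₁ (P2.map g₁ α) = P2.map f₂ (P2.map g₂ α) := by
  refine Subtype.ext ?_
  rw [hf₁.coe_map, hg₁.coe_map, hf₂.coe_map, hg₂.coe_map,
    Measure.map_map hf₁.measurable hg₁.measurable, Measure.map_map hf₂.measurable hg₂.measurable]
  exact congrArg (fun k => Measure.map k α.1) (funext h)

lemma l2Norm_hypot {α : Type*} [MeasurableSpace α] {μ : Measure α} {a b : α → ℝ≥0∞}
    (ha : Measurable a) : l2Norm μ (fun x => hypot (a x) (b x)) =
      hypot (l2Norm μ a) (l2Norm μ b) := by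
  have h1 : ∀ x, hypot (a x) (b x) ^ 2 = a x ^ 2 + b x ^ 2 := fun x => ENNReal.sq_rpow_half _
  have h2 : l2Norm μ (fun x => hypot (a x) (b x)) ^ 2 = hypot (l2Norm μ a) (l2Norm μ b) ^ 2 := by
    rw [l2Norm_sq]
    simp only [h1]
    rw [lintegral_add_left (ha.pow_const 2), ← l2Norm_sq, ← l2Norm_sq]
    exact (ENNReal.sq_rpow_half _).symm
  rw [← ENNReal.rpow_half_sq (l2Norm μ _), h2, ENNReal.rpow_half_sq]

/-- Surjectivity with linearly growing antecedents passes from `(g₁, g₂)` to `([g₁], [g₂])`: the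
linear growth is preserved by gluing measures along antecedents of linear growth only. -/
lemma LinearlyGrowingAntecedents.map (hf₁ : IsMorphism f₁) (hf₂ : IsMorphism f₂)
    (hg₁ : IsMorphism g₁) (hg₂ : IsMorphism g₂) {h : ∀ w, f₁ (g₁ w) = f₂ (g₂ w)}
    (hL : LinearlyGrowingAntecedents (Y := fiberProd f₁ f₂) (fiberLift h))
    (h' : ∀ α, P2.map f₁ (P2.map g₁ α) = P2.map f₂ (P2.map g₂ α)) :
    LinearlyGrowingAntecedents (Y := fiberProd (P2.map f₁) (P2.map f₂)) (fiberLift h') := by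
  obtain ⟨w₀, C, hC⟩ := hL.2
  let a : W → ℝ≥0∞ := fun w => X.d (g₁ w₀) (g₁ w)
  let b : W → ℝ≥0∞ := fun w => Y.d (g₂ w₀) (g₂ w)
  have ha : Measurable a := (measurable_d_right _).comp hg₁.measurable
  have hb : Measurable b := (measurable_d_right _).comp hg₂.measurable
  have hab : Measurable fun w => hypot (a w) (b w) :=
    ((ha.pow_const 2).add (hb.pow_const 2)).pow_const _
  let Q : Set W := {w | W.d w₀ w ≤ C * (1 + hypot (a w) (b w))}
  have hQ : MeasurableSet Q := measurableSet_le (measurable_d_right w₀)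
    ((measurable_const.add hab).const_mul _)
  have hlift : ∀ x y, f₁ x = f₂ y → ∃ w ∈ Q, g₁ w = x ∧ g₂ w = y := by
    intro x y hxy
    obtain ⟨w, hw, hwd⟩ := hC ⟨(x, y), hxy⟩
    have h1 : (g₁ w, g₂ w) = (x, y) := congrArg Subtype.val hw
    obtain ⟨rfl, rfl⟩ := Prod.ext_iff.1 h1
    exact ⟨w, hwd, rfl, rfl⟩
  have key : ∀ p : fiberProd (P2.map f₁) (P2.map f₂), ∃ α : P2 W, fiberLift h' α = p ∧
      (P2 W).d (P2.mk _ (isP2_dirac w₀)) α ≤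
        C * (1 + (fiberProd (P2.map f₁) (P2.map f₂)).d
          (fiberLift h' (P2.mk _ (isP2_dirac w₀))) p) := by
    rintro ⟨⟨μ, ν⟩, hμν⟩
    have := μ.2.prob
    have := ν.2.prob
    have hmap : μ.1.map f₁ = ν.1.map f₂ := by
      have := congrArg Subtype.val hμν
      rwa [hf₁.coe_map, hf₂.coe_map] at this
    obtain ⟨α, hα, hα₁, hα₂, hαQ⟩ := exists_lift hW.analytic hX.analytic hY.analytic
      hf₁.measurable hf₂.measurable hg₁.measurable hg₂.measurable hQ hlift μ.1 ν.1 hmap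
    have hna : l2Norm α a = W2 (Measure.dirac (g₁ w₀)) μ.1 := by
      rw [W2_dirac, ← hα₁, l2Norm_map hg₁.measurable (measurable_d_right _)]
    have hnb : l2Norm α b = W2 (Measure.dirac (g₂ w₀)) ν.1 := by
      rw [W2_dirac, ← hα₂, l2Norm_map hg₂.measurable (measurable_d_right _)]
    have hle : l2Norm α (W.d w₀) ≤ C * (1 + hypot (W2 (Measure.dirac (g₁ w₀)) μ.1)
        (W2 (Measure.dirac (g₂ w₀)) ν.1)) := by
      rw [← hna, ← hnb, ← l2Norm_hypot ha]
      exact (l2Norm_mono_ae hαQ).trans (l2Norm_one_add_le hab C)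
    have hα2 : IsP2 α := by
      refine (isP2_iff w₀).2 ⟨hα, hle.trans_lt (ENNReal.mul_lt_top ENNReal.coe_lt_top
        (ENNReal.add_lt_top.2 ⟨ENNReal.one_lt_top, (hypot_le_add _ _).trans_lt
          (ENNReal.add_lt_top.2 ⟨?_, ?_⟩)⟩))⟩
      · exact W2_lt_top (isP2_dirac _) μ.2
      · exact W2_lt_top (isP2_dirac _) ν.2
    refine ⟨P2.mk α hα2, Subtype.ext (Prod.ext (Subtype.ext ?_) (Subtype.ext ?_)), ?_⟩
    · exact (hg₁.coe_map _).trans hα₁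
    · exact (hg₂.coe_map _).trans hα₂
    · have h₁ : (P2.map g₁ (P2.mk _ (isP2_dirac w₀))).1 = Measure.dirac (g₁ w₀) :=
        (hg₁.coe_map _).trans (Measure.map_dirac' hg₁.measurable _)
      have h₂ : (P2.map g₂ (P2.mk _ (isP2_dirac w₀))).1 = Measure.dirac (g₂ w₀) :=
        (hg₂.coe_map _).trans (Measure.map_dirac' hg₂.measurable _)
      change W2 (Measure.dirac w₀) α ≤ C * (1 + hypot
        (W2 (P2.map g₁ (P2.mk _ (isP2_dirac w₀))).1 μ.1)
        (W2 (P2.map g₂ (P2.mk _ (isP2_dirac w₀))).1 ν.1))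
      rw [h₁, h₂, W2_dirac]
      exact hle
  exact ⟨fun p => (key p).imp fun α h => h.1, P2.mk _ (isP2_dirac w₀), C, key⟩

theorem exists_linearlyGrowingAntecedents_iterMap (hf₁ : IsMorphism f₁) (hf₂ : IsMorphism f₂)
    (hg₁ : IsMorphism g₁) (hg₂ : IsMorphism g₂) (h : ∀ w, f₁ (g₁ w) = f₂ (g₂ w))
    (hL : LinearlyGrowingAntecedents (Y := fiberProd f₁ f₂) (fiberLift h)) (n : ℕ) :
    ∃ comm : ∀ α, iterMap f₁ n (iterMap g₁ n α) = iterMap f₂ n (iterMap g₂ n α),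
      LinearlyGrowingAntecedents (Y := fiberProd (iterMap f₁ n) (iterMap f₂ n))
        (fiberLift comm) := by
  induction n with
  | zero => exact ⟨h, hL⟩
  | succ n ih =>
    obtain ⟨comm, hn⟩ := ih
    exact ⟨P2.map_map_eq (hf₁.iterMap n) (hf₂.iterMap n) (hg₁.iterMap n) (hg₂.iterMap n) comm,
      hn.map (hf₁.iterMap n) (hf₂.iterMap n) (hg₁.iterMap n) (hg₂.iterMap n) _⟩

/-- The topology of the distance of a metric space is its own topology. -/
lemma topology_of (X : Type u) [t : MetricSpace X] :
    instTopologicalSpaceCarrier (of X) = t.toUniformSpace.toTopologicalSpace := by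
  have h : ∀ x : X, (𝓝 x).HasBasis (fun c : ℝ≥0∞ => 0 < c) fun c => {y : X | edist x y < c} := by
    intro x
    have h2 : ∀ c, Metric.eball x c = {y : X | edist x y < c} := fun c => by
      ext y; rw [Metric.mem_eball']; rfl
    exact Metric.nhds_basis_eball.congr (fun _ => Iff.rfl) fun c _ => h2 c
  exact (topology_eq (X := of X) (fun x y => edist_comm (α := X) x y)
    (fun x y z => edist_triangle (α := X) x y z) t.toUniformSpace.toTopologicalSpace h).symm

instance (X : Type u) [MetricSpace X] : IsMetric (of X) where
  d_comm x y := edist_comm (α := X) x y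
  d_triangle x y z := edist_triangle (α := X) x y z
  eq_of_d_eq_zero _ _ h := eq_of_edist_eq_zero (α := X) h
  d_ne_top x y := edist_ne_top (α := X) x y

instance (X : Type u) [MetricSpace X] [PolishSpace X] : IsSuslin (of X) where
  separable := by
    rw [topology_of]
    exact inferInstanceAs (TopologicalSpace.SeparableSpace X)
  analytic := by
    have : PolishSpace (of X) := by
      rw [topology_of]
      exact inferInstanceAs (PolishSpace X)
    exact isAnalyticSpace_of_standardBorel _

end DistSpace

/-! ### Christoffel symbols of a metric in coordinates -/

section MetricCoordinates

variable {E : Type u} [NormedAddCommGroup E] [NormedSpace ℝ E]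

-- Shortcut instances: the search for them is slow when the Riemannian bundle instances are open.
local instance : NormedAddCommGroup (E →L[ℝ] E →L[ℝ] ℝ) :=
  ContinuousLinearMap.toNormedAddCommGroup

local instance : NormedSpace ℝ (E →L[ℝ] E →L[ℝ] ℝ) :=
  ContinuousLinearMap.toNormedSpace

/-- The Koszul form `w ↦ ½ (∂_v G(u, w) + ∂_u G(v, w) - ∂_w G(v, u))` at the point `y`, for a field
of bilinear forms `G` on a vector space. -/
def koszul (G : E → E →L[ℝ] E →L[ℝ] ℝ) (y v u : E) : E →L[ℝ] ℝ :=
  (1 / 2 : ℝ) • (fderiv ℝ G y v u + fderiv ℝ G y u v - ((fderiv ℝ G y).flip v).flip u)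

lemma koszul_apply (G : E → E →L[ℝ] E →L[ℝ] ℝ) (y v u w : E) :
    koszul G y v u w =
      1 / 2 * (fderiv ℝ G y v u w + fderiv ℝ G y u v w - fderiv ℝ G y w v u) := by
  simp [koszul]

/-- The vector given by the Christoffel symbols at `y` of the field of bilinear forms `G`. -/
def christoffelVec (G : E → E →L[ℝ] E →L[ℝ] ℝ) (y v u : E) : E :=
  (G y).inverse (koszul G y v u)

/-- The Sasaki form in the coordinates `(y, w)` of the tangent bundle: the pairing of the horizontal
parts `ξ.1` plus the pairing of the vertical parts `ξ.2 + Γ(ξ.1, w)`. -/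
def sasakiCoord (G : E → E →L[ℝ] E →L[ℝ] ℝ) (y w : E) (ξ η : E × E) : ℝ :=
  G y ξ.1 η.1 + G y (ξ.2 + christoffelVec G y ξ.1 w) (η.2 + christoffelVec G y η.1 w)

lemma koszul_add (G : E → E →L[ℝ] E →L[ℝ] ℝ) (y v v' u : E) :
    koszul G y (v + v') u = koszul G y v u + koszul G y v' u := by
  ext w; simp only [koszul_apply, map_add, add_apply]; ring

lemma koszul_smul (G : E → E →L[ℝ] E →L[ℝ] ℝ) (y : E) (c : ℝ) (v u : E) :
    koszul G y (c • v) u = c • koszul G y v u := by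
  ext w
  simp only [koszul_apply, map_smul, smul_apply, smul_eq_mul]; ring

lemma christoffelVec_add (G : E → E →L[ℝ] E →L[ℝ] ℝ) (y v v' u : E) :
    christoffelVec G y (v + v') u = christoffelVec G y v u + christoffelVec G y v' u := by
  simp [christoffelVec, koszul_add]

lemma christoffelVec_smul (G : E → E →L[ℝ] E →L[ℝ] ℝ) (y : E) (c : ℝ) (v u : E) :
    christoffelVec G y (c • v) u = c • christoffelVec G y v u := by
  simp [christoffelVec, koszul_smul]

/-- The tensoriality defect of the Koszul form: pulling back a metric by `τ` changes it by the
second derivative of `τ`. -/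
lemma koszul_pullback {G G' : E → E →L[ℝ] E →L[ℝ] ℝ} {τ : E → E} {y : E}
    (hτ : ContDiffAt ℝ 2 τ y)
    (hG' : DifferentiableAt ℝ G' (τ y))
    (hsymm : ∀ a b, G' (τ y) a b = G' (τ y) b a)
    (hpull : ∀ᶠ y' in 𝓝 y, G y' = (G' (τ y')).bilinearComp (fderiv ℝ τ y') (fderiv ℝ τ y'))
    (v u w : E) :
    koszul G y v u w = koszul G' (τ y) (fderiv ℝ τ y v) (fderiv ℝ τ y u) (fderiv ℝ τ y w) +
      G' (τ y) (fderiv ℝ (fderiv ℝ τ) y v u) (fderiv ℝ τ y w) := by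
  have hT : DifferentiableAt ℝ (fderiv ℝ τ) y :=
    (hτ.fderiv_right (m := 1) (by norm_num)).differentiableAt one_ne_zero
  have hτd : DifferentiableAt ℝ τ y := hτ.differentiableAt two_ne_zero
  have hcomp : DifferentiableAt ℝ (fun y' => G' (τ y')) y := hG'.comp y hτd
  have hDG : HasFDerivAt G (fderiv ℝ G y) y := by
    refine DifferentiableAt.hasFDerivAt ?_
    refine DifferentiableAt.congr_of_eventuallyEq ?_ hpull
    have h1 : (fun y' => (G' (τ y')).bilinearComp (fderiv ℝ τ y') (fderiv ℝ τ y')) =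
        fun y' => ((G' (τ y')).comp (fderiv ℝ τ y')).flip.comp (fderiv ℝ τ y') |>.flip := by
      ext y' a b
      simp
    rw [h1]
    have h2 : DifferentiableAt ℝ (fun y' => (G' (τ y')).comp (fderiv ℝ τ y')) y :=
      hcomp.clm_comp hT
    have h3 : DifferentiableAt ℝ (fun y' => ((G' (τ y')).comp (fderiv ℝ τ y')).flip) y :=
      (ContinuousLinearMap.flipₗᵢ ℝ E E ℝ).differentiable.differentiableAt.comp y h2
    exact (ContinuousLinearMap.flipₗᵢ ℝ E E ℝ).differentiable.differentiableAt.comp y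
      (h3.clm_comp hT)
  have key : ∀ a b c, fderiv ℝ G y c a b =
      fderiv ℝ G' (τ y) (fderiv ℝ τ y c) (fderiv ℝ τ y a) (fderiv ℝ τ y b) +
      G' (τ y) (fderiv ℝ (fderiv ℝ τ) y c a) (fderiv ℝ τ y b) +
      G' (τ y) (fderiv ℝ τ y a) (fderiv ℝ (fderiv ℝ τ) y c b) := by
    intro a b c
    have hL : HasFDerivAt (fun y' => G y' a b)
        (((ContinuousLinearMap.apply ℝ ℝ b).comp
          (ContinuousLinearMap.apply ℝ (E →L[ℝ] ℝ) a)).comp (fderiv ℝ G y)) y :=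
      ((ContinuousLinearMap.apply ℝ ℝ b).comp
        (ContinuousLinearMap.apply ℝ (E →L[ℝ] ℝ) a)).hasFDerivAt.comp y hDG
    have hGτ : HasFDerivAt (fun y' => G' (τ y')) ((fderiv ℝ G' (τ y)).comp (fderiv ℝ τ y)) y :=
      hG'.hasFDerivAt.comp y hτd.hasFDerivAt
    have hTa : ∀ e, HasFDerivAt (fun y' => fderiv ℝ τ y' e)
        ((ContinuousLinearMap.apply ℝ E e).comp (fderiv ℝ (fderiv ℝ τ) y)) y := fun e =>
      (ContinuousLinearMap.apply ℝ E e).hasFDerivAt.comp y hT.hasFDerivAt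
    have hR := (hGτ.clm_apply (hTa a)).clm_apply (hTa b)
    have heq : (fun y' => G y' a b) =ᶠ[𝓝 y]
        fun y' => G' (τ y') (fderiv ℝ τ y' a) (fderiv ℝ τ y' b) := by
      filter_upwards [hpull] with y' hy'
      rw [hy']; rfl
    have hu := (hR.congr_of_eventuallyEq heq).unique hL
    have := congrArg (fun L : E →L[ℝ] ℝ => L c) hu
    simp at this
    linarith
  have hs : ∀ a b, fderiv ℝ (fderiv ℝ τ) y a b = fderiv ℝ (fderiv ℝ τ) y b a := fun a b =>
    (hτ.isSymmSndFDerivAt (by simp)) a b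
  -- The second derivatives of `τ` in directions other than `(v, u)` cancel, by symmetry.
  rw [koszul_apply, koszul_apply, key, key, key, hs u v, hs w v, hs w u,
    hsymm (fderiv ℝ (fderiv ℝ τ) y v w)]
  ring

variable [FiniteDimensional ℝ E]

/-- A definite bilinear form on a finite dimensional space is invertible as a map to the dual. -/
lemma isInvertible_of_definite {A : E →L[ℝ] E →L[ℝ] ℝ} (hA : ∀ v ≠ 0, 0 < A v v) :
    A.IsInvertible := by
  have hinj : Function.Injective A := by
    rw [injective_iff_map_eq_zero]
    intro v hv
    by_contra h
    have := hA v h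
    simp [hv] at this
  have hfr : Module.finrank ℝ E = Module.finrank ℝ (E →L[ℝ] ℝ) := by
    rw [← LinearEquiv.finrank_eq (LinearMap.toContinuousLinearMap (𝕜 := ℝ) (E := E) (F' := ℝ))]
    exact (Subspace.dual_finrank_eq).symm
  let e := (LinearEquiv.ofInjectiveOfFinrankEq (A : E →ₗ[ℝ] E →L[ℝ] ℝ) hinj hfr)
  exact ⟨e.toContinuousLinearEquiv, by ext; rfl⟩

lemma apply_christoffelVec {G : E → E →L[ℝ] E →L[ℝ] ℝ} {y : E} (hpos : ∀ v ≠ 0, 0 < G y v v)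
    (v u : E) : G y (christoffelVec G y v u) = koszul G y v u :=
  (isInvertible_of_definite hpos).self_apply_inverse _

omit [FiniteDimensional ℝ E] in
lemma ext_of_definite {A : E →L[ℝ] E →L[ℝ] ℝ} (hA : ∀ v ≠ 0, 0 < A v v) {a b : E}
    (h : ∀ w, A a w = A b w) : a = b := by
  by_contra hne
  have := hA (a - b) (sub_ne_zero.2 hne)
  simp [h] at this

/-- The transformation law of the Christoffel symbols under a change of coordinates `τ`. -/
lemma christoffelVec_pullback {G G' : E → E →L[ℝ] E →L[ℝ] ℝ} {τ : E → E} {y : E}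
    (hτ : ContDiffAt ℝ 2 τ y) (hsurj : Function.Bijective (fderiv ℝ τ y))
    (hG' : DifferentiableAt ℝ G' (τ y))
    (hsymm : ∀ a b, G' (τ y) a b = G' (τ y) b a)
    (hpos : ∀ v ≠ 0, 0 < G' (τ y) v v)
    (hpull : ∀ᶠ y' in 𝓝 y, G y' = (G' (τ y')).bilinearComp (fderiv ℝ τ y') (fderiv ℝ τ y'))
    (v u : E) :
    fderiv ℝ τ y (christoffelVec G y v u) =
      fderiv ℝ (fderiv ℝ τ) y v u + christoffelVec G' (τ y) (fderiv ℝ τ y v) (fderiv ℝ τ y u) := by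
  have hGy := hpull.self_of_nhds
  have hposG : ∀ v ≠ 0, 0 < G y v v := by
    intro v hv
    rw [hGy]
    exact hpos _ (fun h => hv (hsurj.1 (by simpa using h)))
  refine ext_of_definite hpos fun w' => ?_
  obtain ⟨w, rfl⟩ := hsurj.2 w'
  have h1 : G' (τ y) (fderiv ℝ τ y (christoffelVec G y v u)) (fderiv ℝ τ y w) =
      G y (christoffelVec G y v u) w := by rw [hGy]; rfl
  rw [h1, apply_christoffelVec hposG, koszul_pullback hτ hG' hsymm hpull, map_add,
    add_apply, apply_christoffelVec hpos]
  ring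

/-- The Sasaki form does not depend on the coordinates: the derivative of the change of coordinates
`(y, w) ↦ (τ y, Dτ(y) w)` is an isometry. -/
lemma sasakiCoord_pullback {G G' : E → E →L[ℝ] E →L[ℝ] ℝ} {τ : E → E} {y : E}
    (hτ : ContDiffAt ℝ 2 τ y) (hsurj : Function.Bijective (fderiv ℝ τ y))
    (hG' : DifferentiableAt ℝ G' (τ y))
    (hsymm : ∀ a b, G' (τ y) a b = G' (τ y) b a)
    (hpos : ∀ v ≠ 0, 0 < G' (τ y) v v)
    (hpull : ∀ᶠ y' in 𝓝 y, G y' = (G' (τ y')).bilinearComp (fderiv ℝ τ y') (fderiv ℝ τ y'))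
    (w : E) (ξ η : E × E) :
    sasakiCoord G' (τ y) (fderiv ℝ τ y w)
      (fderiv ℝ τ y ξ.1, fderiv ℝ (fderiv ℝ τ) y ξ.1 w + fderiv ℝ τ y ξ.2)
      (fderiv ℝ τ y η.1, fderiv ℝ (fderiv ℝ τ) y η.1 w + fderiv ℝ τ y η.2) =
    sasakiCoord G y w ξ η := by
  have hv : ∀ ζ : E × E, fderiv ℝ (fderiv ℝ τ) y ζ.1 w + fderiv ℝ τ y ζ.2 +
      christoffelVec G' (τ y) (fderiv ℝ τ y ζ.1) (fderiv ℝ τ y w) =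
      fderiv ℝ τ y (ζ.2 + christoffelVec G y ζ.1 w) := by
    intro ζ
    rw [map_add, christoffelVec_pullback hτ hsurj hG' hsymm hpos hpull]
    abel
  simp only [sasakiCoord, hv]
  rw [hpull.self_of_nhds]
  rfl

/-- The Sasaki form in coordinates is continuous in the base point. -/
lemma continuousAt_sasakiCoord {G : E → E →L[ℝ] E →L[ℝ] ℝ} {y w : E} (hG : ContDiffAt ℝ 1 G y)
    (hpos : ∀ v ≠ 0, 0 < G y v v) (ξ η : E × E) :
    ContinuousAt (fun q : E × E => sasakiCoord G q.1 q.2 ξ η) (y, w) := by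
  have hG1 : ContinuousAt (fun q : E × E => G q.1) (y, w) :=
    hG.continuousAt.comp_of_eq continuousAt_fst rfl
  have hD : ContinuousAt (fun q : E × E => fderiv ℝ G q.1) (y, w) :=
    ContinuousAt.comp_of_eq (f := Prod.fst) (g := fderiv ℝ G) (y := y)
      (hG.fderiv_right (m := 0) (by norm_num)).continuousAt continuousAt_fst rfl
  have hflip : ∀ {f : E × E → E →L[ℝ] E →L[ℝ] E →L[ℝ] ℝ}, ContinuousAt f (y, w) →
      ContinuousAt (fun q => (f q).flip) (y, w) := fun hf =>
    (ContinuousLinearMap.flipₗᵢ ℝ E E (E →L[ℝ] ℝ)).continuous.continuousAt.comp hf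
  have hflip' : ∀ {f : E × E → E →L[ℝ] E →L[ℝ] ℝ}, ContinuousAt f (y, w) →
      ContinuousAt (fun q => (f q).flip) (y, w) := fun hf =>
    (ContinuousLinearMap.flipₗᵢ ℝ E E ℝ).continuous.continuousAt.comp hf
  have hsnd : ContinuousAt (fun q : E × E => q.2) (y, w) := continuousAt_snd
  have hcst : ∀ v : E, ContinuousAt (fun _ : E × E => v) (y, w) := fun v => continuousAt_const
  have hK : ∀ v : E, ContinuousAt (fun q : E × E => koszul G q.1 v q.2) (y, w) := by
    intro v
    unfold koszul
    have h1 := (hD.clm_apply (hcst v)).clm_apply hsnd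
    have h2 := (hD.clm_apply hsnd).clm_apply (hcst v)
    have h3 := (hflip' ((hflip hD).clm_apply (hcst v))).clm_apply hsnd
    exact ((h1.add h2).sub h3).const_smul (1 / 2 : ℝ)
  have hinv : ContinuousAt (fun q : E × E => (G q.1).inverse) (y, w) := by
    have hI := isInvertible_of_definite hpos
    have : CompleteSpace E := FiniteDimensional.complete ℝ E
    refine ContinuousAt.comp_of_eq (f := fun q : E × E => G q.1)
      (g := ContinuousLinearMap.inverse) (y := G y) ?_ hG1 rfl
    exact (hI.contDiffAt_map_inverse (n := 0)).continuousAt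
  have hΓ : ∀ v : E, ContinuousAt (fun q : E × E => christoffelVec G q.1 v q.2) (y, w) :=
    fun v => hinv.clm_apply (hK v)
  unfold sasakiCoord
  refine ContinuousAt.add ?_ ?_
  · exact (hG1.clm_apply continuousAt_const).clm_apply continuousAt_const
  · exact (hG1.clm_apply (continuousAt_const.add (hΓ _))).clm_apply (continuousAt_const.add (hΓ _))

end MetricCoordinates

/-! ### Changes of coordinates of the tangent bundle -/

namespace Sasaki

variable {E : Type u} [NormedAddCommGroup E] [NormedSpace ℝ E]
  {M : Type v} [TopologicalSpace M] [ChartedSpace E M]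

/-- The change of coordinates between the preferred charts at `x₀` and `x`. -/
def coordTrans (E : Type u) [NormedAddCommGroup E] [NormedSpace ℝ E]
    {M : Type v} [TopologicalSpace M] [ChartedSpace E M] (x₀ x : M) : E → E :=
  extChartAt 𝓘(ℝ, E) x ∘ (extChartAt 𝓘(ℝ, E) x₀).symm

lemma coordTrans_apply {x₀ x z : M} (hz : z ∈ (chartAt E x₀).source) :
    coordTrans E x₀ x (extChartAt 𝓘(ℝ, E) x₀ z) = extChartAt 𝓘(ℝ, E) x z := by
  rw [coordTrans, Function.comp_apply, (extChartAt 𝓘(ℝ, E) x₀).left_inv (by simpa using hz)]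

variable [IsManifold 𝓘(ℝ, E) ∞ M]

lemma contDiffAt_coordTrans {x₀ x z : M} (hz : z ∈ (chartAt E x₀).source)
    (hz' : z ∈ (chartAt E x).source) :
    ContDiffAt ℝ ∞ (coordTrans E x₀ x) (extChartAt 𝓘(ℝ, E) x₀ z) := by
  have h' : extChartAt 𝓘(ℝ, E) x₀ z ∈
      ((extChartAt 𝓘(ℝ, E) x₀).symm ≫ (extChartAt 𝓘(ℝ, E) x)).source := by
    rw [PartialEquiv.trans_source'', PartialEquiv.symm_symm, PartialEquiv.symm_target]
    exact Set.mem_image_of_mem _ ⟨by simpa using hz, by simpa using hz'⟩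
  have := contDiffWithinAt_ext_coord_change (I := 𝓘(ℝ, E)) (n := ∞) x x₀ h'
  simpa [contDiffWithinAt_univ, coordTrans] using this

lemma fderiv_coordTrans {x₀ x z : M} :
    fderiv ℝ (coordTrans E x₀ x) (extChartAt 𝓘(ℝ, E) x₀ z) =
      tangentCoordChange 𝓘(ℝ, E) x₀ x z := by
  rw [tangentCoordChange_def, coordTrans]
  simp [fderivWithin_univ]

lemma fderiv_coordTrans_bijective {x₀ x z : M} (hz : z ∈ (chartAt E x₀).source)
    (hz' : z ∈ (chartAt E x).source) :
    Function.Bijective (fderiv ℝ (coordTrans E x₀ x) (extChartAt 𝓘(ℝ, E) x₀ z)) := by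
  rw [fderiv_coordTrans, Function.bijective_iff_has_inverse]
  refine ⟨tangentCoordChange 𝓘(ℝ, E) x x₀ z, fun a => ?_, fun a => ?_⟩
  · rw [tangentCoordChange_comp (by simp [hz, hz']), tangentCoordChange_self (by simp [hz])]
  · rw [tangentCoordChange_comp (by simp [hz, hz']), tangentCoordChange_self (by simp [hz'])]

/-- In the charts of the tangent bundle given by the preferred charts of the base, the change of
coordinates is `(y, w) ↦ (τ y, Dτ(y) w)`, where `τ` is the change of coordinates of the base. -/
lemma extChartAt_tangent_comp_symm (p₀ p : TangentBundle 𝓘(ℝ, E) M) {z : M}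
    (hz : z ∈ (chartAt E p₀.1).source) (hz' : z ∈ (chartAt E p.1).source) (w : E) :
    extChartAt 𝓘(ℝ, E).tangent p
      ((extChartAt 𝓘(ℝ, E).tangent p₀).symm (extChartAt 𝓘(ℝ, E) p₀.1 z, w)) =
      (coordTrans E p₀.1 p.1 (extChartAt 𝓘(ℝ, E) p₀.1 z),
        fderiv ℝ (coordTrans E p₀.1 p.1) (extChartAt 𝓘(ℝ, E) p₀.1 z) w) := by
  have h1 : (extChartAt 𝓘(ℝ, E).tangent p₀).symm (extChartAt 𝓘(ℝ, E) p₀.1 z, w) =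
      (⟨z, tangentCoordChange 𝓘(ℝ, E) p₀.1 z z w⟩ : TangentBundle 𝓘(ℝ, E) M) := by
    have h2 : (extChartAt 𝓘(ℝ, E).tangent p₀)
        (⟨z, tangentCoordChange 𝓘(ℝ, E) p₀.1 z z w⟩ : TangentBundle 𝓘(ℝ, E) M) =
        (extChartAt 𝓘(ℝ, E) p₀.1 z, w) := by
      have : (extChartAt 𝓘(ℝ, E).tangent p₀)
        (⟨z, tangentCoordChange 𝓘(ℝ, E) p₀.1 z z w⟩ : TangentBundle 𝓘(ℝ, E) M) =
        (extChartAt 𝓘(ℝ, E) p₀.1 z, tangentCoordChange 𝓘(ℝ, E) z p₀.1 z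
          (tangentCoordChange 𝓘(ℝ, E) p₀.1 z z w)) := rfl
      rw [this, tangentCoordChange_comp (by simp [hz]), tangentCoordChange_self (by simp [hz])]
    rw [← h2]
    refine (extChartAt 𝓘(ℝ, E).tangent p₀).left_inv ?_
    rw [extChartAt_source]
    exact (TangentBundle.mem_chart_source_iff _ _).2 hz
  rw [h1, coordTrans_apply hz, fderiv_coordTrans]
  have : (extChartAt 𝓘(ℝ, E).tangent p)
        (⟨z, tangentCoordChange 𝓘(ℝ, E) p₀.1 z z w⟩ : TangentBundle 𝓘(ℝ, E) M) =
        (extChartAt 𝓘(ℝ, E) p.1 z, tangentCoordChange 𝓘(ℝ, E) z p.1 z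
          (tangentCoordChange 𝓘(ℝ, E) p₀.1 z z w)) := rfl
  rw [this, tangentCoordChange_comp (by simp [hz, hz'])]

/-- The derivative of the change of coordinates of the tangent bundle. -/
lemma tangentCoordChange_tangent (p₀ p : TangentBundle 𝓘(ℝ, E) M)
    (hp : p.1 ∈ (chartAt E p₀.1).source) (ξ : E × E) :
    letI y := extChartAt 𝓘(ℝ, E) p₀.1 p.1
    letI τ := coordTrans E p₀.1 p.1
    tangentCoordChange 𝓘(ℝ, E).tangent p₀ p p ξ =
      (fderiv ℝ τ y ξ.1,
        fderiv ℝ (fderiv ℝ τ) y ξ.1 (extChartAt 𝓘(ℝ, E).tangent p₀ p).2 + fderiv ℝ τ y ξ.2) := by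
  set y := extChartAt 𝓘(ℝ, E) p₀.1 p.1 with hy
  set τ := coordTrans E p₀.1 p.1 with hτ
  set w : E := (extChartAt 𝓘(ℝ, E).tangent p₀ p).2 with hw
  have hyw : extChartAt 𝓘(ℝ, E).tangent p₀ p = (y, w) := rfl
  have hp' : p.1 ∈ (chartAt E p.1).source := mem_chart_source E p.1
  rw [tangentCoordChange_def, hyw]
  have hrange : Set.range 𝓘(ℝ, E).tangent = Set.univ := by
    simp
  rw [hrange, fderivWithin_univ]
  have hev : (extChartAt 𝓘(ℝ, E).tangent p ∘ (extChartAt 𝓘(ℝ, E).tangent p₀).symm)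
      =ᶠ[𝓝 (y, w)] fun q : E × E => (τ q.1, fderiv ℝ τ q.1 q.2) := by
    have h1 : ∀ᶠ y' in 𝓝 y, y' ∈ (extChartAt 𝓘(ℝ, E) p₀.1).target :=
      extChartAt_target_mem_nhds' ((extChartAt 𝓘(ℝ, E) p₀.1).map_source (by simpa using hp))
    have h2 : ∀ᶠ y' in 𝓝 y, (extChartAt 𝓘(ℝ, E) p₀.1).symm y' ∈ (chartAt E p.1).source := by
      refine (continuousAt_extChartAt_symm' (by simpa using hp)).eventually_mem ?_
      rw [(extChartAt 𝓘(ℝ, E) p₀.1).left_inv (by simpa using hp)]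
      exact chart_source_mem_nhds E p.1
    filter_upwards [(continuous_fst.tendsto (y, w)).eventually (h1.and h2)] with q hq
    have hs : (extChartAt 𝓘(ℝ, E) p₀.1).symm q.1 ∈ (chartAt E p₀.1).source := by
      simpa using (extChartAt 𝓘(ℝ, E) p₀.1).map_target hq.1
    have := extChartAt_tangent_comp_symm p₀ p hs hq.2 q.2
    rwa [(extChartAt 𝓘(ℝ, E) p₀.1).right_inv hq.1] at this
  rw [hev.fderiv_eq]
  have hsm : ContDiffAt ℝ 2 τ y := (contDiffAt_coordTrans hp hp').of_le ENat.LEInfty.out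
  have hτd : HasFDerivAt τ (fderiv ℝ τ y) y := (hsm.differentiableAt two_ne_zero).hasFDerivAt
  have hT : HasFDerivAt (fderiv ℝ τ) (fderiv ℝ (fderiv ℝ τ) y) y :=
    ((hsm.fderiv_right (m := 1) (by norm_num)).differentiableAt one_ne_zero).hasFDerivAt
  have hf1 : HasFDerivAt (fun q : E × E => τ q.1)
      ((fderiv ℝ τ y).comp (ContinuousLinearMap.fst ℝ E E)) (y, w) :=
    HasFDerivAt.comp (g := τ) (f := Prod.fst) (y, w) hτd hasFDerivAt_fst
  have hf2 : HasFDerivAt (fun q : E × E => fderiv ℝ τ q.1)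
      ((fderiv ℝ (fderiv ℝ τ) y).comp (ContinuousLinearMap.fst ℝ E E)) (y, w) :=
    HasFDerivAt.comp (g := fderiv ℝ τ) (f := Prod.fst) (y, w) hT hasFDerivAt_fst
  have hf3 := hf2.clm_apply (hasFDerivAt_snd (𝕜 := ℝ) (E := E) (F := E) (p := (y, w)))
  rw [(hf1.prodMk hf3).fderiv]
  ext <;> simp [add_comm]

end Sasaki

/-! ### Local expressions of the metric and of the Sasaki form -/

namespace Sasaki

variable {E : Type u} [NormedAddCommGroup E] [NormedSpace ℝ E]
  {M : Type v} [TopologicalSpace M] [ChartedSpace E M] [IsManifold 𝓘(ℝ, E) ∞ M]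
  [RiemannianBundle (fun x : M => TangentSpace 𝓘(ℝ, E) x)]

/-- The inner product of `T_z M`, as a function on the model space. -/
def tangentInner (z : M) (a b : E) : ℝ :=
  inner ℝ (show TangentSpace 𝓘(ℝ, E) z from a) (show TangentSpace 𝓘(ℝ, E) z from b)

lemma chartMetric_apply {x₀ z : M} (hz : z ∈ (chartAt E x₀).source) (a b : E) :
    chartMetric x₀ (extChartAt 𝓘(ℝ, E) x₀ z) a b =
      tangentInner z (tangentCoordChange 𝓘(ℝ, E) x₀ z z a)
        (tangentCoordChange 𝓘(ℝ, E) x₀ z z b) := by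
  have key : ∀ z' : M, z' = z →
      (innerSL ℝ (E := TangentSpace 𝓘(ℝ, E) z')).bilinearComp
        ((trivializationAt E (TangentSpace 𝓘(ℝ, E) : M → Type u) x₀).symmL ℝ z')
        ((trivializationAt E (TangentSpace 𝓘(ℝ, E) : M → Type u) x₀).symmL ℝ z') a b =
      tangentInner z (tangentCoordChange 𝓘(ℝ, E) x₀ z z a)
        (tangentCoordChange 𝓘(ℝ, E) x₀ z z b) := by
    rintro _ rfl
    rw [TangentBundle.symmL_trivializationAt_eq_core hz]
    rfl
  exact key _ ((extChartAt 𝓘(ℝ, E) x₀).left_inv (by simpa using hz))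

lemma chartMetric_self (x : M) (a b : E) :
    chartMetric x (extChartAt 𝓘(ℝ, E) x x) a b = tangentInner x a b := by
  rw [chartMetric_apply (mem_chart_source E x), tangentCoordChange_self (mem_extChartAt_source x),
    tangentCoordChange_self (mem_extChartAt_source x)]

lemma chartMetric_self_pos (x : M) : ∀ v ≠ (0 : E),
    0 < chartMetric x (extChartAt 𝓘(ℝ, E) x x) v v := by
  intro v hv
  rw [chartMetric_self]
  exact (real_inner_self_pos (F := TangentSpace 𝓘(ℝ, E) x)).2 hv

lemma chartMetric_self_symm (x : M) (a b : E) :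
    chartMetric x (extChartAt 𝓘(ℝ, E) x x) a b = chartMetric x (extChartAt 𝓘(ℝ, E) x x) b a := by
  rw [chartMetric_self, chartMetric_self]
  exact real_inner_comm (F := TangentSpace 𝓘(ℝ, E) x) _ _

/-- The local expressions of the metric in two charts are related by the change of coordinates. -/
lemma chartMetric_pullback {x₀ x : M} (hx : x ∈ (chartAt E x₀).source) :
    ∀ᶠ y in 𝓝 (extChartAt 𝓘(ℝ, E) x₀ x), chartMetric x₀ y =
      (chartMetric x (coordTrans E x₀ x y)).bilinearComp
        (fderiv ℝ (coordTrans E x₀ x) y) (fderiv ℝ (coordTrans E x₀ x) y) := by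
  have h1 : ∀ᶠ y' in 𝓝 (extChartAt 𝓘(ℝ, E) x₀ x), y' ∈ (extChartAt 𝓘(ℝ, E) x₀).target :=
    extChartAt_target_mem_nhds' ((extChartAt 𝓘(ℝ, E) x₀).map_source (by simpa using hx))
  have h2 : ∀ᶠ y' in 𝓝 (extChartAt 𝓘(ℝ, E) x₀ x),
      (extChartAt 𝓘(ℝ, E) x₀).symm y' ∈ (chartAt E x).source := by
    refine (continuousAt_extChartAt_symm' (by simpa using hx)).eventually_mem ?_
    rw [(extChartAt 𝓘(ℝ, E) x₀).left_inv (by simpa using hx)]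
    exact chart_source_mem_nhds E x
  filter_upwards [h1, h2] with y hy hz'
  obtain ⟨z, hz, rfl⟩ : ∃ z ∈ (chartAt E x₀).source, extChartAt 𝓘(ℝ, E) x₀ z = y :=
    ⟨_, by simpa using (extChartAt 𝓘(ℝ, E) x₀).map_target hy,
      (extChartAt 𝓘(ℝ, E) x₀).right_inv hy⟩
  rw [(extChartAt 𝓘(ℝ, E) x₀).left_inv (by simpa using hz)] at hz'
  ext a b
  rw [chartMetric_apply hz, ContinuousLinearMap.bilinearComp_apply, coordTrans_apply hz,
    chartMetric_apply hz', fderiv_coordTrans, tangentCoordChange_comp (by simp [hz, hz']),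
    tangentCoordChange_comp (by simp [hz, hz'])]

/-- The local expression of the metric in a chart is smooth at the base point. -/
lemma contDiffAt_chartMetric
    [IsContMDiffRiemannianBundle 𝓘(ℝ, E) ∞ E (fun x : M => TangentSpace 𝓘(ℝ, E) x)] (x : M) :
    ContDiffAt ℝ ∞ (chartMetric (E := E) x) (extChartAt 𝓘(ℝ, E) x x) := by
  obtain ⟨g, hg, hgi⟩ := IsContMDiffRiemannianBundle.exists_contMDiff (IB := 𝓘(ℝ, E)) (n := ∞)
    (F := E) (E := fun x : M => TangentSpace 𝓘(ℝ, E) x)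
  have h1 := ((contMDiffAt_hom_bundle _).1 (hg x)).2
  have h2 : ContMDiffAt 𝓘(ℝ, E) 𝓘(ℝ, E) ∞ (extChartAt 𝓘(ℝ, E) x).symm
      (extChartAt 𝓘(ℝ, E) x x) :=
    (contMDiffOn_extChartAt_symm x).contMDiffAt (extChartAt_target_mem_nhds x)
  have h3 := h1.comp_of_eq h2 (extChartAt_to_inv x)
  refine h3.contDiffAt.congr_of_eventuallyEq ?_
  filter_upwards [extChartAt_target_mem_nhds (I := 𝓘(ℝ, E)) x] with y hy
  obtain ⟨z, hz, rfl⟩ : ∃ z ∈ (chartAt E x).source, extChartAt 𝓘(ℝ, E) x z = y :=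
    ⟨_, by simpa using (extChartAt 𝓘(ℝ, E) x).map_target hy,
      (extChartAt 𝓘(ℝ, E) x).right_inv hy⟩
  ext a b
  rw [chartMetric_apply hz, Function.comp_apply,
    (extChartAt 𝓘(ℝ, E) x).left_inv (by simpa using hz)]
  rw [inCoordinates_apply_eq₂ hz hz (by simp)]
  simp only [Trivial.fiberBundle_trivializationAt', Trivial.linearMapAt_trivialization,
        LinearMap.id_coe, id_eq]
  rw [← hgi]
  have := TangentBundle.symmL_trivializationAt_eq_core (I := 𝓘(ℝ, E)) hz
  have h4 : ∀ a : E, (trivializationAt E (TangentSpace 𝓘(ℝ, E) : M → Type u) x).symm z a =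
      tangentCoordChange 𝓘(ℝ, E) x z z a := fun a =>
    (Trivialization.symmL_apply _ hz _).symm.trans (DFunLike.congr_fun this a)
  rw [h4, h4]
  rfl

variable [FiniteDimensional ℝ E]

omit [FiniteDimensional ℝ E] in
lemma koszulForm_eq (x : M) (v u : E) :
    koszulForm x v u = koszul (chartMetric x) (extChartAt 𝓘(ℝ, E) x x) v u := rfl

lemma christoffel_eq (x : M) (v u : E) :
    (show E from christoffel x v u) =
      christoffelVec (chartMetric (E := E) x) (extChartAt 𝓘(ℝ, E) x x) v u := by
  refine ext_of_definite (chartMetric_self_pos x) fun w => ?_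
  rw [apply_christoffelVec (chartMetric_self_pos x), chartMetric_self, ← koszulForm_eq]
  have := FiniteDimensional.complete ℝ (TangentSpace 𝓘(ℝ, E) x)
  exact InnerProductSpace.toDual_symm_apply (𝕜 := ℝ) (E := TangentSpace 𝓘(ℝ, E) x)

/-- The Sasaki inner product on `T_p TM`, in the chart of `TM` given by the preferred chart at the
base point of `p`. -/
def sasakiForm (p : TangentBundle 𝓘(ℝ, E) M) (ξ η : E × E) : ℝ :=
  sasakiCoord (chartMetric p.1) (extChartAt 𝓘(ℝ, E) p.1 p.1) p.2 ξ η

lemma sasakiNorm_sq (p : TangentBundle 𝓘(ℝ, E) M) (ξ : TangentSpace 𝓘(ℝ, E).tangent p) :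
    sasakiNorm p ξ ^ 2 = sasakiForm p ξ ξ := by
  have hn : ∀ v : TangentSpace 𝓘(ℝ, E) p.1, ‖v‖ ^ 2 = tangentInner (E := E) p.1 v v := fun v =>
    (real_inner_self_eq_norm_sq v).symm
  have h : ∀ v Ξ : E, sasakiNorm p (v, Ξ) ^ 2 = sasakiForm p (v, Ξ) (v, Ξ) := by
    intro v Ξ
    have hc := christoffel_eq p.1 v p.2
    have h1 : sasakiForm p (v, Ξ) (v, Ξ) = tangentInner p.1 v v +
        tangentInner p.1
          (Ξ + christoffelVec (chartMetric (E := E) p.1) (extChartAt 𝓘(ℝ, E) p.1 p.1) v p.2)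
          (Ξ + christoffelVec (chartMetric (E := E) p.1) (extChartAt 𝓘(ℝ, E) p.1 p.1) v p.2) := by
      rw [← chartMetric_self, ← chartMetric_self]; rfl
    rw [h1]
    refine (Real.sq_sqrt (by positivity)).trans ?_
    refine congrArg₂ (· + ·) (hn _) ((hn _).trans ?_)
    exact congrArg (fun c : E => tangentInner p.1 (Ξ + c) (Ξ + c)) hc
  exact h (show E × E from ξ).1 (show E × E from ξ).2

end Sasaki

/-! ### The Sasaki metric is a continuous Riemannian metric -/

section MetricCoordinates

variable {E : Type u} [NormedAddCommGroup E] [NormedSpace ℝ E] [FiniteDimensional ℝ E]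

/-- The Sasaki form in coordinates, as a continuous bilinear form. -/
def sasakiCoordL (G : E → E →L[ℝ] E →L[ℝ] ℝ) (y w : E) : (E × E) →L[ℝ] (E × E) →L[ℝ] ℝ :=
  letI Γ : E →L[ℝ] E := LinearMap.toContinuousLinearMap
    { toFun := fun v => christoffelVec G y v w
      map_add' := fun _ _ => christoffelVec_add _ _ _ _ _
      map_smul' := fun _ _ => christoffelVec_smul _ _ _ _ _ }
  letI V : (E × E) →L[ℝ] E :=
    ContinuousLinearMap.snd ℝ E E + Γ.comp (ContinuousLinearMap.fst ℝ E E)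
  (G y).bilinearComp (ContinuousLinearMap.fst ℝ E E) (ContinuousLinearMap.fst ℝ E E) +
    (G y).bilinearComp V V

omit [FiniteDimensional ℝ E] in
lemma sasakiCoord_pos {G : E → E →L[ℝ] E →L[ℝ] ℝ} {y : E} (hpos : ∀ v ≠ 0, 0 < G y v v) (w : E)
    {ξ : E × E} (hξ : ξ ≠ 0) : 0 < sasakiCoord G y w ξ ξ := by
  have hnn : ∀ v, 0 ≤ G y v v := fun v => by
    by_cases h : v = 0
    · simp [h]
    · exact (hpos v h).le
  unfold sasakiCoord
  by_cases h1 : ξ.1 = 0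
  · have h2 : ξ.2 ≠ 0 := fun h2 => hξ (Prod.ext h1 h2)
    have h3 : christoffelVec G y 0 w = 0 := by
      simpa using christoffelVec_smul G y 0 0 w
    simpa [h1, h3] using hpos _ h2
  · exact add_pos_of_pos_of_nonneg (hpos _ h1) (hnn _)

omit [FiniteDimensional ℝ E] in
lemma sasakiCoord_symm {G : E → E →L[ℝ] E →L[ℝ] ℝ} {y : E} (h : ∀ a b, G y a b = G y b a)
    (w : E) (ξ η : E × E) : sasakiCoord G y w ξ η = sasakiCoord G y w η ξ := by
  unfold sasakiCoord
  rw [h ξ.1, h (ξ.2 + _)]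

/-- The unit ball of a definite form on a finite dimensional space is bounded. -/
lemma isVonNBounded_of_definite {A : E →L[ℝ] E →L[ℝ] ℝ} (hA : ∀ v ≠ 0, 0 < A v v) :
    Bornology.IsVonNBounded ℝ {v : E | A v v < 1} := by
  -- `c` is the minimum of the form on the unit sphere.
  obtain ⟨c, hc, hAc⟩ : ∃ c > 0, ∀ v, c * ‖v‖ ^ 2 ≤ A v v := by
    have hcomp : IsCompact (Metric.sphere (0 : E) 1) := by
      have : ProperSpace E := FiniteDimensional.proper ℝ E
      exact isCompact_sphere _ _
    have hcont : Continuous fun v => A v v := by fun_prop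
    rcases (Metric.sphere (0 : E) 1).eq_empty_or_nonempty with h | h
    · refine ⟨1, one_pos, fun v => ?_⟩
      have : v = 0 := by
        by_contra hv
        have : ‖v‖⁻¹ • v ∈ Metric.sphere (0 : E) 1 := by
          simp [norm_smul, inv_mul_cancel₀ (norm_ne_zero_iff.2 hv)]
        simp [h] at this
      simp [this]
    · obtain ⟨v₀, hv₀, hmin⟩ := hcomp.exists_isMinOn h hcont.continuousOn
      refine ⟨A v₀ v₀, hA _ (fun h0 => by simp [h0] at hv₀), fun v => ?_⟩
      by_cases hv : v = 0
      · simp [hv]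
      have hn : ‖v‖ ≠ 0 := norm_ne_zero_iff.2 hv
      have : A v₀ v₀ ≤ A (‖v‖⁻¹ • v) (‖v‖⁻¹ • v) := by
        refine hmin (?_ : ‖v‖⁻¹ • v ∈ Metric.sphere (0 : E) 1)
        simp [norm_smul, inv_mul_cancel₀ hn]
      simp only [map_smul, smul_apply, smul_eq_mul] at this
      calc A v₀ v₀ * ‖v‖ ^ 2 ≤ (‖v‖⁻¹ * (‖v‖⁻¹ * A v v)) * ‖v‖ ^ 2 := by gcongr
        _ = A v v := by field_simp
  rw [NormedSpace.isVonNBounded_iff, isBounded_iff_forall_norm_le]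
  refine ⟨√(1 / c), fun v hv => Real.le_sqrt_of_sq_le ?_⟩
  rw [le_div_iff₀ hc, mul_comm]
  exact (hAc v).trans hv.le

end MetricCoordinates

namespace Sasaki

variable {E : Type u} [NormedAddCommGroup E] [NormedSpace ℝ E]
  {M : Type v} [TopologicalSpace M] [ChartedSpace E M] [IsManifold 𝓘(ℝ, E) ∞ M]
  [RiemannianBundle (fun x : M => TangentSpace 𝓘(ℝ, E) x)]

/-- The Sasaki inner product does not depend on the chart used to compute it. -/
lemma sasakiForm_tangentCoordChange
    [IsContMDiffRiemannianBundle 𝓘(ℝ, E) ∞ E (fun x : M => TangentSpace 𝓘(ℝ, E) x)]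
    [FiniteDimensional ℝ E]
    (p₀ p : TangentBundle 𝓘(ℝ, E) M) (hp : p.1 ∈ (chartAt E p₀.1).source) (ξ η : E × E) :
    sasakiForm p (tangentCoordChange 𝓘(ℝ, E).tangent p₀ p p ξ)
      (tangentCoordChange 𝓘(ℝ, E).tangent p₀ p p η) =
    sasakiCoord (chartMetric p₀.1) (extChartAt 𝓘(ℝ, E).tangent p₀ p).1
      (extChartAt 𝓘(ℝ, E).tangent p₀ p).2 ξ η := by
  have hp' : p.1 ∈ (chartAt E p.1).source := mem_chart_source E p.1
  rw [tangentCoordChange_tangent p₀ p hp, tangentCoordChange_tangent p₀ p hp]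
  have h1 : (extChartAt 𝓘(ℝ, E).tangent p₀ p).1 = extChartAt 𝓘(ℝ, E) p₀.1 p.1 := rfl
  have h2 : fderiv ℝ (coordTrans E p₀.1 p.1) (extChartAt 𝓘(ℝ, E) p₀.1 p.1)
      (extChartAt 𝓘(ℝ, E).tangent p₀ p).2 = p.2 := by
    have h3 : ∀ u : E, tangentCoordChange 𝓘(ℝ, E) p₀.1 p.1 p.1
        (tangentCoordChange 𝓘(ℝ, E) p.1 p₀.1 p.1 u) = u := fun u => by
      rw [tangentCoordChange_comp (by simp [hp]), tangentCoordChange_self (by simp)]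
    rw [fderiv_coordTrans]
    exact h3 p.2
  rw [h1, ← sasakiCoord_pullback (G' := chartMetric p.1) (τ := coordTrans E p₀.1 p.1)
    ((contDiffAt_coordTrans hp hp').of_le ENat.LEInfty.out) (fderiv_coordTrans_bijective hp hp')
    _ _ _ (chartMetric_pullback hp), h2, coordTrans_apply hp]
  · rfl
  · rw [coordTrans_apply hp]
    exact (contDiffAt_chartMetric p.1).differentiableAt (by simp)
  · rw [coordTrans_apply hp]; exact chartMetric_self_symm p.1
  · rw [coordTrans_apply hp]; exact chartMetric_self_pos p.1

variable [FiniteDimensional ℝ E]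

omit [FiniteDimensional ℝ E] in
lemma sasakiForm_symm (p : TangentBundle 𝓘(ℝ, E) M) (ξ η : E × E) :
    sasakiForm p ξ η = sasakiForm p η ξ :=
  sasakiCoord_symm (E := E) (chartMetric_self_symm p.1) (show E from p.2) ξ η

omit [FiniteDimensional ℝ E] in
lemma sasakiForm_pos (p : TangentBundle 𝓘(ℝ, E) M) (ξ : E × E) (hξ : ξ ≠ 0) :
    0 < sasakiForm p ξ ξ :=
  sasakiCoord_pos (E := E) (chartMetric_self_pos p.1) (show E from p.2) hξ

/-- The Sasaki inner product on `T_p TM`. -/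
def sasakiInner (p : TangentBundle 𝓘(ℝ, E) M) : TangentSpace 𝓘(ℝ, E).tangent p →L[ℝ]
    TangentSpace 𝓘(ℝ, E).tangent p →L[ℝ] ℝ :=
  sasakiCoordL (chartMetric p.1) (extChartAt 𝓘(ℝ, E) p.1 p.1) p.2

lemma sasakiInner_symm (p : TangentBundle 𝓘(ℝ, E) M) (ξ η : TangentSpace 𝓘(ℝ, E).tangent p) :
    sasakiInner p ξ η = sasakiInner p η ξ :=
  sasakiForm_symm p ξ η

lemma sasakiInner_pos (p : TangentBundle 𝓘(ℝ, E) M) (ξ : TangentSpace 𝓘(ℝ, E).tangent p)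
    (hξ : ξ ≠ 0) : 0 < sasakiInner p ξ ξ :=
  sasakiForm_pos p ξ hξ

lemma isVonNBounded_sasakiInner (p : TangentBundle 𝓘(ℝ, E) M) :
    Bornology.IsVonNBounded ℝ {ξ : TangentSpace 𝓘(ℝ, E).tangent p | sasakiInner p ξ ξ < 1} :=
  isVonNBounded_of_definite (E := E × E)
    (A := sasakiCoordL (E := E) (chartMetric p.1) (extChartAt 𝓘(ℝ, E) p.1 p.1) (show E from p.2))
    (sasakiForm_pos p)

variable (E M) in
/-- The Sasaki metric on the tangent bundle. -/
def sasakiMetric [IsContMDiffRiemannianBundle 𝓘(ℝ, E) ∞ E (fun x : M => TangentSpace 𝓘(ℝ, E) x)] :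
    ContinuousRiemannianMetric (E × E)
      (fun p : TangentBundle 𝓘(ℝ, E) M => TangentSpace 𝓘(ℝ, E).tangent p) where
  inner := sasakiInner
  symm := sasakiInner_symm
  pos := sasakiInner_pos
  isVonNBounded := isVonNBounded_sasakiInner
  continuous := by
    rw [continuous_iff_continuousAt]
    intro p₀
    rw [continuousAt_hom_bundle]
    refine ⟨continuousAt_id, ?_⟩
    rw [continuousAt_clm_apply]
    intro ξ
    rw [continuousAt_clm_apply]
    intro η
    have hev : ∀ᶠ p : TangentBundle 𝓘(ℝ, E) M in 𝓝 p₀,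
        p ∈ (chartAt (ModelProd E E) p₀).source := chart_source_mem_nhds (ModelProd E E) p₀
    have hC1 : ContDiffAt ℝ 1 (chartMetric (E := E) p₀.1) (extChartAt 𝓘(ℝ, E) p₀.1 p₀.1) :=
      (contDiffAt_chartMetric (E := E) p₀.1).of_le ENat.LEInfty.out
    have hcont := continuousAt_sasakiCoord (w := (extChartAt 𝓘(ℝ, E).tangent p₀ p₀).2) hC1
      (chartMetric_self_pos p₀.1) ξ η
    refine (hcont.comp_of_eq (continuousAt_extChartAt (I := 𝓘(ℝ, E).tangent) p₀)
      rfl).congr ?_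
    filter_upwards [hev] with p hp
    have hp1 : p.1 ∈ (chartAt E p₀.1).source := (TangentBundle.mem_chart_source_iff _ _).1 hp
    rw [inCoordinates_apply_eq₂ hp hp (by simp)]
    have h4 : ∀ ζ : E × E, (trivializationAt (E × E) (TangentSpace 𝓘(ℝ, E).tangent :
        TangentBundle 𝓘(ℝ, E) M → Type u) p₀).symm p ζ =
        tangentCoordChange 𝓘(ℝ, E).tangent p₀ p p ζ := fun ζ =>
      (Trivialization.symmL_apply _ hp _).symm.trans
        (DFunLike.congr_fun (TangentBundle.symmL_trivializationAt_eq_core hp) ζ)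
    rw [h4, h4]
    simp only [Trivial.fiberBundle_trivializationAt', Trivial.linearMapAt_trivialization,
      LinearMap.id_coe, id_eq]
    exact (sasakiForm_tangentCoordChange p₀ p hp1 ξ η).symm

end Sasaki

/-! ### The Sasaki distance -/

namespace Sasaki

variable {E : Type u} [NormedAddCommGroup E] [NormedSpace ℝ E] [FiniteDimensional ℝ E]
  {M : Type v} [TopologicalSpace M] [ChartedSpace E M] [IsManifold 𝓘(ℝ, E) ∞ M]
  [RiemannianBundle (fun x : M => TangentSpace 𝓘(ℝ, E) x)]

section
variable [IsContMDiffRiemannianBundle 𝓘(ℝ, E) ∞ E (fun x : M => TangentSpace 𝓘(ℝ, E) x)]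

/-- The Riemannian bundle structure on `T(TM)` given by the Sasaki metric. -/
local instance sasakiBundle :
    RiemannianBundle (fun p : TangentBundle 𝓘(ℝ, E) M => TangentSpace 𝓘(ℝ, E).tangent p) :=
  ⟨(sasakiMetric E M).toRiemannianMetric⟩

lemma enorm_eq_sasakiNorm (p : TangentBundle 𝓘(ℝ, E) M)
    (ξ : TangentSpace 𝓘(ℝ, E).tangent p) : ‖ξ‖ₑ = ENNReal.ofReal (sasakiNorm p ξ) := by
  rw [← ofReal_norm]
  congr 1
  have h1 : ‖ξ‖ ^ 2 = sasakiForm p ξ ξ := (real_inner_self_eq_norm_sq ξ).symm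
  rw [← sasakiNorm_sq] at h1
  exact (sq_eq_sq₀ (norm_nonneg _) (Real.sqrt_nonneg _)).1 h1

lemma sasakiEDist_eq_riemannianEDist (p q : TangentBundle 𝓘(ℝ, E) M) :
    sasakiEDist p q = riemannianEDist 𝓘(ℝ, E).tangent p q := by
  let e₂ : ∀ p : TangentBundle 𝓘(ℝ, E) M, ENorm (TangentSpace 𝓘(ℝ, E).tangent p) :=
    fun p => inferInstance
  let e₁ : ∀ p : TangentBundle 𝓘(ℝ, E) M, ENorm (TangentSpace 𝓘(ℝ, E).tangent p) :=
    fun p => ⟨fun ξ => ENNReal.ofReal (sasakiNorm p ξ)⟩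
  have h : e₁ = e₂ := by
    funext p
    refine congrArg ENorm.mk ?_
    funext ξ
    exact (enorm_eq_sasakiNorm p ξ).symm
  exact congrArg (fun e => @riemannianEDist _ _ _ _ _ 𝓘(ℝ, E).tangent _ _ _ e p q) h

lemma sasakiEDist_comm (p q : TangentBundle 𝓘(ℝ, E) M) : sasakiEDist p q = sasakiEDist q p := by
  rw [sasakiEDist_eq_riemannianEDist, sasakiEDist_eq_riemannianEDist, riemannianEDist_comm]

lemma sasakiEDist_triangle (p q r : TangentBundle 𝓘(ℝ, E) M) :
    sasakiEDist p r ≤ sasakiEDist p q + sasakiEDist q r := by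
  simp only [sasakiEDist_eq_riemannianEDist]
  exact riemannianEDist_triangle

/-- The Sasaki distance induces the topology of the tangent bundle. -/
lemma nhds_basis_sasakiEDist [RegularSpace (TangentBundle 𝓘(ℝ, E) M)]
    (p : TangentBundle 𝓘(ℝ, E) M) :
    (𝓝 p).HasBasis (fun c : ℝ≥0∞ => 0 < c) (fun c => {q | sasakiEDist p q < c}) := by
  simp only [sasakiEDist_eq_riemannianEDist]
  exact (Filter.basis_sets (𝓝 p)).to_hasBasis'
    (fun _ hs => setOfPred_riemannianEDist_lt_subset_nhds' _ hs)
    (fun _ hc => eventually_riemannianEDist_lt _ p hc)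

end

/-- The projection of the tangent bundle does not increase the norm of tangent vectors. -/
lemma enorm_mfderiv_proj_le (p : TangentBundle 𝓘(ℝ, E) M) (ξ : TangentSpace 𝓘(ℝ, E).tangent p) :
    ‖mfderiv 𝓘(ℝ, E).tangent 𝓘(ℝ, E) (fun q : TangentBundle 𝓘(ℝ, E) M => q.1) p ξ‖ₑ ≤
      ENNReal.ofReal (sasakiNorm p ξ) := by
  have h : mfderiv 𝓘(ℝ, E).tangent 𝓘(ℝ, E) (fun q : TangentBundle 𝓘(ℝ, E) M => q.1) p =
      ContinuousLinearMap.fst ℝ E E := by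
    have hd : MDifferentiableAt 𝓘(ℝ, E).tangent 𝓘(ℝ, E)
        (fun q : TangentBundle 𝓘(ℝ, E) M => q.1) p := mdifferentiableAt_proj _
    rw [hd.mfderiv]
    have hrange : Set.range 𝓘(ℝ, E).tangent = Set.univ := by simp
    rw [hrange, fderivWithin_univ]
    refine HasFDerivAt.fderiv (hasFDerivAt_fst.congr_of_eventuallyEq ?_)
    have := extChartAt_target_mem_nhds (I := 𝓘(ℝ, E).tangent) p
    filter_upwards [this] with q hq
    have h1 : (extChartAt 𝓘(ℝ, E).tangent p ((extChartAt 𝓘(ℝ, E).tangent p).symm q)).1 = q.1 := by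
      rw [(extChartAt 𝓘(ℝ, E).tangent p).right_inv hq]
    exact h1
  rw [h, ← ofReal_norm]
  refine ENNReal.ofReal_le_ofReal (Real.le_sqrt_of_sq_le ?_)
  exact le_add_of_nonneg_right (by positivity)

end Sasaki

/-! ### Topology of the tangent bundle -/

lemma isAnalyticSpace_of_iUnion_eq_univ {X : Type*} [MeasurableSpace X] {s : ℕ → Set X}
    (hs : ∀ n, IsAnalyticSpace (s n)) (hU : ⋃ n, s n = Set.univ) : IsAnalyticSpace X := by
  intro hne
  have : ∀ n, ∃ φ : ℝ → X, Measurable φ ∧ s n ⊆ Set.range φ := by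
    intro n
    rcases (s n).eq_empty_or_nonempty with h | ⟨x, hx⟩
    · exact ⟨fun _ => hne.some, measurable_const, by simp [h]⟩
    · obtain ⟨φ, hφ, hφs⟩ := hs n ⟨x, hx⟩
      refine ⟨fun t => φ t, measurable_subtype_coe.comp hφ, fun y hy => ?_⟩
      obtain ⟨t, ht⟩ := hφs ⟨y, hy⟩
      exact ⟨t, congrArg Subtype.val ht⟩
  choose φ hφ hφs using this
  refine (isAnalyticSpace_of_standardBorel (ℝ × ℕ)).of_surjective
    (f := fun p => φ p.2 p.1) (measurable_from_prod_countable_left hφ) (fun x => ?_) hne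
  obtain ⟨n, hn⟩ := Set.mem_iUnion.1 (hU ▸ Set.mem_univ x)
  obtain ⟨t, ht⟩ := hφs n hn
  exact ⟨(t, n), ht⟩

lemma isAnalyticSpace_of_sigmaCompact (X : Type*) [TopologicalSpace X] [SigmaCompactSpace X]
    [TopologicalSpace.MetrizableSpace X] [MeasurableSpace X] [BorelSpace X] :
    IsAnalyticSpace X := by
  refine isAnalyticSpace_of_iUnion_eq_univ (fun n => ?_) (iUnion_compactCovering X)
  have : CompactSpace (compactCovering X n) :=
    isCompact_iff_compactSpace.1 (isCompact_compactCovering X n)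
  let := TopologicalSpace.metrizableSpaceMetric (compactCovering X n)
  exact isAnalyticSpace_of_standardBorel _

namespace Sasaki

section Topology

variable (E : Type u) [NormedAddCommGroup E] [NormedSpace ℝ E]
  (M : Type v) [TopologicalSpace M] [ChartedSpace E M] [IsManifold 𝓘(ℝ, E) ∞ M]

lemma t2Space_tangentBundle [T2Space M] : T2Space (TangentBundle 𝓘(ℝ, E) M) := by
  refine ⟨fun p q hpq => ?_⟩
  have hπ : Continuous fun p : TangentBundle 𝓘(ℝ, E) M => p.1 :=
    FiberBundle.continuous_proj E (TangentSpace 𝓘(ℝ, E) : M → Type u)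
  by_cases h : p.1 = q.1
  · let e := trivializationAt E (TangentSpace 𝓘(ℝ, E) : M → Type u) p.1
    have hp : p ∈ e.source := e.mem_source.2 (FiberBundle.mem_baseSet_trivializationAt' p.1)
    have hq : q ∈ e.source := e.mem_source.2 (by
      rw [← h]; exact FiberBundle.mem_baseSet_trivializationAt' p.1)
    have hne : e p ≠ e q := fun h' => hpq (e.injOn hp hq h')
    obtain ⟨U, V, hU, hV, hpU, hqV, hUV⟩ := t2_separation hne
    exact ⟨e.source ∩ e ⁻¹' U, e.source ∩ e ⁻¹' V,
      e.toOpenPartialHomeomorph.isOpen_inter_preimage hU,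
      e.toOpenPartialHomeomorph.isOpen_inter_preimage hV, ⟨hp, hpU⟩, ⟨hq, hqV⟩,
      (hUV.preimage e).mono Set.inter_subset_right Set.inter_subset_right⟩
  · obtain ⟨U, V, hU, hV, hpU, hqV, hUV⟩ := t2_separation h
    exact ⟨_, _, hU.preimage hπ, hV.preimage hπ, hpU, hqV, hUV.preimage _⟩

lemma secondCountable_tangentBundle [FiniteDimensional ℝ E] [SecondCountableTopology M] :
    SecondCountableTopology (TangentBundle 𝓘(ℝ, E) M) := by
  obtain ⟨s, hs, hsU⟩ := TopologicalSpace.countable_cover_nhds fun x : M =>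
    (chartAt E x).open_source.mem_nhds (mem_chart_source E x)
  have : SecondCountableTopology (ModelProd E E) :=
    inferInstanceAs (SecondCountableTopology (E × E))
  refine ChartedSpace.secondCountable_of_countable_cover (ModelProd E E)
    (s := (fun x : M => (⟨x, 0⟩ : TangentBundle 𝓘(ℝ, E) M)) '' s) ?_ (hs.image _)
  refine Set.eq_univ_of_forall fun p => ?_
  obtain ⟨x, hx, hp⟩ := Set.mem_iUnion₂.1 (hsU ▸ Set.mem_univ p.1)
  refine Set.mem_iUnion₂.2 ⟨⟨x, 0⟩, ⟨x, hx, rfl⟩, ?_⟩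
  exact (TangentBundle.mem_chart_source_iff _ _).2 hp

lemma locallyCompact_tangentBundle [FiniteDimensional ℝ E] :
    LocallyCompactSpace (TangentBundle 𝓘(ℝ, E) M) :=
  Manifold.locallyCompact_of_finiteDimensional 𝓘(ℝ, E).tangent

lemma regularSpace_tangentBundle [FiniteDimensional ℝ E] [T2Space M] :
    RegularSpace (TangentBundle 𝓘(ℝ, E) M) := by
  have := t2Space_tangentBundle E M
  have := locallyCompact_tangentBundle E M
  infer_instance

/-- The tangent bundle of a connected manifold is connected: the zero section meets all fibers. -/
lemma preconnectedSpace_tangentBundle [PreconnectedSpace M] :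
    PreconnectedSpace (TangentBundle 𝓘(ℝ, E) M) := by
  rw [preconnectedSpace_iff_clopen]
  intro A hA
  rcases A.eq_empty_or_nonempty with h | ⟨p, hp⟩
  · exact Or.inl h
  -- The line `t ↦ (x, t u)` joins a tangent vector to the zero section.
  have hfib : ∀ q : TangentBundle 𝓘(ℝ, E) M,
      q ∈ A ↔ (⟨q.1, 0⟩ : TangentBundle 𝓘(ℝ, E) M) ∈ A := by
    intro q
    have hc : Continuous fun t : ℝ => (⟨q.1, t • q.2⟩ : TangentBundle 𝓘(ℝ, E) M) := by
      refine (FiberBundle.continuous_totalSpaceMk E (TangentSpace 𝓘(ℝ, E) : M → Type u) q.1).comp ?_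
      exact continuous_id.smul continuous_const
    have h1 := (hA.preimage hc)
    rcases isClopen_iff.1 h1 with h0 | h0
    · have ha : (1 : ℝ) ∉ (∅ : Set ℝ) := id
      have hb : (0 : ℝ) ∉ (∅ : Set ℝ) := id
      rw [← h0] at ha hb
      simp only [Set.mem_preimage, one_smul, zero_smul] at ha hb
      exact iff_of_false ha hb
    · have ha : (1 : ℝ) ∈ Set.univ := trivial
      have hb : (0 : ℝ) ∈ Set.univ := trivial
      rw [← h0] at ha hb
      simp only [Set.mem_preimage, one_smul, zero_smul] at ha hb
      exact iff_of_true ha hb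
  have hz : Continuous fun x : M => (⟨x, 0⟩ : TangentBundle 𝓘(ℝ, E) M) :=
    Bundle.Trivialization.continuous_zeroSection (F := E)
      (E := (TangentSpace 𝓘(ℝ, E) : M → Type u)) ℝ
  have h2 := (hA.preimage hz).eq_univ ⟨p.1, (hfib p).1 hp⟩
  exact Or.inr (Set.eq_univ_of_forall fun q => (hfib q).2 (h2 ▸ Set.mem_univ q.1 :))

end Topology

end Sasaki

/-! ### The tangent bundle as a Suslin metric space -/

namespace DistSpace

lemma isMorphism_of_le {X : DistSpace.{u}} {Y : DistSpace.{v}} [IsMetric X] [IsMetric Y]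
    [hne : Nonempty X] {f : X → Y} (hf : ∀ x x', Y.d (f x) (f x') ≤ X.d x x') : IsMorphism f where
  continuous := (LipschitzWith.of_edist_le hf).continuous
  linearGrowth := by
    obtain ⟨x⟩ := hne
    refine ⟨x, f x, 1, fun y => (hf x y).trans ?_⟩
    rw [ENNReal.coe_one, one_mul]
    exact le_add_self

lemma hypot_add_le (a b a' b' : ℝ≥0∞) : hypot (a + a') (b + b') ≤ hypot a b + hypot a' b' := by
  have := ENNReal.Lp_add_le (Finset.univ : Finset (Fin 2)) ![a, b] ![a', b'] (p := 2) (by norm_num)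
  simpa [hypot, Fin.sum_univ_two] using this

end DistSpace

namespace Sasaki

section

variable {E : Type u} [NormedAddCommGroup E] [NormedSpace ℝ E] [FiniteDimensional ℝ E]
  {M : Type v} [TopologicalSpace M] [ChartedSpace E M] [IsManifold 𝓘(ℝ, E) ∞ M]
  [RiemannianBundle (fun x : M => TangentSpace 𝓘(ℝ, E) x)]

/-- The projection of the tangent bundle does not increase distances: it shortens paths. -/
lemma riemannianEDist_proj_le (p q : TangentBundle 𝓘(ℝ, E) M) :
    riemannianEDist 𝓘(ℝ, E) p.1 q.1 ≤ sasakiEDist p q := by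
  unfold sasakiEDist
  rw [riemannianEDist, riemannianEDist]
  refine le_iInf₂ fun γ hγ => ?_
  have hπ : ContMDiff 𝓘(ℝ, E).tangent 𝓘(ℝ, E) 1 (fun q : TangentBundle 𝓘(ℝ, E) M => q.1) :=
    (contMDiff_proj (TangentSpace 𝓘(ℝ, E) : M → Type u))
  have hπc : ContMDiff (𝓡∂ 1) 𝓘(ℝ, E) 1 (γ.map hπ.continuous) := hπ.comp hγ
  refine iInf₂_le_of_le (γ.map hπ.continuous) hπc (lintegral_mono fun t => ?_)
  have h1 : mfderiv (𝓡∂ 1) 𝓘(ℝ, E) (γ.map hπ.continuous) t 1 =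
      mfderiv 𝓘(ℝ, E).tangent 𝓘(ℝ, E) (fun q : TangentBundle 𝓘(ℝ, E) M => q.1) (γ t)
        (mfderiv (𝓡∂ 1) 𝓘(ℝ, E).tangent γ t 1) := by
    have h2 := mfderiv_comp t (hπ.mdifferentiableAt one_ne_zero)
      (hγ.mdifferentiableAt one_ne_zero) (I := 𝓡∂ 1) (I' := 𝓘(ℝ, E).tangent) (I'' := 𝓘(ℝ, E))
    exact DFunLike.congr_fun h2 1
  change ‖mfderiv (𝓡∂ 1) 𝓘(ℝ, E) (γ.map hπ.continuous) t 1‖ₑ ≤ _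
  rw [h1]
  exact enorm_mfderiv_proj_le (γ t) _

section

variable [IsContMDiffRiemannianBundle 𝓘(ℝ, E) ∞ E (fun x : M => TangentSpace 𝓘(ℝ, E) x)]
  [RegularSpace (TangentBundle 𝓘(ℝ, E) M)]

/-- Points at finite distance from `p` form a set which is open and closed. -/
lemma sasakiEDist_ne_top [PreconnectedSpace M] (p q : TangentBundle 𝓘(ℝ, E) M) :
    sasakiEDist p q ≠ ⊤ := by
  have := preconnectedSpace_tangentBundle E M
  have hball : ∀ q : TangentBundle 𝓘(ℝ, E) M, {r | sasakiEDist q r < ⊤} ∈ 𝓝 q := fun q =>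
    (nhds_basis_sasakiEDist q).mem_of_mem ENNReal.zero_lt_top
  have ho : IsOpen {q | sasakiEDist p q < ⊤} := by
    refine isOpen_iff_mem_nhds.2 fun q hq => ?_
    filter_upwards [hball q] with r hr
    exact (sasakiEDist_triangle p q r).trans_lt (ENNReal.add_lt_top.2 ⟨hq, hr⟩)
  have hc : IsOpen {q | sasakiEDist p q < ⊤}ᶜ := by
    refine isOpen_iff_mem_nhds.2 fun q hq => ?_
    filter_upwards [hball q] with r hr hpr
    refine hq ((sasakiEDist_triangle p r q).trans_lt (ENNReal.add_lt_top.2 ⟨hpr, ?_⟩))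
    rw [sasakiEDist_comm]
    exact hr
  have huniv := (IsClopen.eq_univ ⟨isOpen_compl_iff.1 hc, ho⟩
    ⟨p, by simp [sasakiEDist_self]⟩ : {q | sasakiEDist p q < ⊤} = Set.univ)
  exact (huniv ▸ Set.mem_univ q : q ∈ {q | sasakiEDist p q < ⊤}).ne

/-- The topology of the Sasaki distance is the topology of the tangent bundle. -/
lemma topology_TM : DistSpace.instTopologicalSpaceCarrier (TM E M) =
    (inferInstance : TopologicalSpace (TangentBundle 𝓘(ℝ, E) M)) :=
  (DistSpace.topology_eq (X := TM E M) sasakiEDist_comm sasakiEDist_triangle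
    (inferInstance : TopologicalSpace (TangentBundle 𝓘(ℝ, E) M)) nhds_basis_sasakiEDist).symm

end

end

section

variable (E : Type u) [NormedAddCommGroup E] [NormedSpace ℝ E] [FiniteDimensional ℝ E]
  (M : Type v) [TopologicalSpace M] [T2Space M] [SecondCountableTopology M] [PreconnectedSpace M]
  [ChartedSpace E M] [IsManifold 𝓘(ℝ, E) ∞ M]
  [RiemannianBundle (fun x : M => TangentSpace 𝓘(ℝ, E) x)]
  [IsContMDiffRiemannianBundle 𝓘(ℝ, E) ∞ E (fun x : M => TangentSpace 𝓘(ℝ, E) x)]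

instance isMetric_TM : DistSpace.IsMetric (TM E M) :=
  have := t2Space_tangentBundle E M
  have := regularSpace_tangentBundle E M
  { d_comm := sasakiEDist_comm (E := E) (M := M)
    d_triangle := sasakiEDist_triangle (E := E) (M := M)
    eq_of_d_eq_zero := fun p q h => by
      by_contra hne
      obtain ⟨c, hc, hcs⟩ := (nhds_basis_sasakiEDist (E := E) (M := M) p).mem_iff.1
        ((isOpen_ne (X := TangentBundle 𝓘(ℝ, E) M) (x := q)).mem_nhds hne)
      exact hcs (show sasakiEDist (E := E) (M := M) p q < c from h.trans_lt hc) rfl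
    d_ne_top := sasakiEDist_ne_top (E := E) (M := M) }

instance isSuslin_TM : DistSpace.IsSuslin (TM E M) := by
  have := t2Space_tangentBundle E M
  have := regularSpace_tangentBundle E M
  have := locallyCompact_tangentBundle E M
  have := secondCountable_tangentBundle E M
  refine { separable := ?_, analytic := ?_ }
  · rw [topology_TM]
    exact inferInstanceAs (TopologicalSpace.SeparableSpace (TangentBundle 𝓘(ℝ, E) M))
  · have : SigmaCompactSpace (TM E M) := by
      rw [topology_TM]
      exact inferInstanceAs (SigmaCompactSpace (TangentBundle 𝓘(ℝ, E) M))
    exact isAnalyticSpace_of_sigmaCompact _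

end

end Sasaki

/-! ### Pairs of tangent vectors at the same point -/

namespace Sasaki

open DistSpace

section

variable (E : Type u) [NormedAddCommGroup E] [NormedSpace ℝ E] [FiniteDimensional ℝ E]
  (M : Type v) [TopologicalSpace M] [ChartedSpace E M] [IsManifold 𝓘(ℝ, E) ∞ M]
  [RiemannianBundle (fun x : M => TangentSpace 𝓘(ℝ, E) x)]

/-- Two tangent vectors with the same base point, as a point of `T²M`. -/
def pairT2M (v : {v : TM E M × TM E M // TotalSpace.proj v.1 = TotalSpace.proj v.2}) : T2M E M :=
  ⟨v.1.1.1, v.1.1.2, v.2 ▸ v.1.2.2⟩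

lemma mk_pairT2M_right (v : {v : TM E M × TM E M // TotalSpace.proj v.1 = TotalSpace.proj v.2}) :
    (⟨(pairT2M E M v).1, (pairT2M E M v).2.2⟩ : TangentBundle 𝓘(ℝ, E) M) = v.1.2 := by
  obtain ⟨⟨⟨x, v⟩, ⟨y, w⟩⟩, h⟩ := v
  obtain rfl : x = y := h
  rfl

lemma d_pairT2M (v v' : {v : TM E M × TM E M // TotalSpace.proj v.1 = TotalSpace.proj v.2}) :
    (T2M E M).d (pairT2M E M v) (pairT2M E M v') =
      hypot ((TM E M).d v.1.1 v'.1.1) ((TM E M).d v.1.2 v'.1.2) := by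
  conv_rhs => rw [← mk_pairT2M_right E M v, ← mk_pairT2M_right E M v']
  rfl

lemma pairT2M_surjective : Function.Surjective (pairT2M E M) :=
  fun p => ⟨⟨(⟨p.1, p.2.1⟩, ⟨p.1, p.2.2⟩), rfl⟩, rfl⟩

end

section

variable (E : Type u) [NormedAddCommGroup E] [NormedSpace ℝ E] [FiniteDimensional ℝ E]
  (M : Type v) [TopologicalSpace M] [T2Space M] [PreconnectedSpace M]
  [ChartedSpace E M] [IsManifold 𝓘(ℝ, E) ∞ M]
  [RiemannianBundle (fun x : M => TangentSpace 𝓘(ℝ, E) x)]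
  [IsContMDiffRiemannianBundle 𝓘(ℝ, E) ∞ E (fun x : M => TangentSpace 𝓘(ℝ, E) x)]

instance isMetric_T2M : IsMetric (T2M E M) where
  d_comm p q := congrArg₂ hypot ((isMetric_TM E M).d_comm _ _) ((isMetric_TM E M).d_comm _ _)
  d_triangle p q r := (hypot_mono ((isMetric_TM E M).d_triangle _ ⟨q.1, q.2.1⟩ _)
    ((isMetric_TM E M).d_triangle _ ⟨q.1, q.2.2⟩ _)).trans (hypot_add_le _ _ _ _)
  eq_of_d_eq_zero := by
    rintro ⟨x, v₁, v₂⟩ ⟨y, w₁, w₂⟩ h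
    have h1 := (isMetric_TM E M).eq_of_d_eq_zero ⟨x, v₁⟩ ⟨y, w₁⟩
      (le_antisymm ((le_hypot_left _ _).trans h.le) zero_le)
    have h2 := (isMetric_TM E M).eq_of_d_eq_zero ⟨x, v₂⟩ ⟨y, w₂⟩
      (le_antisymm ((le_hypot_right _ _).trans h.le) zero_le)
    obtain ⟨rfl, h1'⟩ := TotalSpace.mk.inj h1
    obtain ⟨-, h2'⟩ := TotalSpace.mk.inj h2
    rw [eq_of_heq h1', eq_of_heq h2']
  d_ne_top p q := ne_top_of_le_ne_top (ENNReal.add_ne_top.2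
    ⟨(isMetric_TM E M).d_ne_top _ _, (isMetric_TM E M).d_ne_top _ _⟩) (hypot_le_add _ _)

lemma continuous_pairT2M : Continuous (pairT2M E M) := by
  refine LipschitzWith.continuous (K := 2) fun v v' => ?_
  refine ((d_pairT2M E M v v').trans_le (hypot_le_add _ _)).trans ?_
  rw [ENNReal.coe_ofNat, two_mul]
  exact add_le_add (le_max_left _ _) (le_max_right _ _)

variable [SecondCountableTopology M]

lemma measurableSet_eq_proj :
    MeasurableSet {v : TM E M × TM E M | TotalSpace.proj v.1 = TotalSpace.proj v.2} := by
  have hπ : Continuous fun p : TM E M => TotalSpace.proj p := by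
    have := regularSpace_tangentBundle E M
    rw [topology_TM]
    exact FiberBundle.continuous_proj E (TangentSpace 𝓘(ℝ, E) : M → Type u)
  exact (isClosed_eq (hπ.comp continuous_fst) (hπ.comp continuous_snd)).measurableSet

instance isSuslin_T2M : IsSuslin (T2M E M) where
  separable := (pairT2M_surjective E M).denseRange.separableSpace (continuous_pairT2M E M)
  analytic := (((isSuslin_TM E M).analytic.prod (isSuslin_TM E M).analytic).subtype
    (measurableSet_eq_proj E M)).of_surjective (continuous_pairT2M E M).measurable
      (pairT2M_surjective E M)

end

end Sasaki

section

open Sasaki DistSpace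

variable (E : Type u) [NormedAddCommGroup E] [NormedSpace ℝ E] [FiniteDimensional ℝ E]
  (M : Type v) [MetricSpace M] [ChartedSpace E M] [IsManifold 𝓘(ℝ, E) ∞ M]
  [RiemannianBundle (fun x : M => TangentSpace 𝓘(ℝ, E) x)]
  [ConnectedSpace M]

instance : Nonempty (TM E M) := ⟨⟨Classical.arbitrary M, 0⟩⟩

instance : Nonempty (T2M E M) := ⟨⟨Classical.arbitrary M, 0, 0⟩⟩

/-- The map `(π₁, π₂)` is an isometric bijection from `T²M` to the fiber product. -/
lemma linearlyGrowingAntecedents_proj (h : ∀ p, baseProj E M (proj₁ E M p) =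
    baseProj E M (proj₂ E M p)) :
    LinearlyGrowingAntecedents (Y := fiberProd (baseProj E M) (baseProj E M)) (fiberLift h) := by
  have key : ∀ y : fiberProd (baseProj E M) (baseProj E M), ∃ p, fiberLift h p = y := by
    rintro ⟨⟨p, q⟩, hpq⟩
    exact ⟨pairT2M E M ⟨(p, q), hpq⟩,
      Subtype.ext (Prod.ext rfl (mk_pairT2M_right E M ⟨(p, q), hpq⟩))⟩
  refine ⟨key, Classical.arbitrary _, 1, fun y => ?_⟩
  obtain ⟨p, rfl⟩ := key y
  refine ⟨p, rfl, ?_⟩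
  rw [ENNReal.coe_one, one_mul]
  exact le_add_self

variable [IsContMDiffRiemannianBundle 𝓘(ℝ, E) ∞ E (fun x : M => TangentSpace 𝓘(ℝ, E) x)]

lemma isMorphism_baseProj [IsRiemannianManifold 𝓘(ℝ, E) M] : IsMorphism (baseProj E M) :=
  isMorphism_of_le fun p q =>
    (IsRiemannianManifold.out (I := 𝓘(ℝ, E)) _ _).trans_le (riemannianEDist_proj_le p q)

lemma isMorphism_proj₁ : IsMorphism (proj₁ E M) :=
  isMorphism_of_le fun _ _ => le_hypot_left _ _

lemma isMorphism_proj₂ : IsMorphism (proj₂ E M) :=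
  isMorphism_of_le fun _ _ => le_hypot_right _ _

/-- Couplings of velocity plans at all levels of the hierarchy. -/
theorem exists_linearlyGrowingAntecedents_proj [IsRiemannianManifold 𝓘(ℝ, E) M]
    [SecondCountableTopology M] [CompleteSpace M] (n : ℕ) :
    ∃ comm : ∀ α, iterMap (baseProj E M) n (iterMap (proj₁ E M) n α) =
        iterMap (baseProj E M) n (iterMap (proj₂ E M) n α),
      LinearlyGrowingAntecedents
        (Y := fiberProd (iterMap (baseProj E M) n) (iterMap (baseProj E M) n)) (fiberLift comm) :=
  exists_linearlyGrowingAntecedents_iterMap (isMorphism_baseProj E M) (isMorphism_baseProj E M)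
    (isMorphism_proj₁ E M) (isMorphism_proj₂ E M) (fun _ => rfl)
    (linearlyGrowingAntecedents_proj E M _) n

end

end

/-- Part 1: couplings between velocity plans over a complete connected Riemannian manifold.
Part 2: the hierarchical gluing statement for Polish spaces and `P`.
Part 3: the hierarchical gluing statement for Polish metric spaces and `P₂`. -/
theorem mainTheorem4 :
    (∀ (E : Type u) [NormedAddCommGroup E] [NormedSpace ℝ E] [FiniteDimensional ℝ E]
      (M : Type v) [MetricSpace M] [ChartedSpace E M] [IsManifold 𝓘(ℝ, E) ∞ M]
      [RiemannianBundle (fun x : M => TangentSpace 𝓘(ℝ, E) x)]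
      [IsContMDiffRiemannianBundle 𝓘(ℝ, E) ∞ E (fun x : M => TangentSpace 𝓘(ℝ, E) x)]
      [IsRiemannianManifold 𝓘(ℝ, E) M] [SecondCountableTopology M] [ConnectedSpace M]
      [CompleteSpace M] (n : ℕ),
      DistSpace.IsMorphism (DistSpace.iterMap (baseProj E M) n) ∧
      DistSpace.IsMorphism (DistSpace.iterMap (proj₁ E M) n) ∧
      DistSpace.IsMorphism (DistSpace.iterMap (proj₂ E M) n) ∧
      (∃ comm : ∀ α, DistSpace.iterMap (baseProj E M) n (DistSpace.iterMap (proj₁ E M) n α) =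
          DistSpace.iterMap (baseProj E M) n (DistSpace.iterMap (proj₂ E M) n α),
        Function.Surjective (fiberLift comm)) ∧
      ∀ μ, ∀ γ₁ ∈ velocityPlans E M n μ, ∀ γ₂ ∈ velocityPlans E M n μ,
        (couplings E M n γ₁ γ₂).Nonempty) ∧
    (∀ (W : Type u) (X : Type v) (Y : Type w) (Z : Type z)
      [TopologicalSpace W] [PolishSpace W] [TopologicalSpace X] [PolishSpace X]
      [TopologicalSpace Y] [PolishSpace Y] [TopologicalSpace Z] [PolishSpace Z]
      (f₁ : C(X, Z)) (f₂ : C(Y, Z)) (g₁ : C(W, X)) (g₂ : C(W, Y))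
      (h : ∀ w, f₁ (g₁ w) = f₂ (g₂ w)),
      Function.Surjective (fiberLift h) →
      ∀ n : ℕ, ∃ comm : ∀ α : WeakHierarchy.iter (TopCat.of W) n,
          WeakHierarchy.iterMap (X := TopCat.of X) (Y := TopCat.of Z) f₁ n
            (WeakHierarchy.iterMap (X := TopCat.of W) (Y := TopCat.of X) g₁ n α) =
          WeakHierarchy.iterMap (X := TopCat.of Y) (Y := TopCat.of Z) f₂ n
            (WeakHierarchy.iterMap (X := TopCat.of W) (Y := TopCat.of Y) g₂ n α),
        Function.Surjective (fiberLift comm)) ∧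
    (∀ (W : Type u) (X : Type v) (Y : Type w) (Z : Type z)
      [MetricSpace W] [PolishSpace W] [MetricSpace X] [PolishSpace X]
      [MetricSpace Y] [PolishSpace Y] [MetricSpace Z] [PolishSpace Z]
      (f₁ : DistSpace.of X → DistSpace.of Z) (f₂ : DistSpace.of Y → DistSpace.of Z)
      (g₁ : DistSpace.of W → DistSpace.of X) (g₂ : DistSpace.of W → DistSpace.of Y)
      (_ : DistSpace.IsMorphism f₁) (_ : DistSpace.IsMorphism f₂)
      (_ : DistSpace.IsMorphism g₁) (_ : DistSpace.IsMorphism g₂)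
      (h : ∀ w, f₁ (g₁ w) = f₂ (g₂ w)),
      DistSpace.LinearlyGrowingAntecedents (Y := DistSpace.fiberProd f₁ f₂) (fiberLift h) →
      ∀ n : ℕ,
        DistSpace.IsMorphism (DistSpace.iterMap f₁ n) ∧
        DistSpace.IsMorphism (DistSpace.iterMap f₂ n) ∧
        DistSpace.IsMorphism (DistSpace.iterMap g₁ n) ∧
        DistSpace.IsMorphism (DistSpace.iterMap g₂ n) ∧
        ∃ comm : ∀ α, DistSpace.iterMap f₁ n (DistSpace.iterMap g₁ n α) =
            DistSpace.iterMap f₂ n (DistSpace.iterMap g₂ n α),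
          DistSpace.LinearlyGrowingAntecedents
            (Y := DistSpace.fiberProd (DistSpace.iterMap f₁ n) (DistSpace.iterMap f₂ n))
            (fiberLift comm)) := by
  refine ⟨?_, ?_, ?_⟩
  · intro E _ _ _ M _ _ _ _ _ _ _ _ _ n
    obtain ⟨comm, hL⟩ := exists_linearlyGrowingAntecedents_proj E M n
    refine ⟨(isMorphism_baseProj E M).iterMap n, (isMorphism_proj₁ E M).iterMap n,
      (isMorphism_proj₂ E M).iterMap n, ⟨comm, hL.1⟩, fun μ γ₁ h₁ γ₂ h₂ => ?_⟩
    obtain ⟨α, hα⟩ := hL.1 ⟨(γ₁, γ₂), Eq.trans h₁ (Eq.symm h₂)⟩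
    have h := congrArg Subtype.val hα
    exact ⟨α, congrArg Prod.fst h, congrArg Prod.snd h⟩
  · intro W X Y Z _ _ _ _ _ _ _ _ f₁ f₂ g₁ g₂ h hs n
    exact WeakHierarchy.exists_surjective_fiberLift_iterMap (W := TopCat.of W) (X := TopCat.of X)
      (Y := TopCat.of Y) (Z := TopCat.of Z) h hs n
  · intro W X Y Z _ _ _ _ _ _ _ _ f₁ f₂ g₁ g₂ hf₁ hf₂ hg₁ hg₂ h hL n
    exact ⟨hf₁.iterMap n, hf₂.iterMap n, hg₁.iterMap n, hg₂.iterMap n,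
      DistSpace.exists_linearlyGrowingAntecedents_iterMap hf₁ hf₂ hg₁ hg₂ h hL n⟩
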